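/- **Theorem (Triharmonic Green Formula).** Let $N\ge 1$ and let $\Omega\subset\mathbb R^N$ be a bounded domain of class $C^{0,1}$, with outer unit normal $n$ (defined almost everywhere on $\partial\Omega$) and surface measure $dS$. Let $f\in C^6(\overline\Omega)$ and $\varphi\in C^3(\overline\Omega)$ be real-valued. *Notation.* $D^3f:D^3\varphi=\sum_{i,j,k}\partial_{ijk}f\,\partial_{ijk}\varphi$ and $A:B=\sum_{i,j}A_{ij}B_{ij}$ for matrices. On $\partial\Omega$: $\frac{\partial g}{\partial n}=\sum_i n_i\partial_i g$, $\frac{\partial^2 g}{\partial n^2}=\sum_{i,j}n_in_j\partial_{ij}g$, $\frac{\partial^3 g}{\partial n^3}=\sum_{i,j,k}n_in_jn_k\partial_{ijk}g$; $n^TD^2g$ is the vector $\big(\sum_i n_i\partial_{ij}g\big)_j$, $n^TD^3f$ is the matrix $\big(\sum_i n_i\partial_{ijk}f\big)_{jk}$, and $D^3f[n\otimes n]$ is the vector $\big(\sum_{j,k}\partial_{ijk}f\,n_jn_k\big)_i$. Let $P=I-n\otimes n$. The tangential part of a vector $v$ is $(v)_{\partial\Omega}=Pv$, that of a matrix $A$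 is $(A)_{\partial\Omega}=AP$ (its rows are projected onto the tangent space), and $\nabla_{\partial\Omega}\varphi=\nabla\varphi-\frac{\partial\varphi}{\partial n}n$. If $\Omega$ is of class $C^3$, then for a $C^1$ vector field $v$ on $\partial\Omega$ with a $C^1$ extension $V$ to a neighbourhood of $\partial\Omega$, put $D_{\partial\Omega}v=(DV)P$, where $(DV)_{ij}=\partial_jV_i$, and $\operatorname{div}_{\partial\Omega}v=\operatorname{tr}D_{\partial\Omega}v$ (these do not depend on $V$). For a matrix field $A$, $\operatorname{div}_{\partial\Omega}A$ is the vector of the tangential divergences of the rows of $A$, and $\operatorname{div}^2_{\partial\Omega}A=\operatorname{div}_{\partial\Omega}\big((\operatorname{div}_{\partial\Omega}A)_{\partial\Omega}\big)$. (i) All the integrands below are integrable, and $$\int_\Omega D^3f:D^3\varphi\,dx=-\int_\Omega\Delta^3f\,\varphi\,dx+\int_{\partial\Omega}(n^TD^3f):D^2\varphi\,dS-\int_{\partial\Omega}(n^TD^2(\Delta f))_{\partial\Omega}\cdot\nabla_{\partial\Omega}\varphi\,dS-\int_{\partial\Omega}\frac{\partial^2(\Delta f)}{\partial n^2}\frac{\partial\varphi}{\partial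 n}\,dS+\int_{\partial\Omega}\frac{\partial(\Delta^2f)}{\partial n}\varphi\,dS.$$ (ii) If moreover $\Omega$ is of class $C^3$, then all the integrands below are integrable, and $$\begin{aligned}\int_\Omega D^3f:D^3\varphi\,dx=&-\int_\Omega\Delta^3f\,\varphi\,dx+\int_{\partial\Omega}\frac{\partial^3f}{\partial n^3}\frac{\partial^2\varphi}{\partial n^2}\,dS\\&+\int_{\partial\Omega}\Big((n^TD^3f)_{\partial\Omega}:D_{\partial\Omega}n-\frac{\partial^2(\Delta f)}{\partial n^2}-2\operatorname{div}_{\partial\Omega}\big(D^3f[n\otimes n]\big)_{\partial\Omega}\Big)\frac{\partial\varphi}{\partial n}\,dS\\&+\int_{\partial\Omega}\Big(\operatorname{div}^2_{\partial\Omega}\big((n^TD^3f)_{\partial\Omega}\big)+\operatorname{div}_{\partial\Omega}\big(D_{\partial\Omega}n\,(D^3f[n\otimes n])_{\partial\Omega}\big)+\frac{\partial(\Delta^2f)}{\partial n}+\operatorname{div}_{\partial\Omega}\big(n^TD^2(\Delta f)\big)_{\partial\Omega}\Big)\varphi\,dS.\end{aligned}$$ -/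

import Mathlib

open MeasureTheory Set Filter Topology
open scoped Matrix RealInnerProductSpace

noncomputable section

namespace TriharmonicGreen

/-- Euclidean space of dimension `N`. -/
abbrev Rn (N : ℕ) : Type := EuclideanSpace ℝ (Fin N)

/-! ### Domains, surface measure, outer normal -/

/-- A bounded domain: a bounded, nonempty, connected open set. -/
def IsBoundedDomain {N : ℕ} (Ω : Set (Rn N)) : Prop :=
  IsOpen Ω ∧ IsConnected Ω ∧ Bornology.IsBounded Ω

/-- Near `x₀` the set `Ω` is the open set strictly above the graph of the function `γ` of the
`N - 1` variables orthogonal to the unit vector `e`, which plays the role of the vertical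
direction. -/
def IsGraphNear {N : ℕ} (Ω : Set (Rn N)) (x₀ e : Rn N)
    (γ : ((Submodule.span ℝ {e})ᗮ : Submodule ℝ (Rn N)) → ℝ) : Prop :=
  ‖e‖ = 1 ∧ ∀ᶠ x in 𝓝 x₀,
    (x ∈ Ω ↔ γ ((Submodule.span ℝ {e})ᗮ.orthogonalProjectionOnto x) < ⟪e, x⟫)

/-- Boundary of class `C^{0,1}`: locally `Ω` lies above the graph of a Lipschitz function. -/
def HasLipschitzBoundary {N : ℕ} (Ω : Set (Rn N)) : Prop :=
  ∀ x₀ ∈ frontier Ω, ∃ (e : Rn N) (γ : ((Submodule.span ℝ {e})ᗮ : Submodule ℝ (Rn N)) → ℝ),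
    (∃ K, LipschitzWith K γ) ∧ IsGraphNear Ω x₀ e γ

/-- Boundary of class `C^k`: locally `Ω` lies above the graph of a `C^k` function. -/
def HasContDiffBoundary {N : ℕ} (k : ℕ) (Ω : Set (Rn N)) : Prop :=
  ∀ x₀ ∈ frontier Ω, ∃ (e : Rn N) (γ : ((Submodule.span ℝ {e})ᗮ : Submodule ℝ (Rn N)) → ℝ),
    ContDiff ℝ k γ ∧ IsGraphNear Ω x₀ e γ

/-- The surface measure `dS` on `∂Ω`: the `(N-1)`-dimensional Hausdorff measure, normalised to
agree with Lebesgue measure on hyperplanes, restricted to `∂Ω`. -/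
def surfaceMeasure {N : ℕ} (Ω : Set (Rn N)) : Measure (Rn N) :=
  (Measure.euclideanHausdorffMeasure (N - 1)).restrict (frontier Ω)

/-- `ν` is the outer unit normal to `Ω` at `x`: close to `x`, `Ω` contains every cone around `-ν`,
and is disjoint from every cone around `ν`, with vertex `x` and aperture less than a half-space.
For a graph this says that the graph has a tangent hyperplane at `x`, orthogonal to `ν`, and
that `ν` points away from `Ω`. -/
def IsOuterUnitNormal {N : ℕ} (Ω : Set (Rn N)) (x ν : Rn N) : Prop :=
  ‖ν‖ = 1 ∧ ∀ ε > (0 : ℝ), ∀ᶠ y in 𝓝 x,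
    (⟪ν, y - x⟫ < -ε * ‖y - x‖ → y ∈ Ω) ∧ (ε * ‖y - x‖ < ⟪ν, y - x⟫ → y ∉ Ω)

/-- The outer unit normal is unique. -/
theorem IsOuterUnitNormal.unique {N : ℕ} {Ω : Set (Rn N)} {x ν μ : Rn N}
    (h₁ : IsOuterUnitNormal Ω x ν) (h₂ : IsOuterUnitNormal Ω x μ) : ν = μ := by
  by_contra hne
  have hlt : ⟪ν, μ⟫ < 1 := inner_lt_one_iff_real_of_norm_eq_one h₁.1 h₂.1 |>.2 hne
  set w : Rn N := μ - ν with hw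
  have hν : ⟪ν, w⟫ = ⟪ν, μ⟫ - 1 := by
    rw [hw, inner_sub_right, real_inner_self_eq_norm_sq, h₁.1]; norm_num
  have hμ : ⟪μ, w⟫ = 1 - ⟪ν, μ⟫ := by
    rw [hw, inner_sub_right, real_inner_self_eq_norm_sq, h₂.1, real_inner_comm]; norm_num
  have hw0 : 0 < ‖w‖ := norm_pos_iff.2 (sub_ne_zero.2 (Ne.symm hne))
  set ε : ℝ := (1 - ⟪ν, μ⟫) / (2 * ‖w‖) with hε
  have hε0 : 0 < ε := div_pos (by linarith) (by positivity)
  have hεw : ε * ‖w‖ = (1 - ⟪ν, μ⟫) / 2 := by rw [hε]; field_simp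
  have hlim : Tendsto (fun s : ℝ => x + s • w) (𝓝[>] 0) (𝓝 x) := by
    have : Continuous fun s : ℝ => x + s • w := by fun_prop
    simpa using (this.tendsto 0).mono_left nhdsWithin_le_nhds
  obtain ⟨s, ⟨hs₁, hs₂⟩, hs⟩ := ((hlim.eventually (h₁.2 ε hε0)).and
    (hlim.eventually (h₂.2 ε hε0)) |>.and self_mem_nhdsWithin).exists
  replace hs : 0 < s := hs
  have e : x + s • w - x = s • w := by abel
  rw [e, inner_smul_right, norm_smul, Real.norm_of_nonneg hs.le] at hs₁ hs₂
  refine hs₂.2 ?_ (hs₁.1 ?_)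
  · rw [hμ]; nlinarith
  · rw [hν]; nlinarith

open Classical in
/-- The outer unit normal `n(x)`; the value is `0` at the points where there is none. -/
def normal {N : ℕ} (Ω : Set (Rn N)) (x : Rn N) : Rn N :=
  if h : ∃ ν, IsOuterUnitNormal Ω x ν then h.choose else 0

theorem IsOuterUnitNormal.normal_eq {N : ℕ} {Ω : Set (Rn N)} {x ν : Rn N}
    (h : IsOuterUnitNormal Ω x ν) : normal Ω x = ν := by
  have h' : ∃ ν, IsOuterUnitNormal Ω x ν := ⟨ν, h⟩
  rw [normal, dif_pos h']
  exact h'.choose_spec.unique h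

/-! ### Derivatives up to the boundary

A function of class `C^k` on the closed set `closure Ω` has derivatives up to the boundary; they
are taken relative to `closure Ω`. In `Ω` these are the ordinary derivatives, and on `∂Ω` their
continuous extensions. -/

/-- `∂g/∂xᵢ` on the closure of `Ω`. -/
def pd {N : ℕ} (Ω : Set (Rn N)) (i : Fin N) (g : Rn N → ℝ) (x : Rn N) : ℝ :=
  fderivWithin ℝ g (closure Ω) x (EuclideanSpace.single i 1)

/-- The gradient `∇g`. -/
def grad {N : ℕ} (Ω : Set (Rn N)) (g : Rn N → ℝ) (x : Rn N) : Rn N :=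
  WithLp.toLp 2 fun i => pd Ω i g x

/-- The Hessian matrix `D²g`. -/
def hess {N : ℕ} (Ω : Set (Rn N)) (g : Rn N → ℝ) (x : Rn N) : Matrix (Fin N) (Fin N) ℝ :=
  Matrix.of fun i j => pd Ω i (pd Ω j g) x

/-- The tensor `D³g` of third derivatives. -/
def third {N : ℕ} (Ω : Set (Rn N)) (g : Rn N → ℝ) (x : Rn N) (i j k : Fin N) : ℝ :=
  pd Ω i (pd Ω j (pd Ω k g)) x

/-- The Laplacian `Δg` on the closure of `Ω`. -/
def lap {N : ℕ} (Ω : Set (Rn N)) (g : Rn N → ℝ) : Rn N → ℝ :=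
  InnerProductSpace.laplacianWithin g (closure Ω)

/-- `A : B = ∑ᵢⱼ Aᵢⱼ Bᵢⱼ` for matrices. -/
def colon {N : ℕ} (A B : Matrix (Fin N) (Fin N) ℝ) : ℝ := ∑ i, ∑ j, A i j * B i j

/-- `D³f : D³φ = ∑ᵢⱼₖ ∂ᵢⱼₖf ∂ᵢⱼₖφ`. -/
def thirdColon {N : ℕ} (Ω : Set (Rn N)) (f φ : Rn N → ℝ) (x : Rn N) : ℝ :=
  ∑ i, ∑ j, ∑ k, third Ω f x i j k * third Ω φ x i j k

/-! ### Contractions with the normal on `∂Ω` -/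

/-- `∂g/∂n = ∑ᵢ nᵢ ∂ᵢg`. -/
def dn {N : ℕ} (Ω : Set (Rn N)) (g : Rn N → ℝ) (x : Rn N) : ℝ :=
  ∑ i, normal Ω x i * pd Ω i g x

/-- `∂²g/∂n² = ∑ᵢⱼ nᵢ nⱼ ∂ᵢⱼg`. -/
def dnn {N : ℕ} (Ω : Set (Rn N)) (g : Rn N → ℝ) (x : Rn N) : ℝ :=
  ∑ i, ∑ j, normal Ω x i * normal Ω x j * hess Ω g x i j

/-- `∂³g/∂n³ = ∑ᵢⱼₖ nᵢ nⱼ nₖ ∂ᵢⱼₖg`. -/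
def dnnn {N : ℕ} (Ω : Set (Rn N)) (g : Rn N → ℝ) (x : Rn N) : ℝ :=
  ∑ i, ∑ j, ∑ k, normal Ω x i * normal Ω x j * normal Ω x k * third Ω g x i j k

/-- The vector `nᵀD²g`. -/
def nHess {N : ℕ} (Ω : Set (Rn N)) (g : Rn N → ℝ) (x : Rn N) : Rn N :=
  WithLp.toLp 2 fun j => ∑ i, normal Ω x i * hess Ω g x i j

/-- The matrix `nᵀD³g`, with entries `∑ᵢ nᵢ ∂ᵢⱼₖg`. -/
def nThird {N : ℕ} (Ω : Set (Rn N)) (g : Rn N → ℝ) (x : Rn N) : Matrix (Fin N) (Fin N) ℝ :=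
  Matrix.of fun j k => ∑ i, normal Ω x i * third Ω g x i j k

/-- The vector `D³g[n ⊗ n]`, with components `∑ⱼₖ ∂ᵢⱼₖg nⱼ nₖ`. -/
def thirdNN {N : ℕ} (Ω : Set (Rn N)) (g : Rn N → ℝ) (x : Rn N) : Rn N :=
  WithLp.toLp 2 fun i => ∑ j, ∑ k, third Ω g x i j k * normal Ω x j * normal Ω x k

/-! ### Tangential calculus on `∂Ω` -/

/-- The matrix `I - n ⊗ n` of the orthogonal projection onto the tangent space of `∂Ω`. -/
def tangProj {N : ℕ} (Ω : Set (Rn N)) (x : Rn N) : Matrix (Fin N) (Fin N) ℝ :=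
  1 - Matrix.vecMulVec (normal Ω x) (normal Ω x)

/-- The tangential part `(v)_{∂Ω}` of a vector field. -/
def tangVec {N : ℕ} (Ω : Set (Rn N)) (v : Rn N → Rn N) (x : Rn N) : Rn N :=
  WithLp.toLp 2 (tangProj Ω x *ᵥ (v x : Fin N → ℝ))

/-- The tangential part `(A)_{∂Ω} = A (I - n ⊗ n)` of a matrix field: each row is projected onto
the tangent space, just as the tangential Jacobian matrix is the Jacobian matrix with each row
projected onto the tangent space. -/
def tangMat {N : ℕ} (Ω : Set (Rn N)) (A : Rn N → Matrix (Fin N) (Fin N) ℝ) (x : Rn N) :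
    Matrix (Fin N) (Fin N) ℝ :=
  A x * tangProj Ω x

/-- The tangential gradient `∇_{∂Ω} g = ∇g - (∂g/∂n) n`. -/
def tangGrad {N : ℕ} (Ω : Set (Rn N)) (g : Rn N → ℝ) (x : Rn N) : Rn N :=
  grad Ω g x - dn Ω g x • normal Ω x

/-- The tangential Jacobian matrix `D_{∂Ω} v` of a vector field on `∂Ω`. Its entry `(i, j)` is the
derivative of `vᵢ` along `∂Ω` in the direction of the tangential part of the `j`-th basis vector.
Only the values of `v` on `∂Ω` matter, and for a `C¹` extension `V` of `v` this is
`DV (I - n ⊗ n)`, see `tangJacobian_eq`. -/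
def tangJacobian {N : ℕ} (Ω : Set (Rn N)) (v : Rn N → Rn N) (x : Rn N) :
    Matrix (Fin N) (Fin N) ℝ :=
  Matrix.of fun i j =>
    fderivWithin ℝ v (frontier Ω) x (WithLp.toLp 2 fun k => tangProj Ω x k j) i

/-- Every direction orthogonal to the outer normal is a tangent direction of `∂Ω`. -/
theorem IsOuterUnitNormal.mem_tangentConeAt {N : ℕ} {Ω : Set (Rn N)} {x ν t : Rn N}
    (h : IsOuterUnitNormal Ω x ν) (ht : ⟪ν, t⟫ = 0) : t ∈ tangentConeAt ℝ (frontier Ω) x := by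
  have key : ∀ ε > (0 : ℝ), ∃ s r : ℝ, 0 < s ∧ s < ε ∧ |r| ≤ ε ∧
      x + s • (t + r • ν) ∈ frontier Ω := by
    intro ε hε
    set δ : ℝ := ε / (2 * (‖t‖ + ε)) with hδ
    have hδ0 : 0 < δ := by positivity
    have hlim : ∀ v : Rn N, Tendsto (fun s : ℝ => x + s • v) (𝓝[>] 0) (𝓝 x) := by
      intro v
      have : Continuous fun s : ℝ => x + s • v := by fun_prop
      simpa using (this.tendsto 0).mono_left nhdsWithin_le_nhds
    obtain ⟨s, ⟨hs₁, hs₂⟩, hs, hsε⟩ :=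
      (((hlim (t + (-ε) • ν)).eventually (h.2 δ hδ0)).and
        ((hlim (t + ε • ν)).eventually (h.2 δ hδ0)) |>.and
          (Ioo_mem_nhdsGT hε)).exists
    have hnorm : ∀ r : ℝ, |r| = ε → δ * ‖s • (t + r • ν)‖ < s * ε := by
      intro r hr
      have h1 : ‖t + r • ν‖ ≤ ‖t‖ + ε := by
        refine (norm_add_le _ _).trans ?_
        rw [norm_smul, h.1, Real.norm_eq_abs, hr, mul_one]
      have h2 : δ * (‖t‖ + ε) = ε / 2 := by rw [hδ]; field_simp
      rw [norm_smul, Real.norm_of_nonneg hs.le]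
      have h3 : δ * ‖t + r • ν‖ ≤ ε / 2 := h2 ▸ mul_le_mul_of_nonneg_left h1 hδ0.le
      nlinarith
    have hinner : ∀ r : ℝ, ⟪ν, s • (t + r • ν)⟫ = s * r := by
      intro r
      rw [inner_smul_right, inner_add_right, ht, inner_smul_right, real_inner_self_eq_norm_sq, h.1]
      ring
    have hin : x + s • (t + (-ε) • ν) ∈ Ω := by
      refine hs₁.1 ?_
      rw [add_sub_cancel_left, hinner]
      linarith [hnorm (-ε) (by rw [abs_neg, abs_of_pos hε])]
    have hout : x + s • (t + ε • ν) ∉ Ω := by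
      refine hs₂.2 ?_
      rw [add_sub_cancel_left, hinner]
      exact hnorm ε (abs_of_pos hε)
    have hpre : IsPreconnected ((fun r : ℝ => x + s • (t + r • ν)) '' Icc (-ε) ε) :=
      isPreconnected_Icc.image _ (by fun_prop)
    have hmem : ∀ r ∈ Icc (-ε) ε, x + s • (t + r • ν) ∈
        (fun r : ℝ => x + s • (t + r • ν)) '' Icc (-ε) ε := fun r hr => ⟨r, hr, rfl⟩
    by_contra! hno
    have hno' : ∀ r ∈ Icc (-ε) ε, x + s • (t + r • ν) ∉ frontier Ω := fun r hr =>
      hno s r hs hsε (abs_le.2 hr)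
    have hl : (-ε) ∈ Icc (-ε) ε := ⟨le_rfl, by linarith⟩
    have hu : ε ∈ Icc (-ε) ε := ⟨by linarith, le_rfl⟩
    have hin' : x + s • (t + (-ε) • ν) ∈ interior Ω := by
      by_contra hc
      exact hno' _ hl ⟨subset_closure hin, hc⟩
    have hout' : x + s • (t + ε • ν) ∈ (closure Ω)ᶜ := fun hc =>
      hno' _ hu ⟨hc, fun hi => hout (interior_subset hi)⟩
    obtain ⟨y, -, hy₁, hy₂⟩ := hpre (interior Ω) (closure Ω)ᶜ isOpen_interior
      isClosed_closure.isOpen_compl (by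
        rintro _ ⟨r, hr, rfl⟩
        by_contra hc
        rw [mem_union, not_or, notMem_compl_iff] at hc
        exact hno' r hr ⟨hc.2, hc.1⟩)
      ⟨_, hmem _ hl, hin'⟩ ⟨_, hmem _ hu, hout'⟩
    exact hy₂ (interior_subset_closure hy₁)
  choose! s r hs hsε hr hfr using key
  have hε : Tendsto (fun k : ℕ => (1 : ℝ) / ((k : ℝ) + 1)) atTop (𝓝 0) :=
    tendsto_one_div_add_atTop_nhds_zero_nat
  have hpos : ∀ k : ℕ, (0 : ℝ) < 1 / ((k : ℝ) + 1) := fun k => by positivity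
  have hs0 : Tendsto (fun k : ℕ => s (1 / ((k : ℝ) + 1))) atTop (𝓝 0) :=
    squeeze_zero (fun k => (hs _ (hpos k)).le) (fun k => (hsε _ (hpos k)).le) hε
  have hr0 : Tendsto (fun k : ℕ => r (1 / ((k : ℝ) + 1))) atTop (𝓝 0) :=
    squeeze_zero_norm (fun k => hr _ (hpos k)) hε
  have hv : Tendsto (fun k : ℕ => t + r (1 / ((k : ℝ) + 1)) • ν) atTop (𝓝 t) := by
    simpa using tendsto_const_nhds.add (hr0.smul_const ν)
  refine mem_tangentConeAt_of_seq atTop (fun k : ℕ => (s (1 / ((k : ℝ) + 1)))⁻¹)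
    (fun k : ℕ => s (1 / ((k : ℝ) + 1)) • (t + r (1 / ((k : ℝ) + 1)) • ν)) ?_
    (Eventually.of_forall fun k => hfr _ (hpos k)) ?_
  · simpa using hs0.smul hv
  · refine hv.congr fun k => ?_
    rw [inv_smul_smul₀ (hs _ (hpos k)).ne']

/-- The tangential Jacobian matrix can be computed from any derivative `L` of `v` along `∂Ω`, in
particular from the derivative of any extension of `v` to a neighbourhood of `x`. -/
theorem tangJacobian_eq {N : ℕ} {Ω : Set (Rn N)} {x ν : Rn N} (h : IsOuterUnitNormal Ω x ν)
    {v : Rn N → Rn N} {L : Rn N →L[ℝ] Rn N} (hL : HasFDerivWithinAt v L (frontier Ω) x)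
    (i j : Fin N) :
    tangJacobian Ω v x i j = L (WithLp.toLp 2 fun k => tangProj Ω x k j) i := by
  have hd : HasFDerivWithinAt v (fderivWithin ℝ v (frontier Ω) x) (frontier Ω) x :=
    hL.differentiableWithinAt.hasFDerivWithinAt
  have hmem : (WithLp.toLp 2 fun k => tangProj Ω x k j : Rn N) ∈
      tangentConeAt ℝ (frontier Ω) x := by
    apply h.mem_tangentConeAt
    have hsq : ∑ k, ν k * ν k = 1 := by
      have := real_inner_self_eq_norm_sq ν
      rw [h.1, PiLp.inner_apply] at this
      simpa [← pow_two] using this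
    simp only [PiLp.inner_apply, tangProj, h.normal_eq, Matrix.sub_apply, Matrix.vecMulVec_apply,
      Matrix.one_apply, RCLike.inner_apply, conj_trivial, sub_mul, Finset.sum_sub_distrib]
    have e : ∑ k, ν k * ν j * ν k = ν j := by
      calc ∑ k, ν k * ν j * ν k = ν j * ∑ k, ν k * ν k := by
            rw [Finset.mul_sum]
            exact Finset.sum_congr rfl fun k _ => by ring
        _ = ν j := by rw [hsq, mul_one]
    simp [e]
  simp only [tangJacobian, Matrix.of_apply]
  rw [hd.unique_on hL hmem]

/-- The tangential divergence `div_{∂Ω} v = tr (D_{∂Ω} v)`. -/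
def tangDiv {N : ℕ} (Ω : Set (Rn N)) (v : Rn N → Rn N) (x : Rn N) : ℝ :=
  (tangJacobian Ω v x).trace

/-- The tangential divergence of a matrix field, taken row by row. -/
def tangDivMat {N : ℕ} (Ω : Set (Rn N)) (A : Rn N → Matrix (Fin N) (Fin N) ℝ) (x : Rn N) : Rn N :=
  WithLp.toLp 2 fun i => tangDiv Ω (fun y => WithLp.toLp 2 (A y i)) x

/-- The second order tangential divergence `div²_{∂Ω} A`: the tangential divergence of the
tangential vector field `(div_{∂Ω} A)_{∂Ω}`. -/
def tangDivTwo {N : ℕ} (Ω : Set (Rn N)) (A : Rn N → Matrix (Fin N) (Fin N) ℝ) (x : Rn N) : ℝ :=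
  tangDiv Ω (tangVec Ω (tangDivMat Ω A)) x

/-- The curvature tensor `D_{∂Ω} n`. -/
def curvature {N : ℕ} (Ω : Set (Rn N)) (x : Rn N) : Matrix (Fin N) (Fin N) ℝ :=
  tangJacobian Ω (normal Ω) x

/-- The coefficient of `∂φ/∂n` in the boundary integral:
`(nᵀD³f)_{∂Ω} : D_{∂Ω}n - ∂²(Δf)/∂n² - 2 div_{∂Ω} (D³f[n ⊗ n])_{∂Ω}`. -/
def coeffNormal {N : ℕ} (Ω : Set (Rn N)) (f : Rn N → ℝ) (x : Rn N) : ℝ :=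
  colon (tangMat Ω (nThird Ω f) x) (curvature Ω x) - dnn Ω (lap Ω f) x
    - 2 * tangDiv Ω (tangVec Ω (thirdNN Ω f)) x

/-- The coefficient of `φ` in the boundary integral:
`div²_{∂Ω} ((nᵀD³f)_{∂Ω}) + div_{∂Ω} (D_{∂Ω}n (D³f[n ⊗ n])_{∂Ω}) + ∂(Δ²f)/∂n
+ div_{∂Ω} (nᵀD²(Δf))_{∂Ω}`. -/
def coeffValue {N : ℕ} (Ω : Set (Rn N)) (f : Rn N → ℝ) (x : Rn N) : ℝ :=
  tangDivTwo Ω (tangMat Ω (nThird Ω f)) x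
    + tangDiv Ω (fun y => WithLp.toLp 2
        (curvature Ω y *ᵥ (tangVec Ω (thirdNN Ω f) y : Fin N → ℝ))) x
    + dn Ω (lap Ω (lap Ω f)) x
    + tangDiv Ω (tangVec Ω (nHess Ω (lap Ω f))) x

end TriharmonicGreen

end

open TriharmonicGreen

/-!
The two formulas follow from a divergence theorem on `Ω`, a divergence theorem on `∂Ω`, and a
pointwise identity on `∂Ω`.

The divergence theorem on a Lipschitz domain. Above the graph of a Lipschitz function `γ` a volume
preserving shear straightens the boundary. By Fubini's theorem and the fundamental theorem of
calculus, `∫ ∂ᵥu` becomes an integral of `u` over the parameter hyperplane, with density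
`⟪∇γ - e, v⟫`, where `e` is the upward unit vector (`integral_fderiv_epi`). Rademacher's theorem
makes this density meaningful, and `(∇γ - e) / √(1 + |∇γ|²)` is the outer normal at every point of
differentiability. The area formula for graphs (`IsGraphParam.map_withDensity`), obtained by
comparing `γ` on small pieces with its differential, says that `√(1 + |∇γ|²)` is the density of the
`(N - 1)`-dimensional Hausdorff measure on the graph, so that the boundary term is
`∫ u ⟪n, v⟫ dS`. A partition of unity gives the general case, `integral_fderiv_eq_surface`.

The first formula. Green's first identity (`green_first`) is applied to the pair `∂ⱼₖf`, `∂ⱼₖφ`,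
then to `∂ₖΔf`, `∂ₖφ`, then to `Δ²f`, `φ`, and summed over the indices (`triharmonic_green`). The
middle boundary integrand is split into its tangential and normal parts at the points that have a
normal, which are almost all.

The second formula. On a domain of class `C³` the normal is of class `C²` along `∂Ω`, and every
tangential `C¹` field `w` on `∂Ω` satisfies `∫ div_{∂Ω} w dS = 0` (`integral_tangDiv_eq_zero`): in a
graph chart with area density `J`, if `ω` is the horizontal part of `w`, then
`J div_{∂Ω} w = div (J ω)`, and the right-hand side has integral zero when `w` is supported in the
chart. The boundary integrands of the two formulas differ by the tangential divergence of the single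
tangential field `boundaryField` (`boundary_integrand_eq`). This uses the product rule for
`div_{∂Ω}`, the symmetry of `D³f` and `D²φ`, and the fact that a derivative along a tangential
vector sees only the values on `∂Ω`.
-/

noncomputable section

namespace TriharmonicGreen

/-! ### The area formula for graphs -/

section AreaFormula

open Measure
open scoped NNReal ENNReal

/-- If distances between values of `f` are at most `K` times those between values of `g`, then the
same holds, with the factor `K ^ d`, for the Hausdorff measures of the images. -/
theorem euclideanHausdorffMeasure_image_le_of_edist_le {α X Y : Type*} [MetricSpace X]
    [MetricSpace Y] [MeasurableSpace X] [BorelSpace X] [MeasurableSpace Y] [BorelSpace Y]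
    {f : α → X} {g : α → Y} {S : Set α} {K : ℝ≥0} (d : ℕ)
    (h : ∀ a ∈ S, ∀ b ∈ S, edist (f a) (f b) ≤ K * edist (g a) (g b)) :
    euclideanHausdorffMeasure d (f '' S) ≤
      (K : ℝ≥0∞) ^ d * euclideanHausdorffMeasure d (g '' S) := by
  rcases S.eq_empty_or_nonempty with rfl | ⟨a₀, ha₀⟩
  · simp
  have : Nonempty α := ⟨a₀⟩
  set φ : Y → X := fun y => f (Function.invFunOn g S y) with hφ
  have hinv : ∀ a ∈ S, φ (g a) = f a := by
    intro a ha
    have hm : g a ∈ g '' S := ⟨a, ha, rfl⟩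
    have h1 := h _ (Function.invFunOn_mem hm) a ha
    rw [Function.invFunOn_eq hm, edist_self, mul_zero, nonpos_iff_eq_zero, edist_eq_zero] at h1
    exact h1
  have himg : f '' S = φ '' (g '' S) := by
    rw [image_image]
    exact image_congr fun a ha => (hinv a ha).symm
  have hlip : LipschitzOnWith K φ (g '' S) := by
    rintro _ ⟨a, ha, rfl⟩ _ ⟨b, hb, rfl⟩
    rw [hinv a ha, hinv b hb]
    exact h a ha b hb
  have := hlip.hausdorffMeasure_image_le (d := (d : ℝ)) (Nat.cast_nonneg d)
  rw [himg]
  simp only [euclideanHausdorffMeasure_def, Measure.smul_apply, ENNReal.smul_def, smul_eq_mul]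
  rw [ENNReal.rpow_natCast] at this
  calc _ ≤ _ := mul_le_mul_right this _
    _ = _ := by ring

variable {E : Type*} [NormedAddCommGroup E]
variable {F : Type*} [MetricSpace F]

/-- A parametrisation `G` of the graph of `γ`: its distances are those of points
`(y, γ y)` in the orthogonal sum `E ⊕ ℝ`. -/
def IsGraphParam (G : E → F) (γ : E → ℝ) : Prop :=
  ∀ y z, dist (G y) (G z) ^ 2 = ‖y - z‖ ^ 2 + (γ y - γ z) ^ 2

theorem IsGraphParam.injective {G : E → F} {γ : E → ℝ} (hG : IsGraphParam G γ) :
    Function.Injective G := by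
  intro y z h
  have := hG y z
  rw [h, dist_self] at this
  have h2 : ‖y - z‖ ^ 2 = 0 := by nlinarith [sq_nonneg ‖y - z‖, sq_nonneg (γ y - γ z)]
  exact sub_eq_zero.1 (norm_eq_zero.1 (pow_eq_zero_iff two_ne_zero |>.1 h2))

variable [InnerProductSpace ℝ E]

/-- The area density `√(1 + |ℓ|²)` of a graph with slope `ℓ`. -/
def graphDensity (ℓ : E →L[ℝ] ℝ) : ℝ := √(1 + ‖ℓ‖ ^ 2)

theorem graphDensity_sq (ℓ : E →L[ℝ] ℝ) : graphDensity ℓ ^ 2 = 1 + ‖ℓ‖ ^ 2 :=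
  Real.sq_sqrt (by positivity)

theorem one_le_graphDensity (ℓ : E →L[ℝ] ℝ) : 1 ≤ graphDensity ℓ :=
  Real.one_le_sqrt.2 (by nlinarith [sq_nonneg ‖ℓ‖])

theorem graphDensity_pos (ℓ : E →L[ℝ] ℝ) : 0 < graphDensity ℓ :=
  zero_lt_one.trans_le (one_le_graphDensity ℓ)

theorem continuous_graphDensity : Continuous (graphDensity : (E →L[ℝ] ℝ) → ℝ) := by
  unfold graphDensity; fun_prop

theorem graphDensity_le_add (ℓ k : E →L[ℝ] ℝ) :
    graphDensity ℓ ≤ graphDensity k + ‖ℓ - k‖ := by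
  have h1 := graphDensity_sq k
  have h2 := graphDensity_pos k
  have h3 : ‖ℓ‖ ≤ ‖k‖ + ‖ℓ - k‖ := norm_le_norm_add_norm_sub' ℓ k
  have h4 : ‖k‖ ≤ graphDensity k := (sq_le_sq₀ (norm_nonneg k) h2.le).1 (by linarith)
  refine Real.sqrt_le_iff.2 ⟨by positivity, ?_⟩
  have : ‖ℓ‖ ^ 2 ≤ (‖k‖ + ‖ℓ - k‖) ^ 2 := by gcongr
  nlinarith [norm_nonneg (ℓ - k)]

theorem abs_sqrt_add_sq_sub_le (a b c : ℝ) : |√(a ^ 2 + b ^ 2) - √(a ^ 2 + c ^ 2)| ≤ |b - c| := by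
  have key : ∀ b c : ℝ, √(a ^ 2 + b ^ 2) ≤ √(a ^ 2 + c ^ 2) + |b - c| := by
    intro b c
    refine Real.sqrt_le_iff.2 ⟨by positivity, ?_⟩
    have h1 : √(a ^ 2 + c ^ 2) ^ 2 = a ^ 2 + c ^ 2 := Real.sq_sqrt (by positivity)
    have h2 : |c| ≤ √(a ^ 2 + c ^ 2) := Real.abs_le_sqrt (by nlinarith [sq_nonneg a])
    have h3 : c * (b - c) ≤ |c| * |b - c| := by rw [← abs_mul]; exact le_abs_self _
    nlinarith [abs_nonneg (b - c), sq_abs (b - c)]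
  rw [abs_le]
  constructor
  · have := key c b
    rw [abs_sub_comm] at this
    linarith
  · linarith [key b c]

theorem IsGraphParam.abs_dist_sub_norm_le {G : E → F} {γ : E → ℝ} (hG : IsGraphParam G γ)
    {ℓ : E →L[ℝ] ℝ} {S : Set E} {δ : ℝ≥0} (h : ApproximatesLinearOn γ ℓ S δ)
    {T : E →ₗ[ℝ] E} (hT : ∀ v, ‖T v‖ ^ 2 = ‖v‖ ^ 2 + ℓ v ^ 2) {y z : E} (hy : y ∈ S) (hz : z ∈ S) :
    |dist (G y) (G z) - dist (T y) (T z)| ≤ δ * dist (T y) (T z) ∧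
    |dist (G y) (G z) - dist (T y) (T z)| ≤ δ * dist (G y) (G z) := by
  have h1 : dist (G y) (G z) = √(‖y - z‖ ^ 2 + (γ y - γ z) ^ 2) := by
    rw [← hG, Real.sqrt_sq dist_nonneg]
  have h2 : dist (T y) (T z) = √(‖y - z‖ ^ 2 + (ℓ (y - z)) ^ 2) := by
    rw [← hT, Real.sqrt_sq (norm_nonneg _), dist_eq_norm, map_sub]
  have h3 := abs_sqrt_add_sq_sub_le ‖y - z‖ (γ y - γ z) (ℓ (y - z))
  have h4 : |γ y - γ z - ℓ (y - z)| ≤ δ * ‖y - z‖ := by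
    simpa [Real.norm_eq_abs] using h y hy z hz
  have h5 : ‖y - z‖ ≤ √(‖y - z‖ ^ 2 + (ℓ (y - z)) ^ 2) := Real.le_sqrt_of_sq_le (by nlinarith)
  have h6 : ‖y - z‖ ≤ √(‖y - z‖ ^ 2 + (γ y - γ z) ^ 2) := Real.le_sqrt_of_sq_le (by nlinarith)
  rw [h1, h2]
  exact ⟨(h3.trans h4).trans (by gcongr), (h3.trans h4).trans (by gcongr)⟩

variable [FiniteDimensional ℝ E]

/-- The graph of a linear form `ℓ`, parametrised by `E`, is isometric to the image of `E` under an
endomorphism with determinant `√(1 + |ℓ|²)`. -/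
theorem exists_linearMap_norm_sq_eq (ℓ : E →L[ℝ] ℝ) :
    ∃ T : E →ₗ[ℝ] E, (∀ v, ‖T v‖ ^ 2 = ‖v‖ ^ 2 + ℓ v ^ 2) ∧
      LinearMap.det T = graphDensity ℓ := by
  set a : E := (InnerProductSpace.toDual ℝ E).symm ℓ with ha
  have hal : ∀ v, ℓ v = ⟪a, v⟫ := fun v => by rw [ha, InnerProductSpace.toDual_symm_apply]
  have han : ‖a‖ = ‖ℓ‖ := by rw [ha, LinearIsometryEquiv.norm_map]
  set J := graphDensity ℓ with hJ
  have hJ1 : J ^ 2 = 1 + ‖a‖ ^ 2 := by rw [hJ, graphDensity_sq, han]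
  have hJ0 : 0 < J := graphDensity_pos ℓ
  -- `T = 1 + (1 + J)⁻¹ a ⊗ a` is the positive square root of `1 + a ⊗ a`
  refine ⟨LinearMap.transvection (ℓ : E →ₗ[ℝ] ℝ) ((1 + J)⁻¹ • a), fun v => ?_, ?_⟩
  · have : LinearMap.transvection (ℓ : E →ₗ[ℝ] ℝ) ((1 + J)⁻¹ • a) v
        = v + (⟪a, v⟫ * (1 + J)⁻¹) • a := by
      simp [LinearMap.transvection, hal, smul_smul]
    rw [this, norm_add_sq_real, inner_smul_right, norm_smul, mul_pow, hal, real_inner_comm a v,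
      Real.norm_eq_abs, sq_abs]
    have h2 : ‖a‖ ^ 2 = J ^ 2 - 1 := by linarith
    rw [h2]
    field_simp
    ring
  · rw [LinearMap.transvection.det]
    simp only [ContinuousLinearMap.coe_coe, map_smul, smul_eq_mul, hal, real_inner_self_eq_norm_sq]
    have h2 : ‖a‖ ^ 2 = J ^ 2 - 1 := by linarith
    rw [h2]
    field_simp
    ring

variable [MeasurableSpace E] [BorelSpace E]

/-- The derivative of a real function that is `δ`-close to the linear form `ℓ` on a measurable set
is `δ`-close to `ℓ` almost everywhere on that set. -/
theorem ae_norm_fderiv_sub_le_of_approximatesLinearOn {γ : E → ℝ} {ℓ : E →L[ℝ] ℝ} {S : Set E}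
    {δ : ℝ≥0} (h : ApproximatesLinearOn γ ℓ S δ) (hS : MeasurableSet S) {γ' : E → E →L[ℝ] ℝ}
    (hγ : ∀ x ∈ S, HasFDerivWithinAt γ (γ' x) S x) :
    ∀ᵐ x ∂(volume.restrict S), ‖γ' x - ℓ‖ ≤ δ := by
  rcases subsingleton_or_nontrivial E with hE | hE
  · refine Eventually.of_forall fun x => ?_
    rw [Subsingleton.elim (γ' x - ℓ) 0, norm_zero]
    exact δ.2
  obtain ⟨b, hb⟩ := exists_norm_eq E (zero_le_one' ℝ)
  have h' : ApproximatesLinearOn (fun x => γ x • b) (ℓ.smulRight b) S δ := by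
    intro x hx y hy
    have : γ x • b - γ y • b - (ℓ.smulRight b) (x - y) = (γ x - γ y - ℓ (x - y)) • b := by
      simp [sub_smul]
    rw [this, norm_smul, hb, mul_one]
    exact h x hx y hy
  have := h'.norm_fderiv_sub_le volume hS (fun x => (γ' x).smulRight b)
    (fun x hx => (hγ x hx).smul_const b)
  filter_upwards [this] with x hx
  have e : (γ' x).smulRight b - ℓ.smulRight b = (γ' x - ℓ).smulRight b := by
    ext v; simp [sub_smul]
  rw [e, ← NNReal.coe_le_coe, coe_nnnorm, ContinuousLinearMap.norm_smulRight_apply, hb,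
    mul_one] at hx
  exact hx

theorem edist_le_of_dist_le {X Y : Type*} [MetricSpace X] [MetricSpace Y] {a b : X} {c d : Y}
    {K : ℝ≥0} (h : dist a b ≤ K * dist c d) : edist a b ≤ K * edist c d := by
  rw [edist_nndist, edist_nndist]
  exact_mod_cast h

theorem volume_image_linearMap_eq {T : E →ₗ[ℝ] E} {ℓ : E →L[ℝ] ℝ}
    (hT : LinearMap.det T = graphDensity ℓ) (S : Set E) :
    euclideanHausdorffMeasure (Module.finrank ℝ E) (T '' S) =
      ENNReal.ofReal (graphDensity ℓ) * volume S := by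
  rw [InnerProductSpace.euclideanHausdorffMeasure_eq_volume, Measure.addHaar_image_linearMap, hT,
    abs_of_pos (graphDensity_pos ℓ)]

variable [MeasurableSpace F] [BorelSpace F]

/-- Upper estimate in the area formula, on a piece on which the slope is almost constant. -/
theorem IsGraphParam.measure_image_le {G : E → F} {γ : E → ℝ} (hG : IsGraphParam G γ)
    {ℓ : E →L[ℝ] ℝ} {S : Set E} {δ : ℝ≥0} (h : ApproximatesLinearOn γ ℓ S δ) :
    euclideanHausdorffMeasure (Module.finrank ℝ E) (G '' S) ≤
      ((1 + δ : ℝ≥0) : ℝ≥0∞) ^ (Module.finrank ℝ E) *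
        (ENNReal.ofReal (graphDensity ℓ) * volume S) := by
  obtain ⟨T, hT, hdet⟩ := exists_linearMap_norm_sq_eq ℓ
  rw [← volume_image_linearMap_eq hdet]
  refine euclideanHausdorffMeasure_image_le_of_edist_le _ fun y hy z hz => ?_
  apply edist_le_of_dist_le
  have := (abs_le.1 (hG.abs_dist_sub_norm_le h hT hy hz).1).2
  push_cast
  linarith

/-- Lower estimate in the area formula, on a piece on which the slope is almost constant. -/
theorem IsGraphParam.le_measure_image {G : E → F} {γ : E → ℝ} (hG : IsGraphParam G γ)
    {ℓ : E →L[ℝ] ℝ} {S : Set E} {δ : ℝ≥0} (h : ApproximatesLinearOn γ ℓ S δ) :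
    ENNReal.ofReal (graphDensity ℓ) * volume S ≤ ((1 + δ : ℝ≥0) : ℝ≥0∞) ^ (Module.finrank ℝ E) *
      euclideanHausdorffMeasure (Module.finrank ℝ E) (G '' S) := by
  obtain ⟨T, hT, hdet⟩ := exists_linearMap_norm_sq_eq ℓ
  rw [← volume_image_linearMap_eq hdet]
  refine euclideanHausdorffMeasure_image_le_of_edist_le _ fun y hy z hz => ?_
  apply edist_le_of_dist_le
  have := (abs_le.1 (hG.abs_dist_sub_norm_le h hT hy hz).2).1
  push_cast
  linarith

/-- Up to a factor close to `1`, the area formula holds on a piece on which the slope is almost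
constant. -/
theorem IsGraphParam.measure_image_approx {G : E → F} {γ : E → ℝ} (hG : IsGraphParam G γ)
    {ℓ : E →L[ℝ] ℝ} {S : Set E} {δ : ℝ≥0} (h : ApproximatesLinearOn γ ℓ S δ)
    (hS : MeasurableSet S) {γ' : E → E →L[ℝ] ℝ}
    (hγ : ∀ x ∈ S, HasFDerivWithinAt γ (γ' x) S x) :
    euclideanHausdorffMeasure (Module.finrank ℝ E) (G '' S) ≤
      ((1 + δ : ℝ≥0) : ℝ≥0∞) ^ (Module.finrank ℝ E + 1) *
        ∫⁻ x in S, ENNReal.ofReal (graphDensity (γ' x)) ∧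
    ∫⁻ x in S, ENNReal.ofReal (graphDensity (γ' x)) ≤
      ((1 + δ : ℝ≥0) : ℝ≥0∞) ^ (Module.finrank ℝ E + 1) *
        euclideanHausdorffMeasure (Module.finrank ℝ E) (G '' S) := by
  have hae := ae_norm_fderiv_sub_le_of_approximatesLinearOn h hS hγ
  have hcoe : ((1 + δ : ℝ≥0) : ℝ≥0∞) = ENNReal.ofReal (1 + δ) := by
    rw [← ENNReal.ofReal_coe_nnreal]; push_cast; rfl
  have hcompare : ∀ k m : E →L[ℝ] ℝ, ‖k - m‖ ≤ δ →
      ENNReal.ofReal (graphDensity k) ≤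
        ((1 + δ : ℝ≥0) : ℝ≥0∞) * ENNReal.ofReal (graphDensity m) := by
    intro k m hkm
    rw [hcoe, ← ENNReal.ofReal_mul (by positivity)]
    apply ENNReal.ofReal_le_ofReal
    have h1 := graphDensity_le_add k m
    have h2 := one_le_graphDensity m
    have h3 : (δ : ℝ) * 1 ≤ δ * graphDensity m := by gcongr
    linarith
  have hconst : ENNReal.ofReal (graphDensity ℓ) * volume S =
      ∫⁻ _ in S, ENNReal.ofReal (graphDensity ℓ) := by
    rw [lintegral_const, Measure.restrict_apply_univ]
  constructor
  · refine (hG.measure_image_le h).trans ?_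
    rw [pow_succ, mul_assoc, hconst]
    gcongr
    rw [← lintegral_const_mul' _ _ ENNReal.coe_ne_top]
    refine lintegral_mono_ae ?_
    filter_upwards [hae] with x hx
    exact hcompare _ _ (by rwa [norm_sub_rev])
  · calc ∫⁻ x in S, ENNReal.ofReal (graphDensity (γ' x))
        ≤ ∫⁻ _ in S, ((1 + δ : ℝ≥0) : ℝ≥0∞) * ENNReal.ofReal (graphDensity ℓ) := by
          refine lintegral_mono_ae ?_
          filter_upwards [hae] with x hx
          exact hcompare _ _ hx
      _ = ((1 + δ : ℝ≥0) : ℝ≥0∞) * (ENNReal.ofReal (graphDensity ℓ) * volume S) := by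
          rw [lintegral_const_mul' _ _ ENNReal.coe_ne_top, hconst]
      _ ≤ _ := by
          rw [pow_succ, mul_comm (_ ^ _) _, mul_assoc]
          exact mul_le_mul_right (hG.le_measure_image h) _

theorem ennreal_le_of_forall_one_add_pow_mul {a b : ℝ≥0∞} (k : ℕ)
    (h : ∀ δ : ℝ≥0, 0 < δ → a ≤ ((1 + δ : ℝ≥0) : ℝ≥0∞) ^ k * b) : a ≤ b := by
  have hlim : Tendsto (fun δ : ℝ≥0 => ((1 + δ : ℝ≥0) : ℝ≥0∞) ^ k * b) (𝓝[>] 0) (𝓝 b) := by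
    have h1 : Tendsto (fun δ : ℝ≥0 => (1 + δ) ^ k) (𝓝[>] 0) (𝓝 1) := by
      have : Continuous fun δ : ℝ≥0 => (1 + δ) ^ k := by fun_prop
      simpa using (this.tendsto 0).mono_left nhdsWithin_le_nhds
    have h2 : Tendsto (fun δ : ℝ≥0 => (((1 + δ) ^ k : ℝ≥0) : ℝ≥0∞)) (𝓝[>] 0) (𝓝 1) :=
      ENNReal.tendsto_coe.2 h1
    have := ENNReal.Tendsto.mul_const (b := b) h2 (Or.inl one_ne_zero)
    simpa using this
  exact ge_of_tendsto hlim (eventually_nhdsWithin_of_forall fun δ hδ => h δ hδ)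

/-- The area formula for graphs: the Hausdorff measure of the part of a graph over a measurable
set of points of differentiability is the integral of `√(1 + |∇γ|²)`. -/
theorem IsGraphParam.measure_image_eq {G : E → F} {γ : E → ℝ} (hG : IsGraphParam G γ)
    (hGm : MeasurableEmbedding G) {S : Set E} (hS : MeasurableSet S) {γ' : E → E →L[ℝ] ℝ}
    (hγ : ∀ x ∈ S, HasFDerivWithinAt γ (γ' x) S x) :
    euclideanHausdorffMeasure (Module.finrank ℝ E) (G '' S) =
      ∫⁻ x in S, ENNReal.ofReal (graphDensity (γ' x)) := by
  have key : ∀ δ : ℝ≥0, 0 < δ →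
      euclideanHausdorffMeasure (Module.finrank ℝ E) (G '' S) ≤
        ((1 + δ : ℝ≥0) : ℝ≥0∞) ^ (Module.finrank ℝ E + 1) *
          ∫⁻ x in S, ENNReal.ofReal (graphDensity (γ' x)) ∧
      ∫⁻ x in S, ENNReal.ofReal (graphDensity (γ' x)) ≤
        ((1 + δ : ℝ≥0) : ℝ≥0∞) ^ (Module.finrank ℝ E + 1) *
          euclideanHausdorffMeasure (Module.finrank ℝ E) (G '' S) := by
    intro δ hδ
    obtain ⟨t, A, hdisj, htm, hcov, happ, -⟩ :=
      exists_partition_approximatesLinearOn_of_hasFDerivWithinAt γ S γ' hγ (fun _ => δ)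
        (fun _ => hδ.ne')
    have hSt : S = ⋃ n, S ∩ t n := by rw [← inter_iUnion, inter_eq_left.2 hcov]
    have hm : ∀ n, MeasurableSet (S ∩ t n) := fun n => hS.inter (htm n)
    have hd : Pairwise (Function.onFun Disjoint fun n => S ∩ t n) := fun i j hij =>
      (hdisj hij).mono inter_subset_right inter_subset_right
    have hI : ∫⁻ x in S, ENNReal.ofReal (graphDensity (γ' x)) =
        ∑' n, ∫⁻ x in S ∩ t n, ENNReal.ofReal (graphDensity (γ' x)) := by
      conv_lhs => rw [hSt]
      rw [lintegral_iUnion hm hd]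
    have hM : euclideanHausdorffMeasure (Module.finrank ℝ E) (G '' S) =
        ∑' n, euclideanHausdorffMeasure (Module.finrank ℝ E) (G '' (S ∩ t n)) := by
      conv_lhs => rw [hSt, image_iUnion]
      rw [measure_iUnion]
      · exact fun i j hij => disjoint_image_of_injective hG.injective (hd hij)
      · exact fun n => hGm.measurableSet_image.2 (hm n)
    have hpiece := fun n => hG.measure_image_approx (happ n) (hm n)
      (fun x hx => (hγ x hx.1).mono inter_subset_left)
    rw [hI, hM, ← ENNReal.tsum_mul_left, ← ENNReal.tsum_mul_left]
    exact ⟨ENNReal.tsum_le_tsum fun n => (hpiece n).1, ENNReal.tsum_le_tsum fun n => (hpiece n).2⟩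
  exact le_antisymm (ennreal_le_of_forall_one_add_pow_mul _ fun δ hδ => (key δ hδ).1)
    (ennreal_le_of_forall_one_add_pow_mul _ fun δ hδ => (key δ hδ).2)

/-- Over a null set, the graph of a Lipschitz function is negligible. -/
theorem IsGraphParam.measure_image_null {G : E → F} {γ : E → ℝ} (hG : IsGraphParam G γ)
    {K : ℝ≥0} (hγ : LipschitzWith K γ) {S : Set E} (hS : volume S = 0) :
    euclideanHausdorffMeasure (Module.finrank ℝ E) (G '' S) = 0 := by
  have h : ∀ y ∈ S, ∀ z ∈ S, edist (G y) (G z) ≤ (1 + K : ℝ≥0) * edist (id y) (id z) := by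
    intro y _ z _
    apply edist_le_of_dist_le
    have h1 := hG y z
    have h2 := hγ.dist_le_mul y z
    rw [Real.dist_eq, dist_eq_norm] at h2
    simp only [id, NNReal.coe_add, NNReal.coe_one]
    refine abs_le_of_sq_le_sq' ?_ (by positivity) |>.2
    rw [h1, dist_eq_norm, ← sq_abs (γ y - γ z)]
    have h3 : |γ y - γ z| ^ 2 ≤ (K * ‖y - z‖) ^ 2 := by gcongr
    nlinarith [mul_nonneg K.2 (sq_nonneg ‖y - z‖)]
  have := euclideanHausdorffMeasure_image_le_of_edist_le (Module.finrank ℝ E) h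
  rw [image_id, InnerProductSpace.euclideanHausdorffMeasure_eq_volume, hS, mul_zero] at this
  exact nonpos_iff_eq_zero.1 this

/-- The area formula for graphs as an equality of measures on the graph. The function `γ` is either
Lipschitz or differentiable. -/
theorem IsGraphParam.map_withDensity {G : E → F} {γ : E → ℝ} (hG : IsGraphParam G γ)
    (hGm : MeasurableEmbedding G) (hγ : (∃ K, LipschitzWith K γ) ∨ Differentiable ℝ γ) :
    (volume.withDensity fun y => ENNReal.ofReal (graphDensity (fderiv ℝ γ y))).map G =
      (euclideanHausdorffMeasure (Module.finrank ℝ E)).restrict (range G) := by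
  have hnull : euclideanHausdorffMeasure (Module.finrank ℝ E)
      (G '' {y | ¬ DifferentiableAt ℝ γ y}) = 0 := by
    rcases hγ with ⟨K, hK⟩ | hd
    · exact hG.measure_image_null hK hK.ae_differentiableAt
    · have : {y | ¬ DifferentiableAt ℝ γ y} = ∅ := by
        ext y; simp [hd y]
      rw [this, image_empty, measure_empty]
  have hγc : Continuous γ := by
    rcases hγ with ⟨K, hK⟩ | hd
    · exact hK.continuous
    · exact hd.continuous
  have hDm : MeasurableSet {y | DifferentiableAt ℝ γ y} := measurableSet_of_differentiableAt ℝ γ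
  have hae : volume {y | ¬ DifferentiableAt ℝ γ y} = 0 := by
    rcases hγ with ⟨K, hK⟩ | hd
    · exact hK.ae_differentiableAt
    · simp [hd _]
  ext A hA
  rw [hGm.map_apply, withDensity_apply _ (hGm.measurable hA), Measure.restrict_apply hA,
    ← image_preimage_eq_inter_range]
  set D := {y | DifferentiableAt ℝ γ y} with hD
  set S := G ⁻¹' A with hSdef
  have hSm : MeasurableSet S := hGm.measurable hA
  have h1 : euclideanHausdorffMeasure (Module.finrank ℝ E) (G '' S) =
      euclideanHausdorffMeasure (Module.finrank ℝ E) (G '' (S ∩ D)) := by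
    apply le_antisymm
    · have : G '' S ⊆ G '' (S ∩ D) ∪ G '' {y | ¬ DifferentiableAt ℝ γ y} := by
        rw [← image_union]
        refine image_mono fun y hy => ?_
        by_cases h : y ∈ D
        · exact Or.inl ⟨hy, h⟩
        · exact Or.inr h
      refine (measure_mono this).trans ((measure_union_le _ _).trans ?_)
      rw [hnull, add_zero]
    · exact measure_mono (image_mono inter_subset_left)
  rw [h1, hG.measure_image_eq hGm (hSm.inter hDm) (γ' := fderiv ℝ γ)
    (fun x hx => hx.2.hasFDerivAt.hasFDerivWithinAt)]
  refine setLIntegral_congr ?_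
  refine (inter_ae_eq_left_of_ae_eq_univ ?_).symm
  rw [ae_eq_univ]
  exact hae

end AreaFormula

/-! ### The divergence theorem above the graph of a Lipschitz function -/

section Epigraph

open scoped NNReal

variable {F : Type*} [NormedAddCommGroup F] [InnerProductSpace ℝ F]

/-- The hyperplane orthogonal to `e`. -/
abbrev Hyp (e : F) : Submodule ℝ F := (Submodule.span ℝ {e})ᗮ

/-- The orthogonal projection onto the hyperplane orthogonal to `e`. -/
abbrev hproj (e : F) : F →L[ℝ] Hyp e := (Submodule.span ℝ {e})ᗮ.orthogonalProjectionOnto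

theorem inner_hyp (e : F) (y : Hyp e) : ⟪e, (y : F)⟫ = 0 :=
  Submodule.mem_orthogonal_singleton_iff_inner_right.1 y.2

theorem hproj_add_smul (e : F) (y : Hyp e) (t : ℝ) : hproj e ((y : F) + t • e) = y := by
  have h : hproj e e = 0 :=
    Submodule.orthogonalProjectionOnto_orthogonalComplement_singleton_eq_zero e
  rw [map_add, map_smul, h, smul_zero, add_zero]
  exact Submodule.orthogonalProjectionOnto_mem_subspace_eq_self y

theorem inner_add_smul {e : F} (he : ‖e‖ = 1) (y : Hyp e) (t : ℝ) :
    ⟪e, (y : F) + t • e⟫ = t := by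
  rw [inner_add_right, inner_hyp, inner_smul_right, real_inner_self_eq_norm_sq, he]; simp

theorem hproj_add_inner {e : F} (he : ‖e‖ = 1) (x : F) :
    (hproj e x : F) + ⟪e, x⟫ • e = x := by
  have h := (Submodule.span ℝ {e}).starProjection_add_starProjection_orthogonal x
  rw [Submodule.starProjection_unit_singleton ℝ he] at h
  rw [add_comm]
  exact h

theorem norm_add_smul_sq {e : F} (he : ‖e‖ = 1) (y : Hyp e) (t : ℝ) :
    ‖(y : F) + t • e‖ ^ 2 = ‖y‖ ^ 2 + t ^ 2 := by
  rw [norm_add_sq_real, inner_smul_right, real_inner_comm, inner_hyp, norm_smul, he,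
    Submodule.coe_norm, Real.norm_eq_abs, mul_one, sq_abs]
  ring

/-- The point of the hyperplane `Hyp e` at `y`, moved vertically to the height `γ y + s`. -/
def shear (e : F) (γ : Hyp e → ℝ) (y : Hyp e) (s : ℝ) : F := (y : F) + (γ y + s) • e

/-- The parametrisation of the graph of `γ`. -/
def graphMap (e : F) (γ : Hyp e → ℝ) (y : Hyp e) : F := (y : F) + γ y • e

theorem shear_zero (e : F) (γ : Hyp e → ℝ) (y : Hyp e) : shear e γ y 0 = graphMap e γ y := by
  simp [shear, graphMap]

theorem isGraphParam_graphMap {e : F} (he : ‖e‖ = 1) (γ : Hyp e → ℝ) :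
    IsGraphParam (graphMap e γ) γ := by
  intro y z
  have : graphMap e γ y - graphMap e γ z = ((y - z : Hyp e) : F) + (γ y - γ z) • e := by
    simp only [graphMap, Submodule.coe_sub, sub_smul]; abel
  rw [dist_eq_norm, this, norm_add_smul_sq he]

/-- The coordinates `(y, s)` in which the region above the graph of `γ` is the half-space
`s > 0`. -/
def shearHomeomorph {e : F} (he : ‖e‖ = 1) {γ : Hyp e → ℝ} (hγ : Continuous γ) :
    Hyp e × ℝ ≃ₜ F where
  toFun p := shear e γ p.1 p.2
  invFun x := (hproj e x, ⟪e, x⟫ - γ (hproj e x))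
  left_inv p := by
    ext
    · simp only [shear, hproj_add_smul]
    · simp only [shear, hproj_add_smul, inner_add_smul he]; ring
  right_inv x := by
    simp only [shear, add_sub_cancel]
    exact hproj_add_inner he x
  continuous_toFun := by unfold shear; fun_prop
  continuous_invFun := by fun_prop

/-- The region above the graph of `γ`. -/
def epi (e : F) (γ : Hyp e → ℝ) : Set F := {x | γ (hproj e x) < ⟪e, x⟫}

theorem isOpen_epi {e : F} {γ : Hyp e → ℝ} (hγ : Continuous γ) : IsOpen (epi e γ) :=
  isOpen_lt (by fun_prop) (by fun_prop)

theorem shear_mem_epi {e : F} (he : ‖e‖ = 1) {γ : Hyp e → ℝ} {y : Hyp e} {s : ℝ} :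
    shear e γ y s ∈ epi e γ ↔ 0 < s := by
  simp [epi, shear, hproj_add_smul, inner_add_smul he]

theorem measurableEmbedding_graphMap [MeasurableSpace F] [BorelSpace F] {e : F} {γ : Hyp e → ℝ}
    (hγ : Continuous γ) : MeasurableEmbedding (graphMap e γ) := by
  have h : Function.LeftInverse (hproj e) (graphMap e γ) := fun y => hproj_add_smul e y (γ y)
  exact (h.isClosedEmbedding (hproj e).continuous
    (by unfold graphMap; fun_prop)).measurableEmbedding

variable [FiniteDimensional ℝ F] [MeasurableSpace F] [BorelSpace F]

theorem measurePreserving_add_smul {e : F} (he : ‖e‖ = 1) :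
    MeasurePreserving (fun p : Hyp e × ℝ => (p.1 : F) + p.2 • e)
      ((volume : Measure (Hyp e)).prod (volume : Measure ℝ)) volume := by
  let I : WithLp 2 (Hyp e × ℝ) ≃ₗᵢ[ℝ] F :=
    { toFun := fun p => (p.fst : F) + p.snd • e
      map_add' := fun p q => by simp [add_smul]; abel
      map_smul' := fun c p => by simp [smul_smul]
      invFun := fun x => WithLp.toLp 2 (hproj e x, ⟪e, x⟫)
      left_inv := fun p => by
        have h1 := hproj_add_smul e p.fst p.snd
        have h2 := inner_add_smul he p.fst p.snd
        simp only [h1, h2]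
        rfl
      right_inv := fun x => hproj_add_inner he x
      norm_map' := fun p => by
        have h1 := norm_add_smul_sq he p.fst p.snd
        have h2 := WithLp.prod_norm_sq_eq_of_L2 p
        rw [Real.norm_eq_abs, sq_abs] at h2
        refine (sq_eq_sq₀ (norm_nonneg _) (norm_nonneg _)).1 ?_
        rw [h2]; exact h1 }
  exact I.measurePreserving.comp (WithLp.volume_preserving_toLp (Hyp e) ℝ)

theorem measurePreserving_shear {e : F} (he : ‖e‖ = 1) {γ : Hyp e → ℝ} (hγ : Continuous γ) :
    MeasurePreserving (shearHomeomorph he hγ)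
      ((volume : Measure (Hyp e)).prod (volume : Measure ℝ)) volume := by
  have h : MeasurePreserving (fun p : Hyp e × ℝ => (p.1, γ p.1 + p.2))
      ((volume : Measure (Hyp e)).prod (volume : Measure ℝ))
      ((volume : Measure (Hyp e)).prod (volume : Measure ℝ)) := by
    refine (MeasurePreserving.id volume).skew_product (g := fun y s => γ y + s) ?_ ?_
    · exact (by fun_prop : Continuous fun p : Hyp e × ℝ => γ p.1 + p.2).measurable
    · exact Eventually.of_forall fun y => (measurePreserving_add_left volume (γ y)).map_eq
  exact (measurePreserving_add_smul he).comp h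

theorem setIntegral_epi {e : F} (he : ‖e‖ = 1) {γ : Hyp e → ℝ} (hγ : Continuous γ) (g : F → ℝ) :
    ∫ x in epi e γ, g x = ∫ p, g (shear e γ p.1 p.2)
      ∂((volume : Measure (Hyp e)).prod (volume.restrict (Ioi (0 : ℝ)))) := by
  have h := (measurePreserving_shear he hγ).setIntegral_preimage_emb
    (shearHomeomorph he hγ).measurableEmbedding g (epi e γ)
  have hpre : shearHomeomorph he hγ ⁻¹' epi e γ = univ ×ˢ Ioi 0 := by
    ext p
    rw [mem_preimage, mem_prod, and_iff_right (mem_univ _)]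
    exact shear_mem_epi he
  rw [← h, hpre, ← Measure.prod_restrict, Measure.restrict_univ]
  rfl

theorem integrable_shear {e : F} (he : ‖e‖ = 1) {γ : Hyp e → ℝ} (hγ : Continuous γ) {g : F → ℝ}
    (hg : IntegrableOn g (epi e γ)) : Integrable (fun p : Hyp e × ℝ => g (shear e γ p.1 p.2))
      ((volume : Measure (Hyp e)).prod (volume.restrict (Ioi (0 : ℝ)))) := by
  have h := (measurePreserving_shear he hγ).integrableOn_comp_preimage
    (shearHomeomorph he hγ).measurableEmbedding (f := g) (s := epi e γ)
  have hpre : shearHomeomorph he hγ ⁻¹' epi e γ = univ ×ˢ Ioi 0 := by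
    ext p
    rw [mem_preimage, mem_prod, and_iff_right (mem_univ _)]
    exact shear_mem_epi he
  rw [hpre, IntegrableOn, ← Measure.prod_restrict, Measure.restrict_univ] at h
  exact h.2 hg

end Epigraph

section LipschitzCompactSupport

open scoped NNReal

/-- A locally Lipschitz function with bounded support is Lipschitz. -/
theorem exists_lipschitzWith_of_locallyLipschitz {E : Type*} [NormedAddCommGroup E]
    [ProperSpace E] {w : E → ℝ} (hw : LocallyLipschitz w) {R : ℝ}
    (hR : ∀ x, R < ‖x‖ → w x = 0) : ∃ C, LipschitzWith C w := by
  have hc : IsCompact (Metric.closedBall (0 : E) (R + 1)) := isCompact_closedBall _ _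
  obtain ⟨C, hC⟩ := hw.locallyLipschitzOn.exists_lipschitzOnWith_of_compact hc
  obtain ⟨M, hM⟩ := hc.exists_bound_of_continuousOn hw.continuous.continuousOn
  have hM' : ∀ x, |w x| ≤ max M 0 := by
    intro x
    by_cases hx : ‖x‖ ≤ R + 1
    · exact (hM x (by simpa using hx)).trans (le_max_left _ _)
    · rw [hR x (by linarith)]; simp
  have key : ∀ x y, R < ‖y‖ → |w x - w y| ≤ (C + max M 0) * dist x y := by
    intro x y hy
    have hm : (0 : ℝ) ≤ max M 0 := le_max_right _ _
    by_cases hx : R < ‖x‖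
    · rw [hR x hx, hR y hy]; simp; positivity
    rw [not_lt] at hx
    by_cases hy1 : ‖y‖ ≤ R + 1
    · have := hC.dist_le_mul x (by simp; linarith) y (by simpa using hy1)
      rw [Real.dist_eq] at this
      nlinarith [dist_nonneg (x := x) (y := y)]
    · rw [hR y hy, sub_zero]
      have h1 : 1 ≤ dist x y := by
        rw [dist_eq_norm, norm_sub_rev]
        linarith [norm_sub_norm_le y x]
      nlinarith [hM' x, C.2, mul_nonneg C.2 (dist_nonneg (x := x) (y := y))]
  refine ⟨C + (max M 0).toNNReal, LipschitzWith.of_dist_le_mul fun x y => ?_⟩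
  rw [NNReal.coe_add, Real.coe_toNNReal _ (le_max_right _ _), Real.dist_eq]
  have hm : (0 : ℝ) ≤ max M 0 := le_max_right _ _
  by_cases hy : R < ‖y‖
  · exact key x y hy
  by_cases hx : R < ‖x‖
  · rw [abs_sub_comm, dist_comm]; exact key y x hx
  have := hC.dist_le_mul x (by simp; linarith) y (by simp; linarith)
  rw [Real.dist_eq] at this
  nlinarith [dist_nonneg (x := x) (y := y)]

/-- Directional derivatives of a Lipschitz function with bounded support have integral zero. -/
theorem integral_lineDeriv_eq_zero {E : Type*} [NormedAddCommGroup E] [NormedSpace ℝ E]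
    [FiniteDimensional ℝ E] [MeasurableSpace E] [BorelSpace E] (μ : Measure E)
    [μ.IsAddHaarMeasure] {w : E → ℝ} {C : ℝ≥0} (hw : LipschitzWith C w)
    (hc : HasCompactSupport w) (h : E) : ∫ y, lineDeriv ℝ w y h ∂μ = 0 := by
  have h1 : LipschitzWith 0 fun _ : E => (1 : ℝ) := LipschitzWith.const 1
  have := h1.integral_lineDeriv_mul_eq (μ := μ) hw hc (-h)
  have h0 : ∀ x v : E, lineDeriv ℝ (fun _ : E => (1 : ℝ)) x v = 0 := fun x v => by
    simp [lineDeriv]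
  simpa [h0] using this.symm

end LipschitzCompactSupport

section EpigraphDivergence

open scoped NNReal

theorem fderiv_eq_zero_of_norm_lt {F : Type*} [NormedAddCommGroup F] [NormedSpace ℝ F]
    {u : F → ℝ} {R : ℝ} (hR : ∀ x, R < ‖x‖ → u x = 0) {x : F}
    (hx : R < ‖x‖) : fderiv ℝ u x = 0 := by
  have : u =ᶠ[𝓝 x] fun _ => 0 := by
    filter_upwards [(isOpen_lt continuous_const continuous_norm).mem_nhds hx] with z hz
    exact hR z hz
  rw [this.fderiv_eq]
  simp

theorem differentiableAt_of_mem_epi {F : Type*} [NormedAddCommGroup F] [InnerProductSpace ℝ F]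
    {e : F} {γ : Hyp e → ℝ} (hγ : Continuous γ) {u : F → ℝ}
    (hu : ContDiffOn ℝ 1 u (epi e γ)) {x : F} (hx : x ∈ epi e γ) : DifferentiableAt ℝ u x :=
  (hu.contDiffAt ((isOpen_epi hγ).mem_nhds hx)).differentiableAt one_ne_zero

variable {F : Type*} [NormedAddCommGroup F] [InnerProductSpace ℝ F] [FiniteDimensional ℝ F]
  [MeasurableSpace F] [BorelSpace F]

theorem integrableOn_fderiv_epi {e : F} {γ : Hyp e → ℝ} (hγ : Continuous γ) {u : F → ℝ}
    {M R : ℝ} (hM : ∀ x ∈ epi e γ, ‖fderiv ℝ u x‖ ≤ M) (hR : ∀ x, R < ‖x‖ → u x = 0) (v : F) :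
    IntegrableOn (fun x => fderiv ℝ u x v) (epi e γ) := by
  have hB : IntegrableOn (fun x => fderiv ℝ u x v) (epi e γ ∩ Metric.closedBall 0 R) := by
    refine IntegrableOn.of_bound ?_ (measurable_fderiv_apply_const ℝ u v).aestronglyMeasurable
      (M * ‖v‖) ?_
    · exact (measure_mono inter_subset_right).trans_lt measure_closedBall_lt_top
    · refine ae_restrict_of_forall_mem
        ((isOpen_epi hγ).measurableSet.inter Metric.isClosed_closedBall.measurableSet)
        fun x hx => ?_
      exact ((fderiv ℝ u x).le_opNorm v).trans (by gcongr; exact hM x hx.1)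
  refine hB.of_forall_sdiff_eq_zero (isOpen_epi hγ).measurableSet fun x hx => ?_
  have : R < ‖x‖ := by
    by_contra h
    exact hx.2 ⟨hx.1, by simpa using h⟩
  rw [fderiv_eq_zero_of_norm_lt hR this]
  simp

/-- On a slice `s = const`, tangential derivatives have integral zero. -/
theorem integral_shear_slice_eq_zero {e : F} (he : ‖e‖ = 1) {γ : Hyp e → ℝ} {K : ℝ≥0}
    (hγ : LipschitzWith K γ) {u : F → ℝ} (hu : ContDiffOn ℝ 1 u (epi e γ))
    {R : ℝ} (hR : ∀ x, R < ‖x‖ → u x = 0) {s : ℝ} (hs : 0 < s) (h : Hyp e) :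
    ∫ y : Hyp e, (fderiv ℝ u (shear e γ y s) h +
      fderiv ℝ γ y h * fderiv ℝ u (shear e γ y s) e) = 0 := by
  set w : Hyp e → ℝ := fun y => u (shear e γ y s) with hw
  have hΦ : ∀ y z, dist (shear e γ y s) (shear e γ z s) ≤ (1 + K) * dist y z := by
    intro y z
    have : shear e γ y s - shear e γ z s = ((y - z : Hyp e) : F) + (γ y - γ z) • e := by
      simp only [shear, Submodule.coe_sub, sub_smul, add_smul]; abel
    rw [dist_eq_norm, this]
    refine (norm_add_le _ _).trans ?_
    have h2 := hγ.dist_le_mul y z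
    rw [Real.dist_eq] at h2
    rw [norm_smul, he, mul_one, Real.norm_eq_abs, ← Submodule.coe_norm, ← dist_eq_norm]
    linarith
  have hΦL : LipschitzWith (1 + K) fun y => shear e γ y s :=
    LipschitzWith.of_dist_le_mul fun y z => by simpa using hΦ y z
  have hloc : LocallyLipschitz w := by
    intro y
    have hx : shear e γ y s ∈ epi e γ := (shear_mem_epi he).2 hs
    obtain ⟨C, t, ht, hC⟩ :=
      (hu.contDiffAt ((isOpen_epi hγ.continuous).mem_nhds hx)).exists_lipschitzOnWith
    refine ⟨C * (1 + K), (fun y => shear e γ y s) ⁻¹' t, hΦL.continuous.continuousAt ht, ?_⟩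
    exact hC.comp hΦL.lipschitzOnWith (mapsTo_preimage _ _)
  have hsupp : ∀ y, R < ‖y‖ → w y = 0 := by
    intro y hy
    apply hR
    refine hy.trans_le ?_
    have := norm_add_smul_sq he y (γ y + s)
    exact abs_le_of_sq_le_sq' (by rw [shear, this]; nlinarith [sq_nonneg (γ y + s)])
      (norm_nonneg _) |>.2
  obtain ⟨C, hC⟩ := exists_lipschitzWith_of_locallyLipschitz hloc hsupp
  have hcs : HasCompactSupport w := by
    refine HasCompactSupport.of_support_subset_isCompact (isCompact_closedBall (0 : Hyp e) R) ?_
    intro y hy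
    by_contra hc
    exact hy (hsupp y (by simpa using hc))
  rw [← integral_lineDeriv_eq_zero volume hC hcs h]
  refine integral_congr_ae ?_
  filter_upwards [hγ.ae_differentiableAt] with y hy
  have h1 : HasFDerivAt (fun y => shear e γ y s)
      ((Hyp e).subtypeL + (fderiv ℝ γ y).smulRight e) y :=
    (Hyp e).subtypeL.hasFDerivAt.add ((hy.hasFDerivAt.add_const s).smul_const e)
  have h2 : HasFDerivAt u (fderiv ℝ u (shear e γ y s)) (shear e γ y s) :=
    (differentiableAt_of_mem_epi hγ.continuous hu ((shear_mem_epi he).2 hs)).hasFDerivAt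
  have h3 : HasFDerivAt w _ y := h2.comp y h1
  rw [(h3.hasLineDerivAt h).lineDeriv]
  simp

/-- The divergence theorem above the graph of a Lipschitz function. -/
theorem integral_fderiv_epi {e : F} (he : ‖e‖ = 1) {γ : Hyp e → ℝ} {K : ℝ≥0}
    (hγ : LipschitzWith K γ) {u : F → ℝ} (hu : ContDiffOn ℝ 1 u (epi e γ))
    (hcont : ∀ y, ContinuousWithinAt (fun s => u (shear e γ y s)) (Ici 0) 0)
    {M R : ℝ} (hM : ∀ x ∈ epi e γ, ‖fderiv ℝ u x‖ ≤ M) (hR : ∀ x, R < ‖x‖ → u x = 0) (v : F) :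
    ∫ x in epi e γ, fderiv ℝ u x v =
      ∫ y : Hyp e, (fderiv ℝ γ y (hproj e v) - ⟪e, v⟫) * u (graphMap e γ y) := by
  set h := hproj e v with hh
  set c := ⟪e, v⟫ with hc
  have hv : v = (h : F) + c • e := (hproj_add_inner he v).symm
  set a : Hyp e × ℝ → F →L[ℝ] ℝ := fun p => fderiv ℝ u (shear e γ p.1 p.2) with ha
  set μ := (volume : Measure (Hyp e)).prod (volume.restrict (Ioi (0 : ℝ))) with hμ
  have hint : ∀ w : F, Integrable (fun p => a p w) μ := fun w =>
    integrable_shear he hγ.continuous (integrableOn_fderiv_epi hγ.continuous hM hR w)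
  have hslope : Integrable (fun p => fderiv ℝ γ p.1 h * a p e) μ := by
    refine (hint e).bdd_mul (c := K * ‖h‖)
      ((measurable_fderiv_apply_const ℝ γ h).comp measurable_fst).aestronglyMeasurable ?_
    refine Eventually.of_forall fun p => ((fderiv ℝ γ p.1).le_opNorm h).trans ?_
    gcongr
    exact norm_fderiv_le_of_lipschitz ℝ hγ
  have hsum : Integrable (fun p => a p h + fderiv ℝ γ p.1 h * a p e) μ := (hint h).add hslope
  have hzero : ∫ p, (a p h + fderiv ℝ γ p.1 h * a p e) ∂μ = 0 := by
    rw [hμ, integral_prod_symm _ hsum]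
    refine setIntegral_eq_zero_of_forall_eq_zero fun s hs => ?_
    exact integral_shear_slice_eq_zero he hγ hu hR hs h
  have hvert : ∀ y : Hyp e, Integrable (fun s => a (y, s) e) (volume.restrict (Ioi (0 : ℝ))) →
      ∫ s in Ioi (0 : ℝ), a (y, s) e = - u (graphMap e γ y) := by
    intro y hy
    have h1 : ∀ s ∈ Ioi (0 : ℝ), HasDerivAt (fun s => u (shear e γ y s)) (a (y, s) e) s := by
      intro s hs
      have h2 : HasFDerivAt u (fderiv ℝ u (shear e γ y s)) (shear e γ y s) :=
        (differentiableAt_of_mem_epi hγ.continuous hu ((shear_mem_epi he).2 hs)).hasFDerivAt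
      have h3 : HasDerivAt (fun s => shear e γ y s) e s := by
        have := (((hasDerivAt_id s).const_add (γ y)).smul_const e).const_add (y : F)
        simpa [shear] using this
      exact h2.comp_hasDerivAt s h3
    have h4 : Tendsto (fun s => u (shear e γ y s)) atTop (𝓝 0) := by
      refine tendsto_const_nhds.congr' ?_
      filter_upwards [eventually_gt_atTop (max R 0 - γ y)] with s hs
      refine (hR _ ?_).symm
      have h5 := norm_add_smul_sq he y (γ y + s)
      have h6 : γ y + s ≤ ‖shear e γ y s‖ :=
        abs_le_of_sq_le_sq' (by rw [shear, h5]; nlinarith [sq_nonneg ‖y‖]) (norm_nonneg _) |>.2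
      linarith [le_max_left R 0]
    rw [integral_Ioi_of_hasDerivAt_of_tendsto (hcont y) h1 hy h4, shear_zero, zero_sub]
  have hsplit : ∀ p, a p v = (a p h + fderiv ℝ γ p.1 h * a p e) +
      (c - fderiv ℝ γ p.1 h) * a p e := by
    intro p
    conv_lhs => rw [hv]
    rw [map_add, map_smul, smul_eq_mul]
    ring
  have hrest : Integrable (fun p => (c - fderiv ℝ γ p.1 h) * a p e) μ := by
    simp only [sub_mul]
    exact ((hint e).const_mul c).sub hslope
  rw [setIntegral_epi he hγ.continuous]
  calc ∫ p, a p v ∂μ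
      = ∫ p, (a p h + fderiv ℝ γ p.1 h * a p e) ∂μ + ∫ p, (c - fderiv ℝ γ p.1 h) * a p e ∂μ := by
        rw [← integral_add hsum hrest]
        exact integral_congr_ae (Eventually.of_forall hsplit)
    _ = ∫ y : Hyp e, ∫ s in Ioi (0 : ℝ), (c - fderiv ℝ γ y h) * a (y, s) e := by
        rw [hzero, zero_add, hμ, integral_prod _ hrest]
    _ = _ := by
        refine integral_congr_ae ?_
        filter_upwards [(hint e).prod_right_ae] with y hy
        rw [integral_const_mul, hvert y hy]
        ring

end EpigraphDivergence

/-! ### Boundary charts -/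

section Charts

open scoped NNReal

variable {N : ℕ}

/-- In the open set `V`, the set `Ω` is the region above the graph of the continuous function
`γ`. -/
structure IsGraphOn (Ω : Set (Rn N)) (e : Rn N) (γ : Hyp e → ℝ) (V : Set (Rn N)) : Prop where
  norm_eq : ‖e‖ = 1
  cont : Continuous γ
  isOpen : IsOpen V
  mem_iff : ∀ x ∈ V, (x ∈ Ω ↔ x ∈ epi e γ)

theorem IsGraphNear.exists_isGraphOn {Ω : Set (Rn N)} {x₀ e : Rn N} {γ : Hyp e → ℝ}
    (h : IsGraphNear Ω x₀ e γ) (hγ : Continuous γ) : ∃ V, x₀ ∈ V ∧ IsGraphOn Ω e γ V := by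
  obtain ⟨V, hV, hVo, hx⟩ := eventually_nhds_iff.1 h.2
  exact ⟨V, hx, h.1, hγ, hVo, hV⟩

theorem hproj_graphMap {e : Rn N} (γ : Hyp e → ℝ) (y : Hyp e) :
    hproj e (graphMap e γ y) = y := hproj_add_smul e y (γ y)

theorem inner_graphMap {e : Rn N} (he : ‖e‖ = 1) (γ : Hyp e → ℝ) (y : Hyp e) :
    ⟪e, graphMap e γ y⟫ = γ y := inner_add_smul he y (γ y)

theorem continuous_graphMap {e : Rn N} {γ : Hyp e → ℝ} (hγ : Continuous γ) :
    Continuous (graphMap e γ) := by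
  unfold graphMap; fun_prop

theorem graphMap_hproj {e : Rn N} (he : ‖e‖ = 1) {γ : Hyp e → ℝ} {x : Rn N}
    (hx : γ (hproj e x) = ⟪e, x⟫) : graphMap e γ (hproj e x) = x := by
  rw [graphMap, hx, hproj_add_inner he]

theorem closure_epi {e : Rn N} (he : ‖e‖ = 1) {γ : Hyp e → ℝ} (hγ : Continuous γ) :
    closure (epi e γ) = {x | γ (hproj e x) ≤ ⟪e, x⟫} := by
  apply Subset.antisymm
  · refine closure_minimal (fun x hx => show γ (hproj e x) ≤ ⟪e, x⟫ from le_of_lt hx)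
      (isClosed_le (by fun_prop) (by fun_prop))
  · intro x hx
    replace hx : γ (hproj e x) ≤ ⟪e, x⟫ := hx
    have hlim : Tendsto (fun t : ℝ => x + t • e) (𝓝[>] 0) (𝓝 x) := by
      have : Continuous fun t : ℝ => x + t • e := by fun_prop
      simpa using (this.tendsto 0).mono_left nhdsWithin_le_nhds
    refine mem_closure_of_tendsto hlim (eventually_nhdsWithin_of_forall fun t (ht : 0 < t) => ?_)
    have h1 : x + t • e = (hproj e x : Rn N) + (⟪e, x⟫ + t) • e := by
      conv_lhs => rw [← hproj_add_inner he x]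
      rw [add_smul, add_assoc]
    change γ (hproj e (x + t • e)) < ⟪e, x + t • e⟫
    rw [h1, hproj_add_smul, inner_add_smul he]
    linarith

section
variable {Ω : Set (Rn N)} {e : Rn N} {γ : Hyp e → ℝ} {V : Set (Rn N)}

theorem IsGraphOn.mem_closure_iff (h : IsGraphOn Ω e γ V) {x : Rn N} (hx : x ∈ V) :
    x ∈ closure Ω ↔ γ (hproj e x) ≤ ⟪e, x⟫ := by
  have : x ∈ closure Ω ↔ x ∈ closure (epi e γ) := by
    rw [mem_closure_iff_frequently, mem_closure_iff_frequently]
    refine frequently_congr ?_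
    filter_upwards [h.isOpen.mem_nhds hx] with z hz using h.mem_iff z hz
  rw [this, closure_epi h.norm_eq h.cont]
  rfl

theorem IsGraphOn.mem_frontier_iff (h : IsGraphOn Ω e γ V) (hΩ : IsOpen Ω) {x : Rn N}
    (hx : x ∈ V) : x ∈ frontier Ω ↔ γ (hproj e x) = ⟪e, x⟫ := by
  rw [hΩ.frontier_eq, Set.mem_sdiff, h.mem_closure_iff hx, h.mem_iff x hx]
  simp only [epi, mem_ofPred_eq, not_lt]
  exact ⟨fun h => le_antisymm h.1 h.2, fun h => ⟨h.le, h.ge⟩⟩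

theorem IsGraphOn.graphMap_mem_frontier (h : IsGraphOn Ω e γ V) (hΩ : IsOpen Ω) {y : Hyp e}
    (hy : graphMap e γ y ∈ V) : graphMap e γ y ∈ frontier Ω := by
  rw [h.mem_frontier_iff hΩ hy, hproj_graphMap, inner_graphMap h.norm_eq]

/-! ### The normal vector and the surface measure in a chart -/

/-- The downward unit normal `(∇γ - e) / √(1 + |∇γ|²)` of the graph of `γ`. -/
def graphNormal (e : Rn N) (γ : Hyp e → ℝ) (y : Hyp e) : Rn N :=
  (graphDensity (fderiv ℝ γ y))⁻¹ •
    ((((InnerProductSpace.toDual ℝ (Hyp e)).symm (fderiv ℝ γ y) : Hyp e) : Rn N) - e)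

theorem inner_graphNormal (γ : Hyp e → ℝ) (y : Hyp e) (v : Rn N) :
    ⟪graphNormal e γ y, v⟫ =
      (graphDensity (fderiv ℝ γ y))⁻¹ * (fderiv ℝ γ y (hproj e v) - ⟪e, v⟫) := by
  have h : ∀ a : Hyp e, ⟪(a : Rn N), v⟫ = ⟪a, hproj e v⟫ := fun a =>
    (Submodule.inner_orthogonalProjectionOnto_eq_of_mem_left a v).symm
  rw [graphNormal, real_inner_smul_left, inner_sub_left, h, InnerProductSpace.toDual_symm_apply]

theorem norm_graphNormal (he : ‖e‖ = 1) (γ : Hyp e → ℝ) (y : Hyp e) :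
    ‖graphNormal e γ y‖ = 1 := by
  set ℓ := fderiv ℝ γ y
  have h1 := norm_add_smul_sq he ((InnerProductSpace.toDual ℝ (Hyp e)).symm ℓ) (-1)
  rw [LinearIsometryEquiv.norm_map, neg_one_smul, ← sub_eq_add_neg, neg_one_sq, add_comm,
    ← graphDensity_sq] at h1
  have h2 := (sq_eq_sq₀ (norm_nonneg _) (graphDensity_pos ℓ).le).1 h1
  rw [graphNormal, norm_smul, h2, Real.norm_of_nonneg (inv_nonneg.2 (graphDensity_pos ℓ).le),
    inv_mul_cancel₀ (graphDensity_pos ℓ).ne']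

/-- At a point of differentiability, the outer unit normal is the downward unit normal of the
graph. -/
theorem IsGraphOn.isOuterUnitNormal (h : IsGraphOn Ω e γ V) {y : Hyp e}
    (hy : graphMap e γ y ∈ V) (hd : DifferentiableAt ℝ γ y) :
    IsOuterUnitNormal Ω (graphMap e γ y) (graphNormal e γ y) := by
  have he := h.norm_eq
  refine ⟨norm_graphNormal he γ y, fun ε hε => ?_⟩
  set x := graphMap e γ y with hxdef
  have hpx : hproj e x = y := hproj_graphMap γ y
  have hex : ⟪e, x⟫ = γ y := inner_graphMap he γ y
  have hlim : Tendsto (hproj e) (𝓝 x) (𝓝 y) := by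
    have := (hproj e).continuous.tendsto x
    rwa [hpx] at this
  have hd' : ∀ᶠ z in 𝓝 x, ‖γ (hproj e z) - γ y - fderiv ℝ γ y (hproj e z - y)‖ ≤
      ε * ‖hproj e z - y‖ := hlim.eventually (hd.hasFDerivAt.isLittleO.def hε)
  filter_upwards [hd', h.isOpen.mem_nhds hy] with z hz hzV
  have hJ := one_le_graphDensity (fderiv ℝ γ y)
  have hJ0 := graphDensity_pos (fderiv ℝ γ y)
  have hpz : hproj e (z - x) = hproj e z - y := by rw [map_sub, hpx]
  have hez : ⟪e, z - x⟫ = ⟪e, z⟫ - γ y := by rw [inner_sub_right, hex]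
  have hle : ‖hproj e z - y‖ ≤ ‖z - x‖ := by
    have h1 := norm_add_smul_sq he (hproj e (z - x)) ⟪e, z - x⟫
    rw [hproj_add_inner he, hpz] at h1
    exact abs_le_of_sq_le_sq' (by nlinarith [sq_nonneg ⟪e, z - x⟫]) (norm_nonneg _) |>.2
  rw [inner_graphNormal, hpz, hez, h.mem_iff z hzV, inv_mul_lt_iff₀ hJ0, lt_inv_mul_iff₀ hJ0]
  set ℓ := fderiv ℝ γ y (hproj e z - y)
  set J := graphDensity (fderiv ℝ γ y)
  rw [Real.norm_eq_abs, abs_le] at hz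
  have h2 : ε * ‖hproj e z - y‖ ≤ ε * ‖z - x‖ := by gcongr
  have h3 : ε * ‖z - x‖ ≤ J * (ε * ‖z - x‖) := le_mul_of_one_le_left (by positivity) hJ
  change (_ → γ (hproj e z) < ⟪e, z⟫) ∧ (_ → ¬ γ (hproj e z) < ⟪e, z⟫)
  constructor <;> intro h4
  · linarith
  · rw [not_lt]; linarith

theorem IsGraphOn.normal_eq (h : IsGraphOn Ω e γ V) {y : Hyp e}
    (hy : graphMap e γ y ∈ V) (hd : DifferentiableAt ℝ γ y) :
    normal Ω (graphMap e γ y) = graphNormal e γ y :=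
  (h.isOuterUnitNormal hy hd).normal_eq

theorem finrank_hyp (he : ‖e‖ = 1) : Module.finrank ℝ (Hyp e) = N - 1 := by
  have h0 : e ≠ 0 := by rintro rfl; simp at he
  have h1 := Submodule.finrank_add_finrank_orthogonal (Submodule.span ℝ {e})
  rw [finrank_span_singleton h0, finrank_euclideanSpace_fin] at h1
  change Module.finrank ℝ (Hyp e) = N - 1
  have h2 : 1 + Module.finrank ℝ (Hyp e) = N := h1
  omega

/-- In a boundary chart, the surface measure is given by the area density. -/
theorem IsGraphOn.surfaceMeasure_restrict (h : IsGraphOn Ω e γ V) (hΩ : IsOpen Ω)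
    (hγ : (∃ K, LipschitzWith K γ) ∨ Differentiable ℝ γ) :
    (surfaceMeasure Ω).restrict V =
      ((volume.withDensity fun y => ENNReal.ofReal (graphDensity (fderiv ℝ γ y))).map
        (graphMap e γ)).restrict V := by
  rw [(isGraphParam_graphMap h.norm_eq γ).map_withDensity (measurableEmbedding_graphMap h.cont) hγ,
    finrank_hyp h.norm_eq, surfaceMeasure, Measure.restrict_restrict h.isOpen.measurableSet,
    Measure.restrict_restrict h.isOpen.measurableSet]
  congr 1
  ext x
  refine and_congr_right fun hx => ?_
  rw [h.mem_frontier_iff hΩ hx]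
  constructor
  · exact fun hx' => ⟨_, graphMap_hproj h.norm_eq hx'⟩
  · rintro ⟨y, rfl⟩
    rw [hproj_graphMap, inner_graphMap h.norm_eq]

theorem measurable_graphDensity_fderiv (γ : Hyp e → ℝ) :
    Measurable fun y => graphDensity (fderiv ℝ γ y) :=
  continuous_graphDensity.measurable.comp (measurable_fderiv ℝ γ)

/-- Surface integrals of functions supported in a boundary chart. -/
theorem IsGraphOn.integral_surfaceMeasure (h : IsGraphOn Ω e γ V) (hΩ : IsOpen Ω)
    (hγ : (∃ K, LipschitzWith K γ) ∨ Differentiable ℝ γ) {g : Rn N → ℝ}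
    (hg : ∀ x ∉ V, g x = 0) :
    ∫ x, g x ∂(surfaceMeasure Ω) =
      ∫ y, graphDensity (fderiv ℝ γ y) * g (graphMap e γ y) := by
  rw [← setIntegral_eq_integral_of_forall_compl_eq_zero hg, h.surfaceMeasure_restrict hΩ hγ,
    setIntegral_eq_integral_of_forall_compl_eq_zero hg,
    (measurableEmbedding_graphMap h.cont).integral_map,
    integral_withDensity_eq_integral_toReal_smul
      (measurable_graphDensity_fderiv γ).ennreal_ofReal (by simp)]
  refine integral_congr_ae (Eventually.of_forall fun y => ?_)
  simp only [smul_eq_mul]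
  rw [ENNReal.toReal_ofReal (graphDensity_pos _).le]

/-- A property of almost every boundary point has to be checked only where the graph is
differentiable, by Rademacher's theorem. -/
theorem IsGraphOn.ae_surfaceMeasure_restrict_of_differentiableAt (h : IsGraphOn Ω e γ V)
    (hΩ : IsOpen Ω) (hγ : ∃ K, LipschitzWith K γ) {p : Rn N → Prop}
    (hp : ∀ y, graphMap e γ y ∈ V → DifferentiableAt ℝ γ y → p (graphMap e γ y)) :
    ∀ᵐ x ∂((surfaceMeasure Ω).restrict V), p x := by
  rw [h.surfaceMeasure_restrict hΩ (Or.inl hγ),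
    ae_restrict_iff'₀ h.isOpen.measurableSet.nullMeasurableSet,
    (measurableEmbedding_graphMap h.cont).ae_map_iff]
  obtain ⟨K, hK⟩ := hγ
  refine (withDensity_absolutelyContinuous _ _).ae_le ?_
  filter_upwards [hK.ae_differentiableAt] with y hy hyV using hp y hyV hy

theorem IsGraphOn.aestronglyMeasurable_normal (h : IsGraphOn Ω e γ V) (hΩ : IsOpen Ω)
    (hγ : ∃ K, LipschitzWith K γ) :
    AEStronglyMeasurable (normal Ω) ((surfaceMeasure Ω).restrict V) := by
  have hm : Measurable fun x => graphNormal e γ (hproj e x) := by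
    have : Measurable (graphNormal e γ) := by
      unfold graphNormal
      refine (measurable_graphDensity_fderiv γ).inv.smul (Measurable.sub_const ?_ e)
      exact ((Hyp e).subtypeL.continuous.comp
        (InnerProductSpace.toDual ℝ (Hyp e)).symm.continuous).measurable.comp
          (measurable_fderiv ℝ γ)
    exact this.comp (hproj e).continuous.measurable
  refine hm.aestronglyMeasurable.congr ?_
  refine h.ae_surfaceMeasure_restrict_of_differentiableAt hΩ hγ fun y hyV hy => ?_
  simp only [hproj_graphMap, h.normal_eq hyV hy]

/-- The surface measure of a bounded boundary patch is finite. -/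
theorem IsGraphOn.surfaceMeasure_lt_top (h : IsGraphOn Ω e γ V) (hΩ : IsOpen Ω)
    (hγ : ∃ K, LipschitzWith K γ) (hV : Bornology.IsBounded V) : surfaceMeasure Ω V < ⊤ := by
  have h1 : surfaceMeasure Ω V = (surfaceMeasure Ω).restrict V V := by
    rw [Measure.restrict_apply_self]
  rw [h1, h.surfaceMeasure_restrict hΩ (Or.inl hγ), Measure.restrict_apply_self,
    (measurableEmbedding_graphMap h.cont).map_apply,
    withDensity_apply _ ((continuous_graphMap h.cont).measurable h.isOpen.measurableSet)]
  obtain ⟨K, hK⟩ := hγ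
  have hb : Bornology.IsBounded (graphMap e γ ⁻¹' V) := by
    have := (hproj e).lipschitz.isBounded_image hV
    refine this.subset fun y hy => ⟨_, hy, hproj_graphMap γ y⟩
  calc ∫⁻ y in graphMap e γ ⁻¹' V, ENNReal.ofReal (graphDensity (fderiv ℝ γ y))
      ≤ ∫⁻ _ in graphMap e γ ⁻¹' V, ENNReal.ofReal (√(1 + (K : ℝ) ^ 2)) := by
        refine lintegral_mono fun y => ENNReal.ofReal_le_ofReal (Real.sqrt_le_sqrt ?_)
        gcongr
        exact norm_fderiv_le_of_lipschitz ℝ hK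
    _ < ⊤ := by
        rw [lintegral_const, Measure.restrict_apply_univ]
        exact ENNReal.mul_lt_top ENNReal.ofReal_lt_top hb.measure_lt_top

/-- The closure of a Lipschitz domain contains a cone at each boundary point, so derivatives
relative to it are unique. -/
theorem IsGraphOn.uniqueDiffWithinAt (h : IsGraphOn Ω e γ V) {K : ℝ≥0} (hγ : LipschitzWith K γ)
    {x : Rn N} (hx : x ∈ V) (hxγ : γ (hproj e x) = ⟪e, x⟫) :
    UniqueDiffWithinAt ℝ (closure Ω) x := by
  have he := h.norm_eq
  -- the open cone of slope `K` with vertex `x` lies above the graph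
  set A : Set (Rn N) := {z | K * ‖hproj e (z - x)‖ < ⟪e, z - x⟫} with hA
  have hopen : IsOpen A := isOpen_lt (by fun_prop) (by fun_prop)
  have hconv : Convex ℝ A := by
    intro z hz w hw a b ha hb hab
    have h1 : a • z + b • w - x = a • (z - x) + b • (w - x) := by
      have : x = (a + b) • x := by rw [hab, one_smul]
      conv_lhs => rw [this]
      simp only [smul_sub, add_smul]; abel
    change K * ‖hproj e (a • z + b • w - x)‖ < ⟪e, a • z + b • w - x⟫
    rw [h1, map_add, map_smul, map_smul, inner_add_right, inner_smul_right, inner_smul_right]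
    have h2 : ‖a • hproj e (z - x) + b • hproj e (w - x)‖ ≤
        a * ‖hproj e (z - x)‖ + b * ‖hproj e (w - x)‖ := by
      refine (norm_add_le _ _).trans_eq ?_
      rw [norm_smul, norm_smul, Real.norm_of_nonneg ha, Real.norm_of_nonneg hb]
    have h3 : (K : ℝ) * ‖a • hproj e (z - x) + b • hproj e (w - x)‖ ≤
      K * (a * ‖hproj e (z - x)‖ + b * ‖hproj e (w - x)‖) := by gcongr
    have hz' : K * ‖hproj e (z - x)‖ < ⟪e, z - x⟫ := hz
    have hw' : K * ‖hproj e (w - x)‖ < ⟪e, w - x⟫ := hw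
    rcases ha.eq_or_lt with rfl | ha'
    · have : b = 1 := by linarith
      subst this
      linarith
    · nlinarith
  have hcl : x ∈ closure A := by
    have hlim : Tendsto (fun t : ℝ => x + t • e) (𝓝[>] 0) (𝓝 x) := by
      have : Continuous fun t : ℝ => x + t • e := by fun_prop
      simpa using (this.tendsto 0).mono_left nhdsWithin_le_nhds
    refine mem_closure_of_tendsto hlim (eventually_nhdsWithin_of_forall fun t (ht : 0 < t) => ?_)
    have h1 : hproj e (t • e) = 0 := by simp
    change K * ‖hproj e (x + t • e - x)‖ < ⟪e, x + t • e - x⟫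
    rw [add_sub_cancel_left, h1, inner_smul_right, real_inner_self_eq_norm_sq, he]
    simp [show 0 < t from ht]
  have hne : (interior A).Nonempty := by
    rw [hopen.interior_eq]
    exact closure_nonempty_iff.1 ⟨x, hcl⟩
  have hu : UniqueDiffWithinAt ℝ (A ∩ V) x :=
    (uniqueDiffWithinAt_convex hconv hne hcl).inter (h.isOpen.mem_nhds hx)
  refine hu.mono fun z hz => ?_
  rw [h.mem_closure_iff hz.2]
  have h1 : K * ‖hproj e (z - x)‖ < ⟪e, z - x⟫ := hz.1
  have h2 := hγ.dist_le_mul (hproj e z) (hproj e x)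
  rw [map_sub, inner_sub_right] at h1
  rw [Real.dist_eq, dist_eq_norm] at h2
  linarith [le_abs_self (γ (hproj e z) - γ (hproj e x))]

/-- The divergence theorem for functions supported in a boundary chart. -/
theorem IsGraphOn.integral_fderiv_eq (h : IsGraphOn Ω e γ V) (hΩ : IsOpen Ω)
    (hb : Bornology.IsBounded Ω) (hud : UniqueDiffOn ℝ (closure Ω))
    {K : ℝ≥0} (hγ : LipschitzWith K γ) {u : Rn N → ℝ} (hu : ContDiffOn ℝ 1 u (closure Ω))
    {S : Set (Rn N)} (hS : IsCompact S) (hSV : S ⊆ V) (hu0 : ∀ x ∉ S, u x = 0) (v : Rn N) :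
    ∫ x in Ω, fderiv ℝ u x v = ∫ x, u x * ⟪normal Ω x, v⟫ ∂(surfaceMeasure Ω) := by
  have he := h.norm_eq
  have hzero : ∀ x ∉ S, u =ᶠ[𝓝 x] fun _ => 0 := fun x hx => by
    filter_upwards [hS.isClosed.isOpen_compl.mem_nhds hx] with z hz using hu0 z hz
  have hfd0 : ∀ x ∉ S, fderiv ℝ u x = 0 := fun x hx => by
    rw [(hzero x hx).fderiv_eq]; simp
  have hC1 : ContDiffOn ℝ 1 u (epi e γ) := by
    intro x hx
    by_cases hxS : x ∈ S
    · have hxΩ : x ∈ Ω := (h.mem_iff x (hSV hxS)).2 hx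
      exact (hu.contDiffAt (mem_of_superset (hΩ.mem_nhds hxΩ) subset_closure)).contDiffWithinAt
    · exact (contDiffAt_const.congr_of_eventuallyEq (hzero x hxS)).contDiffWithinAt
  have hcont : ∀ y, ContinuousWithinAt (fun s => u (shear e γ y s)) (Ici 0) 0 := by
    intro y
    have hsc : Continuous fun s => shear e γ y s := by unfold shear; fun_prop
    by_cases hyS : shear e γ y 0 ∈ S
    · have hyV := hSV hyS
      have hyc : shear e γ y 0 ∈ closure Ω := by
        rw [h.mem_closure_iff hyV, shear, hproj_add_smul, inner_add_smul he, add_zero]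
      refine (hu.continuousOn _ hyc).tendsto.comp ?_
      refine tendsto_nhdsWithin_iff.2 ⟨hsc.continuousAt.mono_left nhdsWithin_le_nhds, ?_⟩
      have : ∀ᶠ s in 𝓝[≥] (0 : ℝ), shear e γ y s ∈ V :=
        (hsc.continuousAt.mono_left nhdsWithin_le_nhds).eventually (h.isOpen.mem_nhds hyV)
      filter_upwards [this, self_mem_nhdsWithin] with s hs hs0
      rw [h.mem_closure_iff hs, shear, hproj_add_smul, inner_add_smul he]
      linarith [show (0 : ℝ) ≤ s from hs0]
    · have h1 : (fun s => u (shear e γ y s)) =ᶠ[𝓝 0] fun _ => 0 :=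
        hsc.continuousAt.eventually (hzero _ hyS)
      exact (continuousAt_const.congr h1.symm).continuousWithinAt
  have hcomp : IsCompact (closure Ω) := hb.isCompact_closure
  obtain ⟨M, hM⟩ := hcomp.exists_bound_of_continuousOn (hu.continuousOn_fderivWithin hud le_rfl)
  have hfd : ∀ x ∈ Ω, fderivWithin ℝ u (closure Ω) x = fderiv ℝ u x := fun x hx =>
    fderivWithin_of_mem_nhds (mem_of_superset (hΩ.mem_nhds hx) subset_closure)
  have hM' : ∀ x ∈ epi e γ, ‖fderiv ℝ u x‖ ≤ max M 0 := by
    intro x hx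
    by_cases hxS : x ∈ S
    · have hxΩ : x ∈ Ω := (h.mem_iff x (hSV hxS)).2 hx
      rw [← hfd x hxΩ]
      exact (hM x (subset_closure hxΩ)).trans (le_max_left _ _)
    · rw [hfd0 x hxS, norm_zero]; exact le_max_right _ _
  obtain ⟨R, hR⟩ := hS.isBounded.subset_closedBall 0
  have hR' : ∀ x, R < ‖x‖ → u x = 0 := fun x hx => hu0 x fun hxS => by
    have := hR hxS
    rw [mem_closedBall_zero_iff] at this
    linarith
  have hvol : ∫ x in Ω, fderiv ℝ u x v = ∫ x in epi e γ, fderiv ℝ u x v := by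
    rw [← integral_indicator hΩ.measurableSet,
      ← integral_indicator (isOpen_epi h.cont).measurableSet]
    refine integral_congr_ae (Eventually.of_forall fun x => ?_)
    by_cases hxS : x ∈ S
    · by_cases hxΩ : x ∈ Ω
      · rw [indicator_of_mem hxΩ, indicator_of_mem ((h.mem_iff x (hSV hxS)).1 hxΩ)]
      · rw [indicator_of_notMem hxΩ,
          indicator_of_notMem (fun hc => hxΩ ((h.mem_iff x (hSV hxS)).2 hc))]
    · have h0 : fderiv ℝ u x v = 0 := by rw [hfd0 x hxS]; rfl
      have h1 : ∀ s : Set (Rn N), s.indicator (fun x => fderiv ℝ u x v) x = 0 := fun s =>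
        indicator_apply_eq_zero.2 fun _ => h0
      rw [h1, h1]
  rw [hvol, integral_fderiv_epi he hγ hC1 hcont hM' hR' v,
    h.integral_surfaceMeasure hΩ (Or.inl ⟨K, hγ⟩) (g := fun x => u x * ⟪normal Ω x, v⟫)
      (fun x hx => by rw [hu0 x fun hxS => hx (hSV hxS), zero_mul])]
  refine integral_congr_ae ?_
  filter_upwards [hγ.ae_differentiableAt] with y hy
  by_cases hyS : graphMap e γ y ∈ S
  · rw [h.normal_eq (hSV hyS) hy, inner_graphNormal]
    have := (graphDensity_pos (fderiv ℝ γ y)).ne'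
    field_simp
  · rw [hu0 _ hyS]; simp

end

end Charts

/-! ### The divergence theorem on Lipschitz domains -/

section GlobalDivergence

open scoped NNReal ContDiff

variable {N : ℕ} {Ω : Set (Rn N)}

theorem IsGraphOn.mono {e : Rn N} {γ : Hyp e → ℝ} {V W : Set (Rn N)} (h : IsGraphOn Ω e γ V)
    (hW : IsOpen W) (hWV : W ⊆ V) : IsGraphOn Ω e γ W :=
  ⟨h.norm_eq, h.cont, hW, fun x hx => h.mem_iff x (hWV hx)⟩

/-- Every boundary point of a Lipschitz domain lies in a bounded boundary chart. -/
theorem HasLipschitzBoundary.exists_chart (hL : HasLipschitzBoundary Ω) {x₀ : Rn N}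
    (hx₀ : x₀ ∈ frontier Ω) : ∃ (e : Rn N) (γ : Hyp e → ℝ) (K : ℝ≥0) (V : Set (Rn N)),
      LipschitzWith K γ ∧ IsGraphOn Ω e γ V ∧ x₀ ∈ V ∧ Bornology.IsBounded V := by
  obtain ⟨e, γ, ⟨K, hK⟩, hγ⟩ := hL x₀ hx₀
  obtain ⟨V, hxV, hV⟩ := hγ.exists_isGraphOn hK.continuous
  exact ⟨e, γ, K, V ∩ Metric.ball x₀ 1, hK,
    hV.mono (hV.isOpen.inter Metric.isOpen_ball) inter_subset_left,
    ⟨hxV, Metric.mem_ball_self one_pos⟩, Metric.isBounded_ball.subset inter_subset_right⟩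

theorem uniqueDiffOn_closure (hΩ : IsOpen Ω) (hL : HasLipschitzBoundary Ω) :
    UniqueDiffOn ℝ (closure Ω) := by
  intro x hx
  by_cases hxΩ : x ∈ Ω
  · exact (hΩ.uniqueDiffWithinAt hxΩ).mono subset_closure
  · have hxf : x ∈ frontier Ω := by rw [hΩ.frontier_eq]; exact ⟨hx, hxΩ⟩
    obtain ⟨e, γ, K, V, hK, hV, hxV, -⟩ := hL.exists_chart hxf
    exact hV.uniqueDiffWithinAt hK hxV ((hV.mem_frontier_iff hΩ hxV).1 hxf)

theorem isCompact_frontier_of_isBounded (hb : Bornology.IsBounded Ω) : IsCompact (frontier Ω) :=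
  hb.isCompact_closure.of_isClosed_subset isClosed_frontier frontier_subset_closure

theorem isFiniteMeasure_surfaceMeasure (hΩ : IsOpen Ω) (hb : Bornology.IsBounded Ω)
    (hL : HasLipschitzBoundary Ω) : IsFiniteMeasure (surfaceMeasure Ω) := by
  refine ⟨?_⟩
  have h1 : surfaceMeasure Ω (frontier Ω) < ⊤ := by
    refine (isCompact_frontier_of_isBounded hb).measure_lt_top_of_nhdsWithin fun x hx => ?_
    obtain ⟨e, γ, K, V, hK, hV, hxV, hVb⟩ := hL.exists_chart hx
    exact ⟨V, mem_nhdsWithin_of_mem_nhds (hV.isOpen.mem_nhds hxV),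
      hV.surfaceMeasure_lt_top hΩ ⟨K, hK⟩ hVb⟩
  have h2 : surfaceMeasure Ω (frontier Ω) = surfaceMeasure Ω univ := by
    rw [surfaceMeasure, Measure.restrict_apply_self, Measure.restrict_apply_univ]
  rwa [← h2]

theorem aestronglyMeasurable_normal (hΩ : IsOpen Ω) (hb : Bornology.IsBounded Ω)
    (hL : HasLipschitzBoundary Ω) : AEStronglyMeasurable (normal Ω) (surfaceMeasure Ω) := by
  choose! e γ K V hK hV hxV hVb using fun x (hx : x ∈ frontier Ω) => hL.exists_chart hx
  obtain ⟨t, ht, hcov⟩ := (isCompact_frontier_of_isBounded hb).elim_nhds_subcover V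
    fun x hx => (hV x hx).isOpen.mem_nhds (hxV x hx)
  have h1 : AEStronglyMeasurable (normal Ω)
      ((surfaceMeasure Ω).restrict (⋃ x : t, V x)) :=
    AEStronglyMeasurable.iUnion fun x =>
      (hV x (ht x x.2)).aestronglyMeasurable_normal hΩ ⟨_, hK x (ht x x.2)⟩
  have h2 : surfaceMeasure Ω = (surfaceMeasure Ω).restrict (frontier Ω) := by
    rw [surfaceMeasure, Measure.restrict_restrict isClosed_frontier.measurableSet, inter_self]
  rw [h2]
  refine h1.mono_measure (Measure.restrict_mono ?_ le_rfl)
  rwa [iUnion_subtype]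

/-- The components of the outer normal are essentially bounded. -/
theorem memLp_top_normal (hΩ : IsOpen Ω) (hb : Bornology.IsBounded Ω)
    (hL : HasLipschitzBoundary Ω) (i : Fin N) :
    MemLp (fun x => normal Ω x i) ⊤ (surfaceMeasure Ω) := by
  refine memLp_top_of_bound ?_ 1 (Eventually.of_forall fun x => ?_)
  · exact (EuclideanSpace.proj (𝕜 := ℝ) i).continuous.comp_aestronglyMeasurable
      (aestronglyMeasurable_normal hΩ hb hL)
  · have h1 : ‖normal Ω x‖ ≤ 1 := by
      by_cases h : ∃ ν, IsOuterUnitNormal Ω x ν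
      · obtain ⟨ν, hν⟩ := h
        rw [hν.normal_eq, hν.1]
      · rw [normal, dif_neg h]; simp
    exact (PiLp.norm_apply_le _ i).trans h1

/-- Almost every boundary point has an outer unit normal. -/
theorem ae_isOuterUnitNormal (hΩ : IsOpen Ω) (hb : Bornology.IsBounded Ω)
    (hL : HasLipschitzBoundary Ω) :
    ∀ᵐ x ∂(surfaceMeasure Ω), IsOuterUnitNormal Ω x (normal Ω x) := by
  choose! e γ K V hK hV hxV hVb using fun x (hx : x ∈ frontier Ω) => hL.exists_chart hx
  obtain ⟨t, ht, hcov⟩ := (isCompact_frontier_of_isBounded hb).elim_nhds_subcover V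
    fun x hx => (hV x hx).isOpen.mem_nhds (hxV x hx)
  have h1 : ∀ᵐ x ∂((surfaceMeasure Ω).restrict (⋃ x ∈ (t : Set (Rn N)), V x)),
      IsOuterUnitNormal Ω x (normal Ω x) := by
    rw [ae_restrict_biUnion_iff _ t.countable_toSet]
    intro x hx
    refine (hV x (ht x hx)).ae_surfaceMeasure_restrict_of_differentiableAt hΩ ⟨_, hK x (ht x hx)⟩
      fun y hyV hy => ?_
    have := (hV x (ht x hx)).isOuterUnitNormal hyV hy
    rwa [this.normal_eq]
  have h2 : surfaceMeasure Ω = (surfaceMeasure Ω).restrict (frontier Ω) := by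
    rw [surfaceMeasure, Measure.restrict_restrict isClosed_frontier.measurableSet, inter_self]
  rw [h2]
  exact ae_mono (Measure.restrict_mono hcov le_rfl) h1

theorem memLp_top_of_continuousOn_frontier (hb : Bornology.IsBounded Ω) {g : Rn N → ℝ}
    (hg : ContinuousOn g (frontier Ω)) : MemLp g ⊤ (surfaceMeasure Ω) := by
  obtain ⟨C, hC⟩ := (isCompact_frontier_of_isBounded hb).exists_bound_of_continuousOn hg
  exact memLp_top_of_bound (hg.aestronglyMeasurable isClosed_frontier.measurableSet) C
    (ae_restrict_of_forall_mem isClosed_frontier.measurableSet hC)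

theorem integrableOn_of_continuousOn_closure (hb : Bornology.IsBounded Ω) {g : Rn N → ℝ}
    (hg : ContinuousOn g (closure Ω)) : IntegrableOn g Ω :=
  (hg.integrableOn_compact hb.isCompact_closure).mono_set subset_closure

/-- A smooth partition of unity on a compact set, subordinate to a given family of neighbourhoods
of its points. -/
theorem exists_smooth_partition {S : Set (Rn N)} (hS : IsCompact S) (U : Rn N → Set (Rn N))
    (hU : ∀ x ∈ S, IsOpen (U x) ∧ x ∈ U x ∧ Bornology.IsBounded (U x)) :
    ∃ (t : Finset (Rn N)) (ψ : t → Rn N → ℝ), (∀ i : t, (i : Rn N) ∈ S) ∧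
      (∀ i, ContDiff ℝ ∞ (ψ i)) ∧ (∀ i, HasCompactSupport (ψ i)) ∧
      (∀ i, tsupport (ψ i) ⊆ U i) ∧ ∀ x ∈ S, ∑ i, ψ i x = 1 := by
  obtain ⟨t, ht, hcov⟩ := hS.elim_nhds_subcover U fun x hx => (hU x hx).1.mem_nhds (hU x hx).2.1
  obtain ⟨f, hf⟩ := SmoothPartitionOfUnity.exists_isSubordinate
    (modelWithCornersSelf ℝ (Rn N)) hS.isClosed (fun i : t => U i)
    (fun i => (hU i (ht i i.2)).1) (by rwa [iUnion_subtype])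
  refine ⟨t, fun i => f i, fun i => ht i i.2, fun i => (f i).contMDiff.contDiff, fun i => ?_,
    fun i => hf i, fun x hx => ?_⟩
  · exact Metric.isCompact_of_isClosed_isBounded (isClosed_tsupport _)
      ((hU i (ht i i.2)).2.2.subset (hf i))
  · rw [← finsum_eq_sum_of_fintype]
    exact f.sum_eq_one hx

theorem fderivWithin_closure_eq (hΩ : IsOpen Ω) (u : Rn N → ℝ) {x : Rn N} (hx : x ∈ Ω) :
    fderivWithin ℝ u (closure Ω) x = fderiv ℝ u x :=
  fderivWithin_of_mem_nhds (mem_of_superset (hΩ.mem_nhds hx) subset_closure)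

theorem integrableOn_fderiv (hΩ : IsOpen Ω) (hb : Bornology.IsBounded Ω)
    (hud : UniqueDiffOn ℝ (closure Ω)) {u : Rn N → ℝ} (hu : ContDiffOn ℝ 1 u (closure Ω))
    (v : Rn N) : IntegrableOn (fun x => fderiv ℝ u x v) Ω := by
  have h : IntegrableOn (fun x => fderivWithin ℝ u (closure Ω) x v) Ω :=
    integrableOn_of_continuousOn_closure hb
      ((hu.continuousOn_fderivWithin hud le_rfl).clm_apply continuousOn_const)
  refine h.congr_fun (fun x hx => ?_) hΩ.measurableSet
  simp only [fderivWithin_closure_eq hΩ u hx]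

/-- The divergence theorem for functions with compact support in `Ω`. -/
theorem integral_fderiv_eq_zero_of_compact (hΩ : IsOpen Ω) {u : Rn N → ℝ}
    (hu : ContDiffOn ℝ 1 u (closure Ω)) {S : Set (Rn N)} (hS : IsCompact S) (hSΩ : S ⊆ Ω)
    (hu0 : ∀ x ∉ S, u x = 0) (v : Rn N) : ∫ x in Ω, fderiv ℝ u x v = 0 := by
  have hzero : ∀ x ∉ S, u =ᶠ[𝓝 x] fun _ => 0 := fun x hx => by
    filter_upwards [hS.isClosed.isOpen_compl.mem_nhds hx] with z hz using hu0 z hz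
  have hC1 : ContDiff ℝ 1 u := by
    rw [contDiff_iff_contDiffAt]
    intro x
    by_cases hxS : x ∈ S
    · exact hu.contDiffAt (mem_of_superset (hΩ.mem_nhds (hSΩ hxS)) subset_closure)
    · exact contDiffAt_const.congr_of_eventuallyEq (hzero x hxS)
  have hcs : HasCompactSupport u := HasCompactSupport.intro hS hu0
  obtain ⟨C, hC⟩ := ContDiff.lipschitzWith_of_hasCompactSupport hcs hC1 one_ne_zero
  rw [setIntegral_eq_integral_of_forall_compl_eq_zero, ← integral_lineDeriv_eq_zero volume hC hcs v]
  · refine integral_congr_ae (Eventually.of_forall fun x => ?_)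
    exact ((hC1.differentiable one_ne_zero x).lineDeriv_eq_fderiv).symm
  · intro x hx
    rw [(hzero x fun h => hx (hSΩ h)).fderiv_eq]; simp

/-- The divergence theorem on a bounded Lipschitz domain, for a function of class `C¹` up to the
boundary. -/
theorem integral_fderiv_eq_surface (hΩ : IsOpen Ω) (hb : Bornology.IsBounded Ω)
    (hL : HasLipschitzBoundary Ω) {u : Rn N → ℝ} (hu : ContDiffOn ℝ 1 u (closure Ω)) (v : Rn N) :
    ∫ x in Ω, fderiv ℝ u x v = ∫ x, u x * ⟪normal Ω x, v⟫ ∂(surfaceMeasure Ω) := by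
  have hud := uniqueDiffOn_closure hΩ hL
  have := isFiniteMeasure_surfaceMeasure hΩ hb hL
  have hloc : ∀ x₀ ∈ closure Ω, ∃ U, (IsOpen U ∧ x₀ ∈ U ∧ Bornology.IsBounded U) ∧
      ∀ (w : Rn N → ℝ) (S : Set (Rn N)), ContDiffOn ℝ 1 w (closure Ω) → IsCompact S → S ⊆ U →
        (∀ x ∉ S, w x = 0) →
        ∫ x in Ω, fderiv ℝ w x v = ∫ x, w x * ⟪normal Ω x, v⟫ ∂(surfaceMeasure Ω) := by
    intro x₀ hx₀
    by_cases hx : x₀ ∈ Ω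
    · refine ⟨Ω, ⟨hΩ, hx, hb⟩, fun w S hw hS hSΩ hw0 => ?_⟩
      rw [integral_fderiv_eq_zero_of_compact hΩ hw hS hSΩ hw0]
      symm
      refine integral_eq_zero_of_ae ?_
      refine ae_restrict_of_forall_mem isClosed_frontier.measurableSet fun x hx => ?_
      rw [hΩ.frontier_eq] at hx
      simp [hw0 x fun h => hx.2 (hSΩ h)]
    · obtain ⟨e, γ, K, V, hK, hV, hxV, hVb⟩ :=
        hL.exists_chart (x₀ := x₀) (by rw [hΩ.frontier_eq]; exact ⟨hx₀, hx⟩)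
      exact ⟨V, ⟨hV.isOpen, hxV, hVb⟩, fun w S hw hS hSV hw0 =>
        hV.integral_fderiv_eq hΩ hb hud hK hw hS hSV hw0 v⟩
  choose! U hU hUw using hloc
  obtain ⟨t, ψ, ht, hψ, hψc, hψU, hψ1⟩ := exists_smooth_partition hb.isCompact_closure U hU
  have hw : ∀ i, ContDiffOn ℝ 1 (fun x => ψ i x * u x) (closure Ω) := fun i =>
    ((hψ i).of_le (by exact_mod_cast le_top)).contDiffOn.mul hu
  have hi : ∀ i, ∫ x in Ω, fderiv ℝ (fun x => ψ i x * u x) x v =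
      ∫ x, ψ i x * u x * ⟪normal Ω x, v⟫ ∂(surfaceMeasure Ω) := fun i =>
    hUw i (ht i) _ (tsupport (ψ i)) (hw i) (hψc i) (hψU i) fun x hx => by
      rw [image_eq_zero_of_notMem_tsupport hx, zero_mul]
  have hn : MemLp (fun x => ⟪normal Ω x, v⟫) ⊤ (surfaceMeasure Ω) := by
    simp only [PiLp.inner_apply, RCLike.inner_apply, conj_trivial]
    exact memLp_finsetSum _ fun j _ => (memLp_top_normal hΩ hb hL j).const_mul (v j)
  calc ∫ x in Ω, fderiv ℝ u x v
      = ∫ x in Ω, ∑ i, fderiv ℝ (fun x => ψ i x * u x) x v := by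
        refine setIntegral_congr_fun hΩ.measurableSet fun x hx => ?_
        have h1 : u =ᶠ[𝓝 x] fun z => ∑ i, ψ i z * u z := by
          filter_upwards [hΩ.mem_nhds hx] with z hz
          rw [← Finset.sum_mul, hψ1 z (subset_closure hz), one_mul]
        rw [h1.fderiv_eq, fderiv_fun_sum]
        · simp
        · intro i _
          exact ((hw i).contDiffAt
            (mem_of_superset (hΩ.mem_nhds hx) subset_closure)).differentiableAt one_ne_zero
    _ = ∑ i, ∫ x in Ω, fderiv ℝ (fun x => ψ i x * u x) x v :=
        integral_finsetSum _ fun i _ => integrableOn_fderiv hΩ hb hud (hw i) v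
    _ = ∑ i, ∫ x, ψ i x * u x * ⟪normal Ω x, v⟫ ∂(surfaceMeasure Ω) :=
        Finset.sum_congr rfl fun i _ => hi i
    _ = ∫ x, ∑ i, ψ i x * u x * ⟪normal Ω x, v⟫ ∂(surfaceMeasure Ω) := by
        refine (integral_finsetSum _ fun i _ => ?_).symm
        have h1 : MemLp (fun x => ψ i x * u x) ⊤ (surfaceMeasure Ω) :=
          memLp_top_of_continuousOn_frontier hb
            ((hw i).continuousOn.mono frontier_subset_closure)
        exact (MemLp.mul (p := ⊤) (r := ⊤) hn h1).integrable le_top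
    _ = _ := by
        refine integral_congr_ae ?_
        refine ae_restrict_of_forall_mem isClosed_frontier.measurableSet fun x hx => ?_
        simp only
        rw [← Finset.sum_mul, ← Finset.sum_mul, hψ1 x (frontier_subset_closure hx), one_mul]

end GlobalDivergence

/-! ### Partial derivatives up to the boundary -/

section PartialDerivatives

variable {N : ℕ} {Ω : Set (Rn N)}

theorem contDiffOn_pd (hud : UniqueDiffOn ℝ (closure Ω)) {g : Rn N → ℝ} {m n : WithTop ℕ∞}
    (hg : ContDiffOn ℝ n g (closure Ω)) (hmn : m + 1 ≤ n) (i : Fin N) :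
    ContDiffOn ℝ m (pd Ω i g) (closure Ω) :=
  (hg.fderivWithin hud hmn).clm_apply contDiffOn_const

theorem continuousOn_pd (hud : UniqueDiffOn ℝ (closure Ω)) {g : Rn N → ℝ}
    (hg : ContDiffOn ℝ 1 g (closure Ω)) (i : Fin N) : ContinuousOn (pd Ω i g) (closure Ω) :=
  (contDiffOn_pd (m := 0) hud hg (by simp) i).continuousOn

theorem pd_congr {g h : Rn N → ℝ} (hgh : EqOn g h (closure Ω)) (i : Fin N) :
    EqOn (pd Ω i g) (pd Ω i h) (closure Ω) := fun x hx => by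
  rw [pd, pd, fderivWithin_congr hgh (hgh hx)]

theorem pd_mul (hud : UniqueDiffOn ℝ (closure Ω)) {g h : Rn N → ℝ}
    (hg : ContDiffOn ℝ 1 g (closure Ω)) (hh : ContDiffOn ℝ 1 h (closure Ω)) (i : Fin N)
    {x : Rn N} (hx : x ∈ closure Ω) :
    pd Ω i (fun z => g z * h z) x = g x * pd Ω i h x + pd Ω i g x * h x := by
  simp only [pd]
  rw [fderivWithin_fun_mul (hud x hx) (hg.differentiableOn one_ne_zero x hx)
    (hh.differentiableOn one_ne_zero x hx)]
  simp [mul_comm]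

theorem pd_sum (hud : UniqueDiffOn ℝ (closure Ω)) {ι : Type*} (s : Finset ι)
    {g : ι → Rn N → ℝ} (hg : ∀ j ∈ s, ContDiffOn ℝ 1 (g j) (closure Ω)) (i : Fin N)
    {x : Rn N} (hx : x ∈ closure Ω) :
    pd Ω i (fun z => ∑ j ∈ s, g j z) x = ∑ j ∈ s, pd Ω i (g j) x := by
  simp only [pd]
  rw [fderivWithin_fun_sum (hud x hx) fun j hj => (hg j hj).differentiableOn one_ne_zero x hx]
  simp

theorem pd_pd_eq (hud : UniqueDiffOn ℝ (closure Ω)) {g : Rn N → ℝ}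
    (hg : ContDiffOn ℝ 2 g (closure Ω)) (i j : Fin N) {x : Rn N} (hx : x ∈ closure Ω) :
    pd Ω i (pd Ω j g) x = fderivWithin ℝ (fderivWithin ℝ g (closure Ω)) (closure Ω) x
      (EuclideanSpace.single i 1) (EuclideanSpace.single j 1) := by
  have h1 : DifferentiableWithinAt ℝ (fderivWithin ℝ g (closure Ω)) (closure Ω) x :=
    (hg.fderivWithin (m := 1) hud (by norm_num)).differentiableOn one_ne_zero x hx
  change fderivWithin ℝ (fun z => fderivWithin ℝ g (closure Ω) z (EuclideanSpace.single j 1))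
    (closure Ω) x (EuclideanSpace.single i 1) = _
  rw [fderivWithin_clm_apply (hud x hx) h1 (differentiableWithinAt_const _)]
  simp

/-- Partial derivatives commute up to the boundary. -/
theorem pd_comm (hΩ : IsOpen Ω) (hud : UniqueDiffOn ℝ (closure Ω)) {g : Rn N → ℝ}
    (hg : ContDiffOn ℝ 2 g (closure Ω)) (i j : Fin N) :
    EqOn (pd Ω i (pd Ω j g)) (pd Ω j (pd Ω i g)) (closure Ω) := by
  intro x hx
  have hcl : x ∈ closure (interior (closure Ω)) :=
    closure_mono (interior_maximal subset_closure hΩ) hx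
  rw [pd_pd_eq hud hg i j hx, pd_pd_eq hud hg j i hx]
  exact (hg x hx).isSymmSndFDerivWithinAt (by simp) hud hcl hx _ _

theorem lap_eq (hud : UniqueDiffOn ℝ (closure Ω)) {g : Rn N → ℝ}
    (hg : ContDiffOn ℝ 2 g (closure Ω)) :
    EqOn (lap Ω g) (fun x => ∑ i, pd Ω i (pd Ω i g) x) (closure Ω) := by
  intro x hx
  rw [lap, InnerProductSpace.laplacianWithin_eq_iteratedFDerivWithin_orthonormalBasis g hud hx
    (EuclideanSpace.basisFun (Fin N) ℝ)]
  refine Finset.sum_congr rfl fun i _ => ?_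
  rw [iteratedFDerivWithin_two_apply g hud hx, pd_pd_eq hud hg i i hx]
  simp

theorem contDiffOn_lap (hud : UniqueDiffOn ℝ (closure Ω)) {g : Rn N → ℝ} {m n : ℕ}
    (hg : ContDiffOn ℝ n g (closure Ω)) (hmn : m + 2 ≤ n) :
    ContDiffOn ℝ m (lap Ω g) (closure Ω) := by
  have h2 : ContDiffOn ℝ (m + 1 : ℕ) g (closure Ω) := hg.of_le (by exact_mod_cast (by omega))
  refine ContDiffOn.congr ?_ (lap_eq hud (hg.of_le (by exact_mod_cast (by omega : 2 ≤ n))))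
  refine ContDiffOn.sum fun i _ => contDiffOn_pd (n := (m + 1 : ℕ)) hud ?_ (by simp) i
  exact contDiffOn_pd hud hg (by exact_mod_cast hmn) i

/-- The Laplacian commutes with partial derivatives. -/
theorem lap_pd (hΩ : IsOpen Ω) (hud : UniqueDiffOn ℝ (closure Ω)) {g : Rn N → ℝ}
    (hg : ContDiffOn ℝ 3 g (closure Ω)) (k : Fin N) :
    EqOn (lap Ω (pd Ω k g)) (pd Ω k (lap Ω g)) (closure Ω) := by
  intro x hx
  have hg2 : ContDiffOn ℝ 2 g (closure Ω) := hg.of_le (by norm_num)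
  have hp : ∀ i, ContDiffOn ℝ 2 (pd Ω i g) (closure Ω) := fun i =>
    contDiffOn_pd hud hg (by norm_num) i
  rw [lap_eq hud (hp k) hx, pd_congr (lap_eq hud hg2) k hx,
    pd_sum hud _ (fun i _ => contDiffOn_pd hud (hp i) (by norm_num) i) k hx]
  refine Finset.sum_congr rfl fun i _ => ?_
  rw [pd_congr (pd_comm hΩ hud hg2 i k) i hx, pd_comm hΩ hud (hp i) i k hx]

/-! ### Green's first identity and the first formula -/

theorem integral_pd (hΩ : IsOpen Ω) (hb : Bornology.IsBounded Ω)
    (hL : HasLipschitzBoundary Ω) {u : Rn N → ℝ} (hu : ContDiffOn ℝ 1 u (closure Ω))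
    (i : Fin N) :
    ∫ x in Ω, pd Ω i u x = ∫ x, u x * normal Ω x i ∂(surfaceMeasure Ω) := by
  have h := integral_fderiv_eq_surface hΩ hb hL hu (EuclideanSpace.single i 1)
  have h1 : ∀ x, ⟪normal Ω x, EuclideanSpace.single i (1 : ℝ)⟫ = normal Ω x i := fun x => by
    rw [EuclideanSpace.inner_single_right]; simp
  simp only [h1] at h
  rw [← h]
  refine setIntegral_congr_fun hΩ.measurableSet fun x hx => ?_
  simp only [pd, fderivWithin_closure_eq hΩ u hx]

theorem memLp_top_of_continuousOn_closure (hb : Bornology.IsBounded Ω) {g : Rn N → ℝ}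
    (hg : ContinuousOn g (closure Ω)) : MemLp g ⊤ (surfaceMeasure Ω) :=
  memLp_top_of_continuousOn_frontier hb (hg.mono frontier_subset_closure)

theorem memLp_top_mul {μ : Measure (Rn N)} {g h : Rn N → ℝ} (hg : MemLp g ⊤ μ)
    (hh : MemLp h ⊤ μ) : MemLp (fun x => g x * h x) ⊤ μ :=
  MemLp.mul (p := ⊤) (r := ⊤) hh hg

theorem memLp_top_dn (hΩ : IsOpen Ω) (hb : Bornology.IsBounded Ω) (hL : HasLipschitzBoundary Ω)
    {g : Rn N → ℝ} (hg : ContDiffOn ℝ 1 g (closure Ω)) :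
    MemLp (dn Ω g) ⊤ (surfaceMeasure Ω) :=
  memLp_finsetSum _ fun i _ => memLp_top_mul (memLp_top_normal hΩ hb hL i)
    (memLp_top_of_continuousOn_closure hb (continuousOn_pd (uniqueDiffOn_closure hΩ hL) hg i))

/-- Green's first identity. -/
theorem green_first (hΩ : IsOpen Ω) (hb : Bornology.IsBounded Ω)
    (hL : HasLipschitzBoundary Ω) {g ψ : Rn N → ℝ} (hg : ContDiffOn ℝ 2 g (closure Ω))
    (hψ : ContDiffOn ℝ 1 ψ (closure Ω)) :
    ∫ x in Ω, ∑ i, pd Ω i g x * pd Ω i ψ x =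
      ∫ x, dn Ω g x * ψ x ∂(surfaceMeasure Ω) - ∫ x in Ω, lap Ω g x * ψ x := by
  have hud := uniqueDiffOn_closure hΩ hL
  have := isFiniteMeasure_surfaceMeasure hΩ hb hL
  have hp : ∀ i, ContDiffOn ℝ 1 (pd Ω i g) (closure Ω) := fun i =>
    contDiffOn_pd hud hg (by norm_num) i
  have hpp : ∀ i, ContinuousOn (pd Ω i (pd Ω i g)) (closure Ω) := fun i =>
    continuousOn_pd hud (hp i) i
  have hI1 : IntegrableOn (fun x => ∑ i, pd Ω i g x * pd Ω i ψ x) Ω :=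
    integrableOn_of_continuousOn_closure hb
      (continuousOn_finsetSum _ fun i _ => (hp i).continuousOn.mul (continuousOn_pd hud hψ i))
  have hI2 : IntegrableOn (fun x => lap Ω g x * ψ x) Ω :=
    integrableOn_of_continuousOn_closure hb
      ((contDiffOn_lap (m := 0) (n := 2) hud hg le_rfl).continuousOn.mul hψ.continuousOn)
  have hsum : ∀ i, IntegrableOn (pd Ω i (fun z => pd Ω i g z * ψ z)) Ω := fun i =>
    integrableOn_of_continuousOn_closure hb (continuousOn_pd hud ((hp i).mul hψ) i)
  rw [eq_sub_iff_add_eq, ← integral_add hI1 hI2]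
  calc _ = ∫ x in Ω, ∑ i, pd Ω i (fun z => pd Ω i g z * ψ z) x := by
        refine setIntegral_congr_fun hΩ.measurableSet fun x hx => ?_
        rw [lap_eq hud hg (subset_closure hx), Finset.sum_mul, ← Finset.sum_add_distrib]
        exact Finset.sum_congr rfl fun i _ => (pd_mul hud (hp i) hψ i (subset_closure hx)).symm
    _ = ∑ i, ∫ x, pd Ω i g x * ψ x * normal Ω x i ∂(surfaceMeasure Ω) := by
        rw [integral_finsetSum _ fun i _ => hsum i]
        exact Finset.sum_congr rfl fun i _ => integral_pd hΩ hb hL ((hp i).mul hψ) i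
    _ = _ := by
        rw [← integral_finsetSum]
        · refine integral_congr_ae (Eventually.of_forall fun x => ?_)
          simp only [dn, Finset.sum_mul]
          exact Finset.sum_congr rfl fun i _ => by ring
        · intro i _
          exact (memLp_top_mul (memLp_top_of_continuousOn_closure hb
            ((hp i).continuousOn.mul hψ.continuousOn)) (memLp_top_normal hΩ hb hL i)).integrable
              le_top

theorem sum_normal_sq {x : Rn N} (h : IsOuterUnitNormal Ω x (normal Ω x)) :
    ∑ i, normal Ω x i * normal Ω x i = 1 := by
  have := real_inner_self_eq_norm_sq (normal Ω x)
  rw [h.1, PiLp.inner_apply] at this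
  simpa [← pow_two] using this

/-- Splitting of `v · ∇g` into tangential and normal parts. -/
theorem inner_tangVec_tangGrad {x : Rn N} (h : IsOuterUnitNormal Ω x (normal Ω x))
    (v : Rn N → Rn N) (g : Rn N → ℝ) :
    inner ℝ (tangVec Ω v x) (tangGrad Ω g x) =
      ∑ k, v x k * pd Ω k g x - (∑ k, normal Ω x k * v x k) * dn Ω g x := by
  have hn := sum_normal_sq h
  set n := normal Ω x
  set w := v x
  have h1 : tangVec Ω v x = w - (∑ k, n k * w k) • n := by
    ext i
    simp only [tangVec, tangProj, Matrix.sub_mulVec, Matrix.one_mulVec, Matrix.vecMulVec_mulVec,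
      PiLp.sub_apply, PiLp.smul_apply, Pi.sub_apply, Pi.smul_apply, smul_eq_mul]
    simp [dotProduct, mul_comm, n, w]
  have h2 : ⟪n, n⟫ = 1 := by rw [real_inner_self_eq_norm_sq, h.1]; norm_num
  have h3 : ⟪w, n⟫ = ∑ k, n k * w k := by simp [PiLp.inner_apply]
  have h4 : ⟪n, grad Ω g x⟫ = dn Ω g x := by
    simp [PiLp.inner_apply, grad, dn, n, mul_comm]
  have h5 : ⟪w, grad Ω g x⟫ = ∑ k, w k * pd Ω k g x := by
    simp [PiLp.inner_apply, grad, mul_comm]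
  rw [h1, tangGrad, inner_sub_left, inner_sub_right, inner_sub_right, real_inner_smul_left,
    real_inner_smul_left, inner_smul_right, inner_smul_right, h2, h3, h4, h5]
  ring

theorem sum_normal_mul_nHess (g : Rn N → ℝ) (x : Rn N) :
    ∑ k, normal Ω x k * nHess Ω g x k = dnn Ω g x := by
  simp only [nHess, dnn, Finset.mul_sum]
  rw [Finset.sum_comm]
  exact Finset.sum_congr rfl fun i _ => Finset.sum_congr rfl fun j _ => by ring

end PartialDerivatives

section FirstFormula

variable {N : ℕ} {Ω : Set (Rn N)}

/-- The triharmonic Green formula with the full gradient `∇φ` in the boundary term, together with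
the boundedness of all boundary integrands. -/
theorem triharmonic_green (hΩ : IsOpen Ω) (hb : Bornology.IsBounded Ω)
    (hL : HasLipschitzBoundary Ω) {f φ : Rn N → ℝ} (hf : ContDiffOn ℝ 6 f (closure Ω))
    (hφ : ContDiffOn ℝ 3 φ (closure Ω)) :
    IntegrableOn (thirdColon Ω f φ) Ω ∧
    IntegrableOn (fun x => lap Ω (lap Ω (lap Ω f)) x * φ x) Ω ∧
    MemLp (fun x => colon (nThird Ω f x) (hess Ω φ x)) ⊤ (surfaceMeasure Ω) ∧
    MemLp (fun x => ∑ k, nHess Ω (lap Ω f) x k * pd Ω k φ x) ⊤ (surfaceMeasure Ω) ∧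
    MemLp (dnn Ω (lap Ω f)) ⊤ (surfaceMeasure Ω) ∧
    MemLp (fun x => dn Ω (lap Ω (lap Ω f)) x * φ x) ⊤ (surfaceMeasure Ω) ∧
    ∫ x in Ω, thirdColon Ω f φ x =
      - (∫ x in Ω, lap Ω (lap Ω (lap Ω f)) x * φ x)
      + (∫ x, colon (nThird Ω f x) (hess Ω φ x) ∂(surfaceMeasure Ω))
      - (∫ x, ∑ k, nHess Ω (lap Ω f) x k * pd Ω k φ x ∂(surfaceMeasure Ω))
      + (∫ x, dn Ω (lap Ω (lap Ω f)) x * φ x ∂(surfaceMeasure Ω)) := by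
  have hud := uniqueDiffOn_closure hΩ hL
  have := isFiniteMeasure_surfaceMeasure hΩ hb hL
  have hf5 : ∀ k, ContDiffOn ℝ (5 : ℕ) (pd Ω k f) (closure Ω) := fun k =>
    contDiffOn_pd hud hf (by norm_num) k
  have hf4 : ∀ j k, ContDiffOn ℝ (4 : ℕ) (pd Ω j (pd Ω k f)) (closure Ω) := fun j k =>
    contDiffOn_pd hud (hf5 k) (by norm_num) j
  have hf3 : ∀ i j k, ContDiffOn ℝ (3 : ℕ) (pd Ω i (pd Ω j (pd Ω k f))) (closure Ω) :=
    fun i j k => contDiffOn_pd hud (hf4 j k) (by norm_num) i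
  have hφ2 : ∀ k, ContDiffOn ℝ (2 : ℕ) (pd Ω k φ) (closure Ω) := fun k =>
    contDiffOn_pd hud hφ (by norm_num) k
  have hφ1 : ∀ j k, ContDiffOn ℝ (1 : ℕ) (pd Ω j (pd Ω k φ)) (closure Ω) := fun j k =>
    contDiffOn_pd hud (hφ2 k) (by norm_num) j
  have hφ0 : ∀ i j k, ContinuousOn (pd Ω i (pd Ω j (pd Ω k φ))) (closure Ω) := fun i j k =>
    continuousOn_pd hud (hφ1 j k) i
  have hl4 : ContDiffOn ℝ (4 : ℕ) (lap Ω f) (closure Ω) :=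
    contDiffOn_lap (n := 6) hud hf (by norm_num)
  have hl3 : ∀ k, ContDiffOn ℝ (3 : ℕ) (pd Ω k (lap Ω f)) (closure Ω) := fun k =>
    contDiffOn_pd hud hl4 (by norm_num) k
  have hl2 : ∀ j k, ContDiffOn ℝ (2 : ℕ) (pd Ω j (pd Ω k (lap Ω f))) (closure Ω) := fun j k =>
    contDiffOn_pd hud (hl3 k) (by norm_num) j
  have hll2 : ContDiffOn ℝ (2 : ℕ) (lap Ω (lap Ω f)) (closure Ω) :=
    contDiffOn_lap hud hl4 (by norm_num)
  have hll1 : ∀ k, ContDiffOn ℝ (1 : ℕ) (pd Ω k (lap Ω (lap Ω f))) (closure Ω) := fun k =>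
    contDiffOn_pd hud hll2 (by norm_num) k
  have hlll0 : ContinuousOn (lap Ω (lap Ω (lap Ω f))) (closure Ω) :=
    (contDiffOn_lap (m := 0) hud hll2 le_rfl).continuousOn
  -- integrability in `Ω` and boundedness on the boundary
  have hI1 : ∀ j k, IntegrableOn
      (fun x => ∑ i, pd Ω i (pd Ω j (pd Ω k f)) x * pd Ω i (pd Ω j (pd Ω k φ)) x) Ω := fun j k =>
    integrableOn_of_continuousOn_closure hb
      (continuousOn_finsetSum _ fun i _ => (hf3 i j k).continuousOn.mul (hφ0 i j k))
  have hI2 : ∀ k, IntegrableOn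
      (fun x => ∑ j, pd Ω j (pd Ω k (lap Ω f)) x * pd Ω j (pd Ω k φ) x) Ω := fun k =>
    integrableOn_of_continuousOn_closure hb
      (continuousOn_finsetSum _ fun j _ => (hl2 j k).continuousOn.mul (hφ1 j k).continuousOn)
  have hI3 : IntegrableOn (fun x => lap Ω (lap Ω (lap Ω f)) x * φ x) Ω :=
    integrableOn_of_continuousOn_closure hb (hlll0.mul hφ.continuousOn)
  have hB1 : ∀ j k, MemLp (fun x => dn Ω (pd Ω j (pd Ω k f)) x * pd Ω j (pd Ω k φ) x) ⊤
      (surfaceMeasure Ω) := fun j k =>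
    memLp_top_mul (memLp_top_dn hΩ hb hL ((hf4 j k).of_le (by norm_num)))
      (memLp_top_of_continuousOn_closure hb (hφ1 j k).continuousOn)
  have hB2 : ∀ k, MemLp (fun x => dn Ω (pd Ω k (lap Ω f)) x * pd Ω k φ x) ⊤
      (surfaceMeasure Ω) := fun k =>
    memLp_top_mul (memLp_top_dn hΩ hb hL ((hl3 k).of_le (by norm_num)))
      (memLp_top_of_continuousOn_closure hb (hφ2 k).continuousOn)
  have hB3 : MemLp (fun x => dn Ω (lap Ω (lap Ω f)) x * φ x) ⊤ (surfaceMeasure Ω) :=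
    memLp_top_mul (memLp_top_dn hΩ hb hL (hll2.of_le (by norm_num)))
      (memLp_top_of_continuousOn_closure hb hφ.continuousOn)
  have hthird : thirdColon Ω f φ = fun x => ∑ j, ∑ k, ∑ i,
      pd Ω i (pd Ω j (pd Ω k f)) x * pd Ω i (pd Ω j (pd Ω k φ)) x := by
    ext x
    simp only [thirdColon, third]
    rw [Finset.sum_comm]
    exact Finset.sum_congr rfl fun j _ => Finset.sum_comm
  have hcolon : (fun x => colon (nThird Ω f x) (hess Ω φ x)) =
      fun x => ∑ j, ∑ k, dn Ω (pd Ω j (pd Ω k f)) x * pd Ω j (pd Ω k φ) x := rfl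
  have hnH : (fun x => ∑ k, nHess Ω (lap Ω f) x k * pd Ω k φ x) =
      fun x => ∑ k, dn Ω (pd Ω k (lap Ω f)) x * pd Ω k φ x := rfl
  refine ⟨?_, hI3, ?_, ?_, ?_, hB3, ?_⟩
  · rw [hthird]
    exact integrable_finsetSum _ fun j _ => integrable_finsetSum _ fun k _ => hI1 j k
  · rw [hcolon]
    exact memLp_finsetSum _ fun j _ => memLp_finsetSum _ fun k _ => hB1 j k
  · rw [hnH]
    exact memLp_finsetSum _ fun k _ => hB2 k
  · exact memLp_finsetSum _ fun i _ => memLp_finsetSum _ fun j _ =>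
      memLp_top_mul (memLp_top_mul (memLp_top_normal hΩ hb hL i) (memLp_top_normal hΩ hb hL j))
        (memLp_top_of_continuousOn_closure hb (hl2 i j).continuousOn)
  -- Green's first identity is applied to the second, first and zeroth derivatives of `φ` in turn
  have e3 := green_first hΩ hb hL hll2 (hφ.of_le (by norm_num) : ContDiffOn ℝ 1 φ (closure Ω))
  have e2 : ∀ k, ∫ x in Ω, ∑ j, pd Ω j (pd Ω k (lap Ω f)) x * pd Ω j (pd Ω k φ) x =
      ∫ x, dn Ω (pd Ω k (lap Ω f)) x * pd Ω k φ x ∂(surfaceMeasure Ω) -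
        ∫ x in Ω, pd Ω k (lap Ω (lap Ω f)) x * pd Ω k φ x := by
    intro k
    rw [green_first hΩ hb hL ((hl3 k).of_le (by norm_num)) ((hφ2 k).of_le (by norm_num))]
    congr 1
    refine setIntegral_congr_fun hΩ.measurableSet fun x hx => ?_
    simp only [lap_pd hΩ hud (hl4.of_le (by norm_num)) k (subset_closure hx)]
  have e1 : ∀ j k, ∫ x in Ω, ∑ i, pd Ω i (pd Ω j (pd Ω k f)) x * pd Ω i (pd Ω j (pd Ω k φ)) x =
      ∫ x, dn Ω (pd Ω j (pd Ω k f)) x * pd Ω j (pd Ω k φ) x ∂(surfaceMeasure Ω) -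
        ∫ x in Ω, pd Ω j (pd Ω k (lap Ω f)) x * pd Ω j (pd Ω k φ) x := by
    intro j k
    rw [green_first hΩ hb hL ((hf4 j k).of_le (by norm_num)) (hφ1 j k)]
    congr 1
    refine setIntegral_congr_fun hΩ.measurableSet fun x hx => ?_
    simp only [lap_pd hΩ hud ((hf5 k).of_le (by norm_num)) j (subset_closure hx),
      pd_congr (lap_pd hΩ hud (hf.of_le (by norm_num)) k) j (subset_closure hx)]
  have hI2' : ∀ j k, IntegrableOn
      (fun x => pd Ω j (pd Ω k (lap Ω f)) x * pd Ω j (pd Ω k φ) x) Ω := fun j k =>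
    integrableOn_of_continuousOn_closure hb ((hl2 j k).continuousOn.mul (hφ1 j k).continuousOn)
  have hI3' : ∀ k, IntegrableOn
      (fun x => pd Ω k (lap Ω (lap Ω f)) x * pd Ω k φ x) Ω := fun k =>
    integrableOn_of_continuousOn_closure hb ((hll1 k).continuousOn.mul (hφ2 k).continuousOn)
  have s1 : ∫ x in Ω, thirdColon Ω f φ x =
      ∫ x, colon (nThird Ω f x) (hess Ω φ x) ∂(surfaceMeasure Ω) -
        ∑ k, ∫ x in Ω, ∑ j, pd Ω j (pd Ω k (lap Ω f)) x * pd Ω j (pd Ω k φ) x := by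
    rw [hthird, hcolon, integral_finsetSum _ fun j _ => integrable_finsetSum _ fun k _ => hI1 j k,
      integral_finsetSum _ fun j _ => integrable_finsetSum _ fun k _ => (hB1 j k).integrable le_top]
    simp only [integral_finsetSum _ fun k (_ : k ∈ Finset.univ) => hI1 _ k, e1,
      integral_finsetSum _ fun k (_ : k ∈ Finset.univ) => (hB1 _ k).integrable le_top,
      integral_finsetSum _ fun j (_ : j ∈ Finset.univ) => hI2' j _, Finset.sum_sub_distrib]
    congr 1
    exact Finset.sum_comm
  have s2 : ∑ k, ∫ x in Ω, ∑ j, pd Ω j (pd Ω k (lap Ω f)) x * pd Ω j (pd Ω k φ) x =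
      ∫ x, ∑ k, nHess Ω (lap Ω f) x k * pd Ω k φ x ∂(surfaceMeasure Ω) -
        ∫ x in Ω, ∑ k, pd Ω k (lap Ω (lap Ω f)) x * pd Ω k φ x := by
    rw [hnH, integral_finsetSum _ fun k _ => (hB2 k).integrable le_top,
      integral_finsetSum _ fun k _ => hI3' k, ← Finset.sum_sub_distrib]
    exact Finset.sum_congr rfl fun k _ => e2 k
  rw [s1, s2, e3]
  ring

end FirstFormula

/-! ### Smooth graphs -/

section SmoothGraphs

variable {E : Type*} [NormedAddCommGroup E] [InnerProductSpace ℝ E] [FiniteDimensional ℝ E]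

theorem toDual_symm_eq_sum (ℓ : E →L[ℝ] ℝ) :
    (InnerProductSpace.toDual ℝ E).symm ℓ =
      ∑ k, ℓ (stdOrthonormalBasis ℝ E k) • stdOrthonormalBasis ℝ E k := by
  conv_lhs => rw [← (stdOrthonormalBasis ℝ E).sum_repr' ((InnerProductSpace.toDual ℝ E).symm ℓ)]
  refine Finset.sum_congr rfl fun k _ => ?_
  rw [real_inner_comm, InnerProductSpace.toDual_symm_apply]

theorem graphDensity_sq_eq_sum (ℓ : E →L[ℝ] ℝ) :
    graphDensity ℓ ^ 2 = 1 + ∑ k, ℓ (stdOrthonormalBasis ℝ E k) ^ 2 := by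
  rw [graphDensity_sq, ← (InnerProductSpace.toDual ℝ E).symm.norm_map ℓ,
    ← (stdOrthonormalBasis ℝ E).sum_sq_norm_inner_right]
  congr 1
  refine Finset.sum_congr rfl fun k _ => ?_
  rw [real_inner_comm, InnerProductSpace.toDual_symm_apply, Real.norm_eq_abs, sq_abs]

theorem contDiff_graphDensity_fderiv {γ : E → ℝ} {m n : WithTop ℕ∞} (hγ : ContDiff ℝ n γ)
    (hmn : m + 1 ≤ n) : ContDiff ℝ m fun y => graphDensity (fderiv ℝ γ y) := by
  have h1 : ∀ y, graphDensity (fderiv ℝ γ y) =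
      √(1 + ∑ k, fderiv ℝ γ y (stdOrthonormalBasis ℝ E k) ^ 2) := fun y => by
    rw [← graphDensity_sq_eq_sum, Real.sqrt_sq (graphDensity_pos _).le]
  simp only [h1]
  refine ContDiff.sqrt ?_ fun y => ne_of_gt (by positivity)
  exact contDiff_const.add (ContDiff.sum fun k _ =>
    ((hγ.fderiv_right hmn).clm_apply contDiff_const).pow 2)

theorem contDiff_toDual_symm_fderiv {γ : E → ℝ} {m n : WithTop ℕ∞} (hγ : ContDiff ℝ n γ)
    (hmn : m + 1 ≤ n) :
    ContDiff ℝ m fun y => (InnerProductSpace.toDual ℝ E).symm (fderiv ℝ γ y) := by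
  simp only [toDual_symm_eq_sum]
  exact ContDiff.sum fun k _ => ((hγ.fderiv_right hmn).clm_apply contDiff_const).smul contDiff_const

/-- Differentiating `J² = 1 + |∇γ|²` gives `J ∂ₕJ = D²γ(h, ∇γ)`. -/
theorem graphDensity_mul_fderiv {γ : E → ℝ} (hγ : ContDiff ℝ 2 γ) (y h : E) :
    graphDensity (fderiv ℝ γ y) * fderiv ℝ (fun y => graphDensity (fderiv ℝ γ y)) y h =
      fderiv ℝ (fderiv ℝ γ) y h ((InnerProductSpace.toDual ℝ E).symm (fderiv ℝ γ y)) := by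
  have hJ : HasFDerivAt (fun y => graphDensity (fderiv ℝ γ y))
      (fderiv ℝ (fun y => graphDensity (fderiv ℝ γ y)) y) y :=
    ((contDiff_graphDensity_fderiv (m := 1) hγ (by norm_num)).differentiable one_ne_zero
      y).hasFDerivAt
  have hD : HasFDerivAt (fderiv ℝ γ) (fderiv ℝ (fderiv ℝ γ) y) y :=
    ((hγ.fderiv_right (m := 1) (by norm_num)).differentiable one_ne_zero y).hasFDerivAt
  have h1 := (hJ.pow 2)
  have h2 : HasFDerivAt (fun y => 1 + ∑ k, fderiv ℝ γ y (stdOrthonormalBasis ℝ E k) ^ 2) _ y :=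
    (HasFDerivAt.fun_sum fun k (_ : k ∈ Finset.univ) =>
      ((hD.clm_apply (hasFDerivAt_const (stdOrthonormalBasis ℝ E k) y)).pow 2)).const_add 1
  have h3 : (fun y => graphDensity (fderiv ℝ γ y) ^ 2) =
      fun y => 1 + ∑ k, fderiv ℝ γ y (stdOrthonormalBasis ℝ E k) ^ 2 := by
    ext y; exact graphDensity_sq_eq_sum _
  rw [← h3] at h2
  have h4 := congrArg (fun L : E →L[ℝ] ℝ => L h) (h1.unique h2)
  simp only [_root_.smul_apply, _root_.sum_apply, smul_eq_mul] at h4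
  rw [toDual_symm_eq_sum, map_sum]
  simp only [map_smul, smul_eq_mul]
  simp at h4
  have h6 : 2 * (graphDensity (fderiv ℝ γ y) *
      fderiv ℝ (fun y => graphDensity (fderiv ℝ γ y)) y h) =
      2 * ∑ k, fderiv ℝ γ y (stdOrthonormalBasis ℝ E k) *
        fderiv ℝ (fderiv ℝ γ) y h (stdOrthonormalBasis ℝ E k) := by
    rw [← mul_assoc, h4, Finset.mul_sum]
    exact Finset.sum_congr rfl fun k _ => by ring
  linarith

/-- A compactly supported `C¹` vector field has a divergence with integral zero. -/
theorem integral_trace_fderiv_eq_zero [MeasurableSpace E] [BorelSpace E] {X : E → E}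
    (hX : ContDiff ℝ 1 X) (hc : HasCompactSupport X) :
    ∫ y, LinearMap.trace ℝ E (fderiv ℝ X y) = 0 := by
  set b := stdOrthonormalBasis ℝ E
  have hcomp : ∀ k, ContDiff ℝ 1 fun y => ⟪b k, X y⟫ := fun k => contDiff_const.inner ℝ hX
  have hcs : ∀ k, HasCompactSupport fun y => ⟪b k, X y⟫ := fun k =>
    hc.comp_left (g := fun v => ⟪b k, v⟫) (inner_zero_right _)
  have hd : ∀ k y h, fderiv ℝ (fun y => ⟪b k, X y⟫) y h = ⟪b k, fderiv ℝ X y h⟫ := by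
    intro k y h
    have hXd := hX.differentiable one_ne_zero y
    rw [fderiv_inner_apply ℝ (differentiableAt_const _) hXd]
    simp
  have h1 : ∀ y, LinearMap.trace ℝ E (fderiv ℝ X y) =
      ∑ k, fderiv ℝ (fun y => ⟪b k, X y⟫) y (b k) := by
    intro y
    rw [LinearMap.trace_eq_sum_inner _ b]
    exact Finset.sum_congr rfl fun k _ => (hd k y (b k)).symm
  simp only [h1]
  rw [integral_finsetSum]
  · refine Finset.sum_eq_zero fun k _ => ?_
    obtain ⟨C, hC⟩ := ContDiff.lipschitzWith_of_hasCompactSupport (hcs k) (hcomp k) one_ne_zero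
    rw [← integral_lineDeriv_eq_zero volume hC (hcs k) (b k)]
    exact integral_congr_ae (Eventually.of_forall fun y =>
      ((hcomp k).differentiable one_ne_zero y).lineDeriv_eq_fderiv.symm)
  · intro k _
    refine Continuous.integrable_of_hasCompactSupport ?_ ?_
    · exact ((hcomp k).continuous_fderiv one_ne_zero).clm_apply continuous_const
    · exact (hcs k).fderiv_apply ℝ (b k)

end SmoothGraphs

/-! ### Tangential derivatives -/

section TangentialDerivatives

variable {N : ℕ} {Ω : Set (Rn N)}

/-- The tangential part of the `j`-th basis vector. -/
def tcol (Ω : Set (Rn N)) (j : Fin N) (x : Rn N) : Rn N :=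
  WithLp.toLp 2 fun k => tangProj Ω x k j

/-- The tangential derivative of a function on `∂Ω` in the direction of the tangential part of the
`j`-th basis vector. -/
def tpd (Ω : Set (Rn N)) (j : Fin N) (g : Rn N → ℝ) (x : Rn N) : ℝ :=
  fderivWithin ℝ g (frontier Ω) x (tcol Ω j x)

theorem tangProj_apply (x : Rn N) (k j : Fin N) :
    tangProj Ω x k j = (if k = j then 1 else 0) - normal Ω x k * normal Ω x j := by
  simp [tangProj, Matrix.one_apply, Matrix.vecMulVec_apply]

theorem tcol_eq (x : Rn N) (j : Fin N) :
    tcol Ω j x = EuclideanSpace.single j 1 - normal Ω x j • normal Ω x := by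
  ext k
  simp [tcol, tangProj_apply, mul_comm]

theorem inner_normal_tcol {x : Rn N} (h : IsOuterUnitNormal Ω x (normal Ω x)) (j : Fin N) :
    ⟪normal Ω x, tcol Ω j x⟫ = 0 := by
  rw [tcol_eq, inner_sub_right, inner_smul_right, real_inner_self_eq_norm_sq, h.1,
    EuclideanSpace.inner_single_right]
  simp

theorem tcol_mem_tangentConeAt {x : Rn N} (h : IsOuterUnitNormal Ω x (normal Ω x)) (j : Fin N) :
    tcol Ω j x ∈ tangentConeAt ℝ (frontier Ω) x :=
  h.mem_tangentConeAt (inner_normal_tcol h j)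

/-- A tangential derivative can be computed from any derivative along `∂Ω`, although such a
derivative is unique only in tangent directions. -/
theorem tpd_eq {x : Rn N} (h : IsOuterUnitNormal Ω x (normal Ω x)) {g : Rn N → ℝ}
    {L : Rn N →L[ℝ] ℝ} (hL : HasFDerivWithinAt g L (frontier Ω) x) (j : Fin N) :
    tpd Ω j g x = L (tcol Ω j x) :=
  hL.differentiableWithinAt.hasFDerivWithinAt.unique_on hL (tcol_mem_tangentConeAt h j)

theorem tpd_congr {g h : Rn N → ℝ} (hgh : EqOn g h (frontier Ω)) (j : Fin N) :
    EqOn (tpd Ω j g) (tpd Ω j h) (frontier Ω) := fun x hx => by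
  rw [tpd, tpd, fderivWithin_congr hgh (hgh hx)]

theorem tpd_mul {x : Rn N} (h : IsOuterUnitNormal Ω x (normal Ω x)) {g k : Rn N → ℝ}
    (hg : DifferentiableWithinAt ℝ g (frontier Ω) x)
    (hk : DifferentiableWithinAt ℝ k (frontier Ω) x) (j : Fin N) :
    tpd Ω j (fun z => g z * k z) x = g x * tpd Ω j k x + tpd Ω j g x * k x := by
  rw [tpd_eq h (hg.hasFDerivWithinAt.fun_mul hk.hasFDerivWithinAt), tpd, tpd]
  simp [mul_comm]

theorem tpd_add {x : Rn N} (h : IsOuterUnitNormal Ω x (normal Ω x)) {g k : Rn N → ℝ}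
    (hg : DifferentiableWithinAt ℝ g (frontier Ω) x)
    (hk : DifferentiableWithinAt ℝ k (frontier Ω) x) (j : Fin N) :
    tpd Ω j (fun z => g z + k z) x = tpd Ω j g x + tpd Ω j k x := by
  rw [tpd_eq h (hg.hasFDerivWithinAt.fun_add hk.hasFDerivWithinAt), tpd, tpd]
  simp

theorem tpd_sub {x : Rn N} (h : IsOuterUnitNormal Ω x (normal Ω x)) {g k : Rn N → ℝ}
    (hg : DifferentiableWithinAt ℝ g (frontier Ω) x)
    (hk : DifferentiableWithinAt ℝ k (frontier Ω) x) (j : Fin N) :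
    tpd Ω j (fun z => g z - k z) x = tpd Ω j g x - tpd Ω j k x := by
  rw [tpd_eq h (hg.hasFDerivWithinAt.fun_sub hk.hasFDerivWithinAt), tpd, tpd]
  simp

theorem tpd_sum {x : Rn N} (h : IsOuterUnitNormal Ω x (normal Ω x)) {ι : Type*} (s : Finset ι)
    {g : ι → Rn N → ℝ} (hg : ∀ i ∈ s, DifferentiableWithinAt ℝ (g i) (frontier Ω) x)
    (j : Fin N) : tpd Ω j (fun z => ∑ i ∈ s, g i z) x = ∑ i ∈ s, tpd Ω j (g i) x := by
  rw [tpd_eq h (HasFDerivWithinAt.fun_sum fun i hi => (hg i hi).hasFDerivWithinAt)]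
  simp [tpd]

theorem tpd_const {x : Rn N} (h : IsOuterUnitNormal Ω x (normal Ω x)) (c : ℝ) (j : Fin N) :
    tpd Ω j (fun _ => c) x = 0 := by
  rw [tpd_eq h (hasFDerivWithinAt_const c x _)]; simp

/-- For a function that is differentiable up to the boundary, the tangential derivatives are the
components of the tangential projection of its gradient. -/
theorem tpd_eq_sum_pd {x : Rn N} (h : IsOuterUnitNormal Ω x (normal Ω x)) {g : Rn N → ℝ}
    (hg : DifferentiableWithinAt ℝ g (closure Ω) x) (j : Fin N) :
    tpd Ω j g x = pd Ω j g x - normal Ω x j * dn Ω g x := by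
  have hL := hg.hasFDerivWithinAt.mono frontier_subset_closure
  have hn : normal Ω x = ∑ i, normal Ω x i • EuclideanSpace.single i (1 : ℝ) := by
    have := (EuclideanSpace.basisFun (Fin N) ℝ).sum_repr (normal Ω x)
    simpa using this.symm
  rw [tpd_eq h hL, tcol_eq, map_sub, map_smul]
  have h2 : fderivWithin ℝ g (closure Ω) x (normal Ω x) = dn Ω g x := by
    conv_lhs => rw [hn]
    rw [map_sum]
    simp [dn, pd]
  rw [h2]
  rfl

/-- The entries of the tangential Jacobian matrix are tangential derivatives of the components. -/
theorem tangJacobian_apply {x : Rn N} (h : IsOuterUnitNormal Ω x (normal Ω x)) {v : Rn N → Rn N}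
    (hv : DifferentiableWithinAt ℝ v (frontier Ω) x) (i j : Fin N) :
    tangJacobian Ω v x i j = tpd Ω j (fun z => v z i) x := by
  have h1 : HasFDerivWithinAt (fun z => v z i)
      ((EuclideanSpace.proj (𝕜 := ℝ) i).comp (fderivWithin ℝ v (frontier Ω) x)) (frontier Ω) x :=
    (EuclideanSpace.proj (𝕜 := ℝ) i).hasFDerivAt.comp_hasFDerivWithinAt x hv.hasFDerivWithinAt
  rw [tpd_eq h h1]
  rfl

theorem tangDiv_eq {x : Rn N} (h : IsOuterUnitNormal Ω x (normal Ω x)) {v : Rn N → Rn N}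
    (hv : DifferentiableWithinAt ℝ v (frontier Ω) x) :
    tangDiv Ω v x = ∑ i, tpd Ω i (fun z => v z i) x := by
  rw [tangDiv, Matrix.trace]
  exact Finset.sum_congr rfl fun i _ => tangJacobian_apply h hv i i

/-- Tangential derivatives lose one order of smoothness along the boundary. -/
theorem contDiffOn_tpd {n : ℕ} (hn : ContDiffOn ℝ n (normal Ω) (frontier Ω))
    (hN : ∀ x ∈ frontier Ω, IsOuterUnitNormal Ω x (normal Ω x)) {g : Rn N → ℝ}
    (hg : ContDiffOn ℝ (n + 1 : ℕ) g (frontier Ω)) (j : Fin N) :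
    ContDiffOn ℝ n (tpd Ω j g) (frontier Ω) := by
  intro x hx
  have hg' : ContDiffWithinAt ℝ ((n : WithTop ℕ∞) + 1) g (frontier Ω) x := by
    exact_mod_cast hg x hx
  rw [contDiffWithinAt_succ_iff_hasFDerivWithinAt' (by simp)] at hg'
  obtain ⟨u, hu, -, -, g', hg', hc⟩ := hg'
  rw [insert_eq_of_mem hx] at hu
  have hcol : ContDiffWithinAt ℝ n (tcol Ω j) (frontier Ω) x := by
    have : tcol Ω j = fun x => EuclideanSpace.single j 1 - normal Ω x j • normal Ω x := by
      ext x : 1; exact tcol_eq x j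
    rw [this]
    exact contDiffWithinAt_const.sub ((contDiffOn_euclidean.1 hn j x hx).smul (hn x hx))
  refine (hc.clm_apply hcol).congr_of_eventuallyEq_of_mem ?_ hx
  filter_upwards [hu, self_mem_nhdsWithin] with z hz hzf
  exact tpd_eq (hN z hzf) (hg' z hz) j

/-! ### The normal of a `C³` domain -/

/-- Every boundary point of a `C³` domain lies in a bounded `C³` boundary chart. -/
theorem HasContDiffBoundary.exists_chart (hC : HasContDiffBoundary 3 Ω) {x₀ : Rn N}
    (hx₀ : x₀ ∈ frontier Ω) : ∃ (e : Rn N) (γ : Hyp e → ℝ) (V : Set (Rn N)),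
      ContDiff ℝ 3 γ ∧ IsGraphOn Ω e γ V ∧ x₀ ∈ V ∧ Bornology.IsBounded V := by
  obtain ⟨e, γ, hγC, hγ⟩ := hC x₀ hx₀
  obtain ⟨V, hxV, hV⟩ := hγ.exists_isGraphOn hγC.continuous
  exact ⟨e, γ, V ∩ Metric.ball x₀ 1, hγC,
    hV.mono (hV.isOpen.inter Metric.isOpen_ball) inter_subset_left,
    ⟨hxV, Metric.mem_ball_self one_pos⟩, Metric.isBounded_ball.subset inter_subset_right⟩

theorem contDiff_graphNormal {e : Rn N} {γ : Hyp e → ℝ} (hγ : ContDiff ℝ 3 γ) :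
    ContDiff ℝ 2 (graphNormal e γ) := by
  unfold graphNormal
  refine ((contDiff_graphDensity_fderiv hγ (by norm_num)).inv
    fun y => (graphDensity_pos _).ne').smul (ContDiff.sub ?_ contDiff_const)
  exact (Hyp e).subtypeL.contDiff.comp (contDiff_toDual_symm_fderiv hγ (by norm_num))

theorem IsGraphOn.isOuterUnitNormal_graphNormal_hproj {e : Rn N} {γ : Hyp e → ℝ} {V : Set (Rn N)}
    (hV : IsGraphOn Ω e γ V) (hΩ : IsOpen Ω) (hγ : Differentiable ℝ γ) {x : Rn N} (hx : x ∈ V)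
    (hxf : x ∈ frontier Ω) : IsOuterUnitNormal Ω x (graphNormal e γ (hproj e x)) := by
  have h1 := graphMap_hproj hV.norm_eq ((hV.mem_frontier_iff hΩ hx).1 hxf)
  have := hV.isOuterUnitNormal (y := hproj e x) (by rwa [h1]) (hγ _)
  rwa [h1] at this

theorem isOuterUnitNormal_of_contDiff (hΩ : IsOpen Ω) (hC : HasContDiffBoundary 3 Ω) {x : Rn N}
    (hx : x ∈ frontier Ω) : IsOuterUnitNormal Ω x (normal Ω x) := by
  obtain ⟨e, γ, V, hγ, hV, hxV, -⟩ := hC.exists_chart hx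
  have := hV.isOuterUnitNormal_graphNormal_hproj hΩ (hγ.differentiable (by norm_num)) hxV hx
  rwa [this.normal_eq]

theorem contDiffOn_normal (hΩ : IsOpen Ω) (hC : HasContDiffBoundary 3 Ω) :
    ContDiffOn ℝ 2 (normal Ω) (frontier Ω) := by
  intro x hx
  obtain ⟨e, γ, V, hγ, hV, hxV, -⟩ := hC.exists_chart hx
  have h1 : ContDiff ℝ 2 fun z => graphNormal e γ (hproj e z) :=
    (contDiff_graphNormal hγ).comp (hproj e).contDiff
  refine h1.contDiffWithinAt.congr_of_eventuallyEq_of_mem ?_ hx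
  filter_upwards [mem_nhdsWithin_of_mem_nhds (hV.isOpen.mem_nhds hxV), self_mem_nhdsWithin]
    with z hz hzf
  exact (hV.isOuterUnitNormal_graphNormal_hproj hΩ (hγ.differentiable (by norm_num)) hz hzf).normal_eq

end TangentialDerivatives

/-! ### The tangential divergence theorem -/

section TangentialDivergence

open scoped ContDiff

variable {N : ℕ} {Ω : Set (Rn N)}

theorem hproj_graphNormal {e : Rn N} (γ : Hyp e → ℝ) (y : Hyp e) :
    hproj e (graphNormal e γ y) = (graphDensity (fderiv ℝ γ y))⁻¹ •
      (InnerProductSpace.toDual ℝ (Hyp e)).symm (fderiv ℝ γ y) := by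
  have h := hproj_add_smul e ((InnerProductSpace.toDual ℝ (Hyp e)).symm (fderiv ℝ γ y)) (-1)
  rw [neg_one_smul, ← sub_eq_add_neg] at h
  rw [graphNormal, map_smul, h]

/-- In graph coordinates, with `W` a tangential field along the graph, `ω` its horizontal part and
`J` the area density, the tangential divergence of `W` times `J` is the divergence of `J ω`. -/
theorem trace_fderiv_graphDensity_smul {e : Rn N} {γ : Hyp e → ℝ} (hγ : ContDiff ℝ 2 γ)
    {W : Hyp e → Rn N} (hW : ContDiff ℝ 1 W)
    (htan : ∀ y, ⟪e, W y⟫ = fderiv ℝ γ y (hproj e (W y))) (y : Hyp e) :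
    LinearMap.trace ℝ (Hyp e)
        (fderiv ℝ (fun y => graphDensity (fderiv ℝ γ y) • hproj e (W y)) y) =
      graphDensity (fderiv ℝ γ y) *
        (LinearMap.trace ℝ (Rn N) (((fderiv ℝ W y).comp (hproj e) : Rn N →L[ℝ] Rn N)) -
          ⟪graphNormal e γ y, fderiv ℝ W y (hproj e (graphNormal e γ y))⟫) := by
  set D := fderiv ℝ W y with hD
  set a := (InnerProductSpace.toDual ℝ (Hyp e)).symm (fderiv ℝ γ y) with ha
  set J := graphDensity (fderiv ℝ γ y) with hJ
  set D2 := fderiv ℝ (fderiv ℝ γ) y with hD2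
  have hJ0 : J ≠ 0 := (graphDensity_pos _).ne'
  have hWd : HasFDerivAt W D y := (hW.differentiable one_ne_zero y).hasFDerivAt
  have hωd : HasFDerivAt (fun y => hproj e (W y)) ((hproj e).comp D) y :=
    (hproj e).hasFDerivAt.comp y hWd
  have hγd : HasFDerivAt (fderiv ℝ γ) D2 y :=
    ((hγ.fderiv_right (m := 1) (by norm_num)).differentiable one_ne_zero y).hasFDerivAt
  have hJd : HasFDerivAt (fun y => graphDensity (fderiv ℝ γ y))
      (fderiv ℝ (fun y => graphDensity (fderiv ℝ γ y)) y) y :=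
    ((contDiff_graphDensity_fderiv (m := 1) hγ (by norm_num)).differentiable one_ne_zero
      y).hasFDerivAt
  -- the derivative of the tangency condition
  have hstar : ∀ h, ⟪e, D h⟫ = D2 h (hproj e (W y)) + fderiv ℝ γ y (hproj e (D h)) := by
    intro h
    have h1 : HasFDerivAt (fun y => ⟪e, W y⟫) ((innerSL ℝ e).comp D) y :=
      (innerSL ℝ e).hasFDerivAt.comp y hWd
    have h2 := hγd.clm_apply hωd
    have h3 := h1.unique ((funext htan : (fun y => ⟪e, W y⟫) = _) ▸ h2)
    have h4 := congrArg (fun L : Hyp e →L[ℝ] ℝ => L h) h3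
    simp at h4
    rw [h4]; ring
  have hsymm : D2 a (hproj e (W y)) = D2 (hproj e (W y)) a :=
    hγ.contDiffAt.isSymmSndFDerivAt (by simp) _ _
  -- the normal correction is `- ∂_ω J / J`, with `ω` the horizontal part of `W y`
  have hnn : ⟪graphNormal e γ y, D (hproj e (graphNormal e γ y))⟫ =
      - (J⁻¹ * (J⁻¹ * D2 a (hproj e (W y)))) := by
    rw [inner_graphNormal, hstar, hproj_graphNormal, ← ha, ← hJ, map_smul, map_smul]
    simp
  have htr1 : LinearMap.trace ℝ (Rn N) ((D.comp (hproj e) : Rn N →L[ℝ] Rn N)) =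
      LinearMap.trace ℝ (Hyp e) (((hproj e).comp D : Hyp e →L[ℝ] Hyp e)) :=
    LinearMap.trace_comp_comm' ((hproj e : Rn N →L[ℝ] Hyp e) : Rn N →ₗ[ℝ] Hyp e)
      (D : Hyp e →ₗ[ℝ] Rn N)
  have hXd := hJd.smul hωd
  have hX : fderiv ℝ (fun y => graphDensity (fderiv ℝ γ y) • hproj e (W y)) y = _ := hXd.fderiv
  have hgrad := graphDensity_mul_fderiv hγ y (hproj e (W y))
  set b := stdOrthonormalBasis ℝ (Hyp e)
  have htr2 : LinearMap.trace ℝ (Hyp e)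
        (fderiv ℝ (fun y => graphDensity (fderiv ℝ γ y) • hproj e (W y)) y) =
      J * LinearMap.trace ℝ (Hyp e) (((hproj e).comp D : Hyp e →L[ℝ] Hyp e)) +
        fderiv ℝ (fun y => graphDensity (fderiv ℝ γ y)) y (hproj e (W y)) := by
    rw [hX, LinearMap.trace_eq_sum_inner _ b, LinearMap.trace_eq_sum_inner _ b, Finset.mul_sum]
    have h5 : fderiv ℝ (fun y => graphDensity (fderiv ℝ γ y)) y (hproj e (W y)) =
        ∑ k, ⟪b k, hproj e (W y)⟫ * fderiv ℝ (fun y => graphDensity (fderiv ℝ γ y)) y (b k) := by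
      conv_lhs => rw [← b.sum_repr' (hproj e (W y))]
      rw [map_sum]
      exact Finset.sum_congr rfl fun k _ => by rw [map_smul, smul_eq_mul]
    rw [h5, ← Finset.sum_add_distrib]
    refine Finset.sum_congr rfl fun k _ => ?_
    simp [inner_add_right, inner_smul_right, hJ]
    ring
  rw [htr2, hnn, htr1, sub_neg_eq_add, mul_add, hsymm, ← hgrad, ← hJ]
  field_simp

/-- The tangential divergence theorem for fields supported in a boundary chart. -/
theorem IsGraphOn.integral_sum_tpd_eq_zero {e : Rn N} {γ : Hyp e → ℝ} {V : Set (Rn N)}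
    (hV : IsGraphOn Ω e γ V) (hΩ : IsOpen Ω) (hγ : ContDiff ℝ 2 γ) {w : Rn N → Rn N}
    (hw : ContDiffOn ℝ 1 w (frontier Ω)) (htan : ∀ x ∈ frontier Ω, ⟪normal Ω x, w x⟫ = 0)
    {S : Set (Rn N)} (hS : IsCompact S) (hSV : S ⊆ V) (hw0 : ∀ x ∉ S, w x = 0) :
    ∫ x, ∑ i, tpd Ω i (fun z => w z i) x ∂(surfaceMeasure Ω) = 0 := by
  have he := hV.norm_eq
  have hγd : Differentiable ℝ γ := hγ.differentiable two_ne_zero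
  set G := graphMap e γ with hG
  have hGc : Continuous G := continuous_graphMap hV.cont
  have hGC : ContDiff ℝ 1 G := by
    have : ContDiff ℝ 1 γ := hγ.of_le one_le_two
    exact (Hyp e).subtypeL.contDiff.add (this.smul contDiff_const)
  set W : Hyp e → Rn N := fun y => w (G y) with hWdef
  have hWzero : ∀ y, G y ∉ S → W =ᶠ[𝓝 y] fun _ => 0 := fun y hy => by
    filter_upwards [hGc.continuousAt (hS.isClosed.isOpen_compl.mem_nhds hy)] with z hz
    exact hw0 _ hz
  have hW : ContDiff ℝ 1 W := by
    rw [contDiff_iff_contDiffAt]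
    intro y
    by_cases hy : G y ∈ S
    · have h1 : ContDiffOn ℝ 1 W (G ⁻¹' V) :=
        hw.comp hGC.contDiffOn fun z hz => hV.graphMap_mem_frontier hΩ hz
      exact h1.contDiffAt ((hV.isOpen.preimage hGc).mem_nhds (hSV hy))
    · exact contDiffAt_const.congr_of_eventuallyEq (hWzero y hy)
  have hWcs : HasCompactSupport W := by
    refine HasCompactSupport.intro (hS.image (hproj e).continuous) fun y hy => hw0 _ fun h => hy ?_
    exact ⟨_, h, hproj_graphMap γ y⟩
  have hWtan : ∀ y, ⟪e, W y⟫ = fderiv ℝ γ y (hproj e (W y)) := by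
    intro y
    by_cases hy : G y ∈ S
    · have h1 := htan _ (hV.graphMap_mem_frontier hΩ (hSV hy))
      rw [hV.normal_eq (hSV hy) (hγd y), inner_graphNormal] at h1
      have h2 := (mul_eq_zero.1 h1).resolve_left (inv_ne_zero (graphDensity_pos _).ne')
      exact (sub_eq_zero.1 h2).symm
    · have : W y = 0 := hw0 _ hy
      rw [this]; simp
  have hpoint : ∀ y, graphDensity (fderiv ℝ γ y) * ∑ i, tpd Ω i (fun z => w z i) (G y) =
      LinearMap.trace ℝ (Hyp e)
        (fderiv ℝ (fun y => graphDensity (fderiv ℝ γ y) • hproj e (W y)) y) := by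
    intro y
    rw [trace_fderiv_graphDensity_smul hγ hW hWtan]
    congr 1
    by_cases hy : G y ∈ S
    · have hyV := hSV hy
      have hyf := hV.graphMap_mem_frontier hΩ hyV
      have hn := hV.isOuterUnitNormal hyV (hγd y)
      have hn' : IsOuterUnitNormal Ω (G y) (normal Ω (G y)) := by rwa [hn.normal_eq]
      have hWd : HasFDerivAt W (fderiv ℝ W y) (hproj e (G y)) := by
        rw [hG, hproj_graphMap]; exact (hW.differentiable one_ne_zero y).hasFDerivAt
      have hwd : HasFDerivWithinAt w ((fderiv ℝ W y).comp (hproj e)) (frontier Ω) (G y) := by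
        have h1 : HasFDerivAt (fun x => W (hproj e x)) ((fderiv ℝ W y).comp (hproj e)) (G y) :=
          hWd.comp (G y) (hproj e).hasFDerivAt
        have h2 : w =ᶠ[𝓝[frontier Ω] (G y)] fun x => W (hproj e x) := by
          filter_upwards [mem_nhdsWithin_of_mem_nhds (hV.isOpen.mem_nhds hyV),
            self_mem_nhdsWithin] with z hz hzf
          simp only [hWdef, hG, graphMap_hproj he ((hV.mem_frontier_iff hΩ hz).1 hzf)]
        exact h1.hasFDerivWithinAt.congr_of_eventuallyEq h2 (h2.eq_of_nhdsWithin hyf)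
      have hcomp : ∀ i, tpd Ω i (fun z => w z i) (G y) =
          ⟪EuclideanSpace.single i (1 : ℝ), fderiv ℝ W y (hproj e (tcol Ω i (G y)))⟫ := by
        intro i
        have h1 : HasFDerivWithinAt (fun z => w z i)
            ((EuclideanSpace.proj (𝕜 := ℝ) i).comp ((fderiv ℝ W y).comp (hproj e)))
            (frontier Ω) (G y) :=
          (EuclideanSpace.proj (𝕜 := ℝ) i).hasFDerivAt.comp_hasFDerivWithinAt _ hwd
        rw [tpd_eq hn' h1, EuclideanSpace.inner_single_left]
        simp
      rw [LinearMap.trace_eq_sum_inner _ (EuclideanSpace.basisFun (Fin N) ℝ), ← hn.normal_eq]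
      set n := normal Ω (G y)
      have hnn : ⟪n, fderiv ℝ W y (hproj e n)⟫ =
          ∑ i, n i * ⟪EuclideanSpace.single i (1 : ℝ), fderiv ℝ W y (hproj e n)⟫ := by
        simp [PiLp.inner_apply, mul_comm]
      rw [hnn, ← Finset.sum_sub_distrib]
      refine Finset.sum_congr rfl fun i _ => ?_
      rw [hcomp, tcol_eq, map_sub, map_sub, map_smul, map_smul, inner_sub_right, inner_smul_right]
      simp [n]
    · have h1 : fderiv ℝ W y = 0 := by rw [(hWzero y hy).fderiv_eq]; simp
      have h2 : ∀ i, tpd Ω i (fun z => w z i) (G y) = 0 := by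
        intro i
        have : (fun z => w z i) =ᶠ[𝓝 (G y)] fun _ => (0 : ℝ) := by
          filter_upwards [hS.isClosed.isOpen_compl.mem_nhds hy] with z hz
          rw [hw0 z hz]; rfl
        rw [tpd, this.fderivWithin_eq_of_nhds]
        simp
      rw [h1]
      simp [h2]
  rw [hV.integral_surfaceMeasure hΩ (Or.inr hγd)]
  · rw [integral_congr_ae (Eventually.of_forall hpoint)]
    refine integral_trace_fderiv_eq_zero ?_ ?_
    · exact (contDiff_graphDensity_fderiv hγ (by norm_num)).smul ((hproj e).contDiff.comp hW)
    · refine hWcs.mono fun y hy hWy => hy ?_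
      simp only [hWy, map_zero, smul_zero]
  · intro x hx
    refine Finset.sum_eq_zero fun i _ => ?_
    have : (fun z => w z i) =ᶠ[𝓝 x] fun _ => (0 : ℝ) := by
      filter_upwards [hS.isClosed.isOpen_compl.mem_nhds fun h => hx (hSV h)] with z hz
      rw [hw0 z hz]; rfl
    rw [tpd, this.fderivWithin_eq_of_nhds]
    simp

/-- The tangential divergence theorem on the boundary of a `C³` domain: a tangential `C¹` field has
a tangential divergence with integral zero. -/
theorem integral_tangDiv_eq_zero (hΩ : IsOpen Ω) (hb : Bornology.IsBounded Ω)
    (hL : HasLipschitzBoundary Ω) (hC : HasContDiffBoundary 3 Ω) {w : Rn N → Rn N}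
    (hw : ContDiffOn ℝ 1 w (frontier Ω)) (htan : ∀ x ∈ frontier Ω, ⟪normal Ω x, w x⟫ = 0) :
    ∫ x, tangDiv Ω w x ∂(surfaceMeasure Ω) = 0 := by
  have := isFiniteMeasure_surfaceMeasure hΩ hb hL
  have hN : ∀ x ∈ frontier Ω, IsOuterUnitNormal Ω x (normal Ω x) := fun x hx =>
    isOuterUnitNormal_of_contDiff hΩ hC hx
  have hn0 : ContDiffOn ℝ (0 : ℕ) (normal Ω) (frontier Ω) :=
    (contDiffOn_normal hΩ hC).of_le (by norm_num)
  choose! e γ V hγ hV hxV hVb using fun x (hx : x ∈ frontier Ω) => hC.exists_chart hx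
  obtain ⟨t, ψ, ht, hψ, hψc, hψU, hψ1⟩ := exists_smooth_partition
    (isCompact_frontier_of_isBounded hb) V fun x hx => ⟨(hV x hx).isOpen, hxV x hx, hVb x hx⟩
  have hψw : ∀ c, ContDiffOn ℝ 1 (fun x => ψ c x • w x) (frontier Ω) := fun c =>
    ((hψ c).of_le (by exact_mod_cast le_top)).contDiffOn.smul hw
  have hψwi : ∀ c i, ContDiffOn ℝ 1 (fun x => (ψ c x • w x) i) (frontier Ω) := fun c i =>
    contDiffOn_euclidean.1 (hψw c) i
  have hint : ∀ c, Integrable (fun x => ∑ i, tpd Ω i (fun z => (ψ c z • w z) i) x)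
      (surfaceMeasure Ω) := fun c =>
    (memLp_finsetSum _ fun i _ => memLp_top_of_continuousOn_frontier hb
      (contDiffOn_tpd hn0 hN (hψwi c i) i).continuousOn).integrable le_top
  calc ∫ x, tangDiv Ω w x ∂(surfaceMeasure Ω)
      = ∫ x, ∑ c, ∑ i, tpd Ω i (fun z => (ψ c z • w z) i) x ∂(surfaceMeasure Ω) := by
        refine integral_congr_ae ?_
        refine ae_restrict_of_forall_mem isClosed_frontier.measurableSet fun x hx => ?_
        simp only
        rw [tangDiv_eq (hN x hx) (hw.differentiableOn one_ne_zero x hx), Finset.sum_comm]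
        refine Finset.sum_congr rfl fun i _ => ?_
        rw [← tpd_sum (hN x hx) _ fun c _ => (hψwi c i).differentiableOn one_ne_zero x hx]
        refine tpd_congr (fun z hz => ?_) i hx
        simp only [PiLp.smul_apply, smul_eq_mul]
        rw [← Finset.sum_mul, hψ1 z hz, one_mul]
    _ = ∑ c, ∫ x, ∑ i, tpd Ω i (fun z => (ψ c z • w z) i) x ∂(surfaceMeasure Ω) :=
        integral_finsetSum _ fun c _ => hint c
    _ = 0 := by
        refine Finset.sum_eq_zero fun c _ => ?_
        refine (hV c (ht c)).integral_sum_tpd_eq_zero hΩ ((hγ c (ht c)).of_le (by norm_num)) (hψw c)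
          (fun x hx => ?_) (hψc c) (hψU c) fun x hx => ?_
        · rw [inner_smul_right, htan x hx, mul_zero]
        · rw [image_eq_zero_of_notMem_tsupport hx, zero_smul]

end TangentialDivergence

/-! ### Tangential product rules -/

section TangentialProductRules

variable {N : ℕ} {Ω : Set (Rn N)}

theorem tangVec_apply (v : Rn N → Rn N) (x : Rn N) (i : Fin N) :
    tangVec Ω v x i = v x i - (∑ k, normal Ω x k * v x k) * normal Ω x i := by
  simp only [tangVec, tangProj, Matrix.sub_mulVec, Matrix.one_mulVec, Matrix.vecMulVec_mulVec,
    Pi.sub_apply, Pi.smul_apply]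
  simp [dotProduct, mul_comm]

theorem tangMat_apply (A : Rn N → Matrix (Fin N) (Fin N) ℝ) (x : Rn N) (j i : Fin N) :
    tangMat Ω A x j i = A x j i - (∑ k, A x j k * normal Ω x k) * normal Ω x i := by
  simp only [tangMat, tangProj, Matrix.mul_sub, Matrix.mul_one, Matrix.mul_vecMulVec,
    Matrix.sub_apply, Matrix.vecMulVec_apply]
  rfl

theorem sum_normal_mul_tangVec {x : Rn N} (h : IsOuterUnitNormal Ω x (normal Ω x))
    (v : Rn N → Rn N) : ∑ i, normal Ω x i * tangVec Ω v x i = 0 := by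
  simp only [tangVec_apply, mul_sub, Finset.sum_sub_distrib]
  have : ∑ i, normal Ω x i * ((∑ k, normal Ω x k * v x k) * normal Ω x i) =
      (∑ k, normal Ω x k * v x k) * ∑ i, normal Ω x i * normal Ω x i := by
    rw [Finset.mul_sum]
    exact Finset.sum_congr rfl fun i _ => by ring
  rw [this, sum_normal_sq h, mul_one, sub_self]

theorem sum_tangMat_mul_normal {x : Rn N} (h : IsOuterUnitNormal Ω x (normal Ω x))
    (A : Rn N → Matrix (Fin N) (Fin N) ℝ) (j : Fin N) :
    ∑ i, normal Ω x i * tangMat Ω A x j i = 0 := by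
  simp only [tangMat_apply, mul_sub, Finset.sum_sub_distrib]
  have : ∑ i, normal Ω x i * ((∑ k, A x j k * normal Ω x k) * normal Ω x i) =
      (∑ k, A x j k * normal Ω x k) * ∑ i, normal Ω x i * normal Ω x i := by
    rw [Finset.mul_sum]
    exact Finset.sum_congr rfl fun i _ => by ring
  rw [this, sum_normal_sq h, mul_one, sub_eq_zero]
  exact Finset.sum_congr rfl fun i _ => mul_comm _ _

/-- Along a tangential vector, the tangential gradient can be replaced by the full gradient. -/
theorem sum_mul_tpd_eq {x : Rn N} (h : IsOuterUnitNormal Ω x (normal Ω x)) {u : Fin N → ℝ}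
    (hu : ∑ i, normal Ω x i * u i = 0) {g : Rn N → ℝ}
    (hg : DifferentiableWithinAt ℝ g (closure Ω) x) :
    ∑ i, u i * tpd Ω i g x = ∑ i, u i * pd Ω i g x := by
  have h1 : ∀ i, u i * tpd Ω i g x = u i * pd Ω i g x - normal Ω x i * u i * dn Ω g x := fun i => by
    rw [tpd_eq_sum_pd h hg]; ring
  simp only [h1, Finset.sum_sub_distrib]
  rw [← Finset.sum_mul, hu, zero_mul, sub_zero]

theorem tangDiv_smul {x : Rn N} (h : IsOuterUnitNormal Ω x (normal Ω x)) {g : Rn N → ℝ}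
    {u : Rn N → Rn N} (hg : DifferentiableWithinAt ℝ g (frontier Ω) x)
    (hu : DifferentiableWithinAt ℝ u (frontier Ω) x) :
    tangDiv Ω (fun z => g z • u z) x = ∑ i, u x i * tpd Ω i g x + g x * tangDiv Ω u x := by
  rw [tangDiv_eq h (hg.fun_smul hu), tangDiv_eq h hu, Finset.mul_sum, ← Finset.sum_add_distrib]
  refine Finset.sum_congr rfl fun i _ => ?_
  simp only [PiLp.smul_apply, smul_eq_mul]
  rw [tpd_mul h hg (differentiableWithinAt_euclidean.1 hu i)]
  ring

theorem tangDiv_add {x : Rn N} (h : IsOuterUnitNormal Ω x (normal Ω x)) {u v : Rn N → Rn N}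
    (hu : DifferentiableWithinAt ℝ u (frontier Ω) x)
    (hv : DifferentiableWithinAt ℝ v (frontier Ω) x) :
    tangDiv Ω (fun z => u z + v z) x = tangDiv Ω u x + tangDiv Ω v x := by
  rw [tangDiv_eq h (hu.fun_add hv), tangDiv_eq h hu, tangDiv_eq h hv, ← Finset.sum_add_distrib]
  refine Finset.sum_congr rfl fun i _ => ?_
  simp only [PiLp.add_apply]
  rw [tpd_add h (differentiableWithinAt_euclidean.1 hu i) (differentiableWithinAt_euclidean.1 hv i)]

theorem tangDiv_sub {x : Rn N} (h : IsOuterUnitNormal Ω x (normal Ω x)) {u v : Rn N → Rn N}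
    (hu : DifferentiableWithinAt ℝ u (frontier Ω) x)
    (hv : DifferentiableWithinAt ℝ v (frontier Ω) x) :
    tangDiv Ω (fun z => u z - v z) x = tangDiv Ω u x - tangDiv Ω v x := by
  rw [tangDiv_eq h (hu.fun_sub hv), tangDiv_eq h hu, tangDiv_eq h hv, ← Finset.sum_sub_distrib]
  refine Finset.sum_congr rfl fun i _ => ?_
  simp only [PiLp.sub_apply]
  rw [tpd_sub h (differentiableWithinAt_euclidean.1 hu i) (differentiableWithinAt_euclidean.1 hv i)]

theorem tangDiv_sum {x : Rn N} (h : IsOuterUnitNormal Ω x (normal Ω x)) {ι : Type*}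
    (s : Finset ι) {u : ι → Rn N → Rn N}
    (hu : ∀ j ∈ s, DifferentiableWithinAt ℝ (u j) (frontier Ω) x) :
    tangDiv Ω (fun z => ∑ j ∈ s, u j z) x = ∑ j ∈ s, tangDiv Ω (u j) x := by
  rw [tangDiv_eq h (DifferentiableWithinAt.fun_sum hu),
    Finset.sum_congr rfl fun j hj => tangDiv_eq h (hu j hj), Finset.sum_comm]
  refine Finset.sum_congr rfl fun i _ => ?_
  rw [← tpd_sum h s fun j hj => differentiableWithinAt_euclidean.1 (hu j hj) i]
  congr 1
  ext z
  simp

theorem contDiffOn_tangVec {n : ℕ} (hn : ContDiffOn ℝ n (normal Ω) (frontier Ω))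
    {v : Rn N → Rn N} (hv : ContDiffOn ℝ n v (frontier Ω)) :
    ContDiffOn ℝ n (tangVec Ω v) (frontier Ω) := by
  rw [contDiffOn_euclidean] at hn hv ⊢
  intro i
  simp only [tangVec_apply]
  exact (hv i).sub ((ContDiffOn.sum fun k _ => (hn k).mul (hv k)).mul (hn i))

theorem contDiffOn_tangMat {n : ℕ} (hn : ContDiffOn ℝ n (normal Ω) (frontier Ω))
    {A : Rn N → Matrix (Fin N) (Fin N) ℝ}
    (hA : ∀ j k, ContDiffOn ℝ n (fun x => A x j k) (frontier Ω)) (j i : Fin N) :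
    ContDiffOn ℝ n (fun x => tangMat Ω A x j i) (frontier Ω) := by
  rw [contDiffOn_euclidean] at hn
  simp only [tangMat_apply]
  exact (hA j i).sub ((ContDiffOn.sum fun k _ => (hA j k).mul (hn k)).mul (hn i))

theorem contDiffOn_tangDiv {n : ℕ} (hn : ContDiffOn ℝ n (normal Ω) (frontier Ω))
    (hN : ∀ x ∈ frontier Ω, IsOuterUnitNormal Ω x (normal Ω x)) {v : Rn N → Rn N}
    (hv : ContDiffOn ℝ (n + 1 : ℕ) v (frontier Ω)) : ContDiffOn ℝ n (tangDiv Ω v) (frontier Ω) := by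
  refine ContDiffOn.congr (f := fun x => ∑ i, tpd Ω i (fun z => v z i) x)
    (ContDiffOn.sum fun i _ => contDiffOn_tpd hn hN (contDiffOn_euclidean.1 hv i) i)
    fun x hx => tangDiv_eq (hN x hx) (hv.differentiableOn (by norm_num) x hx)

/-- The curvature tensor annihilates the normal from the left, because `|n| = 1`. -/
theorem sum_normal_mul_curvature (hn : DifferentiableOn ℝ (normal Ω) (frontier Ω))
    (hN : ∀ x ∈ frontier Ω, IsOuterUnitNormal Ω x (normal Ω x)) {x : Rn N}
    (hx : x ∈ frontier Ω) (j : Fin N) : ∑ i, normal Ω x i * curvature Ω x i j = 0 := by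
  have hni := differentiableWithinAt_euclidean.1 (hn x hx)
  have h1 : tpd Ω j (fun z => ∑ i, normal Ω z i * normal Ω z i) x = 0 := by
    rw [tpd_congr (fun z hz => sum_normal_sq (hN z hz)) j hx, tpd_const (hN x hx)]
  rw [tpd_sum (hN x hx) _ fun i _ => (hni i).fun_mul (hni i)] at h1
  have h2 : ∀ i, tpd Ω j (fun z => normal Ω z i * normal Ω z i) x =
      2 * (normal Ω x i * curvature Ω x i j) := fun i => by
    rw [tpd_mul (hN x hx) (hni i) (hni i), curvature, tangJacobian_apply (hN x hx) (hn x hx)]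
    ring
  simp only [h2, ← Finset.mul_sum] at h1
  linarith

end TangentialProductRules

/-! ### The second formula -/

section SecondFormula

variable {N : ℕ} {Ω : Set (Rn N)}

/-- The `j`-th row of `(nᵀD³f)_{∂Ω}`, as a tangential vector field. -/
def tangRow (Ω : Set (Rn N)) (f : Rn N → ℝ) (j : Fin N) (x : Rn N) : Rn N :=
  WithLp.toLp 2 (tangMat Ω (nThird Ω f) x j)

/-- The vector field `D_{∂Ω}n (D³f[n ⊗ n])_{∂Ω}`. -/
def curvVec (Ω : Set (Rn N)) (f : Rn N → ℝ) (x : Rn N) : Rn N :=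
  WithLp.toLp 2 (curvature Ω x *ᵥ (tangVec Ω (thirdNN Ω f) x : Fin N → ℝ))

theorem curvVec_apply (f : Rn N → ℝ) (x : Rn N) (i : Fin N) :
    curvVec Ω f x i = ∑ j, curvature Ω x i j * tangVec Ω (thirdNN Ω f) x j := rfl

/-- The third derivatives are symmetric up to the boundary. -/
theorem third_comm_left (hΩ : IsOpen Ω) (hud : UniqueDiffOn ℝ (closure Ω)) {f : Rn N → ℝ}
    (hf : ContDiffOn ℝ 3 f (closure Ω)) {x : Rn N} (hx : x ∈ closure Ω) (i j k : Fin N) :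
    third Ω f x i j k = third Ω f x j i k :=
  pd_comm hΩ hud (contDiffOn_pd hud hf (by norm_num) k) i j hx

theorem third_comm_right (hΩ : IsOpen Ω) (hud : UniqueDiffOn ℝ (closure Ω)) {f : Rn N → ℝ}
    (hf : ContDiffOn ℝ 3 f (closure Ω)) {x : Rn N} (hx : x ∈ closure Ω) (i j k : Fin N) :
    third Ω f x i j k = third Ω f x i k j :=
  pd_congr (pd_comm hΩ hud (hf.of_le (by norm_num)) j k) i hx

/-- `(nᵀD³f) n = D³f[n ⊗ n]`. -/
theorem sum_nThird_mul_normal (hΩ : IsOpen Ω) (hud : UniqueDiffOn ℝ (closure Ω)) {f : Rn N → ℝ}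
    (hf : ContDiffOn ℝ 3 f (closure Ω)) {x : Rn N} (hx : x ∈ closure Ω) (j : Fin N) :
    ∑ k, nThird Ω f x j k * normal Ω x k = thirdNN Ω f x j := by
  simp only [nThird, Matrix.of_apply, thirdNN, Finset.sum_mul]
  rw [Finset.sum_comm]
  refine Finset.sum_congr rfl fun i _ => Finset.sum_congr rfl fun k _ => ?_
  rw [third_comm_left hΩ hud hf hx i j k]
  ring

theorem nThird_symm (hΩ : IsOpen Ω) (hud : UniqueDiffOn ℝ (closure Ω)) {f : Rn N → ℝ}
    (hf : ContDiffOn ℝ 3 f (closure Ω)) {x : Rn N} (hx : x ∈ closure Ω) (j k : Fin N) :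
    nThird Ω f x j k = nThird Ω f x k j := by
  simp only [nThird, Matrix.of_apply]
  exact Finset.sum_congr rfl fun i _ => by rw [third_comm_right hΩ hud hf hx]

theorem sum_normal_mul_thirdNN (f : Rn N → ℝ) (x : Rn N) :
    ∑ i, normal Ω x i * thirdNN Ω f x i = dnnn Ω f x := by
  simp only [thirdNN, dnnn, Finset.mul_sum]
  exact Finset.sum_congr rfl fun i _ => Finset.sum_congr rfl fun j _ =>
    Finset.sum_congr rfl fun k _ => by ring

/-- Contracting the rows of `(nᵀD³f)_{∂Ω}` with `n` gives `(D³f[n ⊗ n])_{∂Ω}`. -/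
theorem sum_normal_mul_tangMat (hΩ : IsOpen Ω) (hud : UniqueDiffOn ℝ (closure Ω)) {f : Rn N → ℝ}
    (hf : ContDiffOn ℝ 3 f (closure Ω)) {x : Rn N} (hx : x ∈ closure Ω) (i : Fin N) :
    ∑ j, normal Ω x j * tangMat Ω (nThird Ω f) x j i = tangVec Ω (thirdNN Ω f) x i := by
  simp only [tangMat_apply, tangVec_apply, sum_nThird_mul_normal hΩ hud hf hx, mul_sub,
    Finset.sum_sub_distrib]
  congr 1
  · rw [← sum_nThird_mul_normal hΩ hud hf hx i]
    exact Finset.sum_congr rfl fun j _ => by rw [nThird_symm hΩ hud hf hx]; ring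
  · rw [Finset.sum_mul]
    exact Finset.sum_congr rfl fun j _ => by ring

section Smoothness

variable (hud : UniqueDiffOn ℝ (closure Ω)) (hn : ContDiffOn ℝ (2 : ℕ) (normal Ω) (frontier Ω))
  (hN : ∀ x ∈ frontier Ω, IsOuterUnitNormal Ω x (normal Ω x)) {f : Rn N → ℝ}
  (hf : ContDiffOn ℝ 6 f (closure Ω))
include hud hf

theorem contDiffOn_third (i j k : Fin N) :
    ContDiffOn ℝ (2 : ℕ) (fun x => third Ω f x i j k) (frontier Ω) := by
  have h5 : ContDiffOn ℝ (5 : ℕ) (pd Ω k f) (closure Ω) := contDiffOn_pd hud hf (by norm_num) k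
  have h4 : ContDiffOn ℝ (4 : ℕ) (pd Ω j (pd Ω k f)) (closure Ω) :=
    contDiffOn_pd hud h5 (by norm_num) j
  have h3 : ContDiffOn ℝ (2 : ℕ) (pd Ω i (pd Ω j (pd Ω k f))) (closure Ω) :=
    contDiffOn_pd hud h4 (by norm_num) i
  exact h3.mono frontier_subset_closure

include hn

theorem contDiffOn_nThird (j k : Fin N) :
    ContDiffOn ℝ (2 : ℕ) (fun x => nThird Ω f x j k) (frontier Ω) := by
  have h : ContDiffOn ℝ (2 : ℕ) (fun x => ∑ i, normal Ω x i * third Ω f x i j k) (frontier Ω) :=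
    ContDiffOn.sum fun i _ => (contDiffOn_euclidean.1 hn i).mul (contDiffOn_third hud hf i j k)
  exact h

theorem contDiffOn_tangRow (j : Fin N) :
    ContDiffOn ℝ (2 : ℕ) (tangRow Ω f j) (frontier Ω) :=
  contDiffOn_euclidean.2 fun i => contDiffOn_tangMat hn (contDiffOn_nThird hud hn hf) j i

theorem contDiffOn_tangVec_thirdNN :
    ContDiffOn ℝ (2 : ℕ) (tangVec Ω (thirdNN Ω f)) (frontier Ω) := by
  refine contDiffOn_tangVec hn (contDiffOn_euclidean.2 fun i => ?_)
  have h : ContDiffOn ℝ (2 : ℕ)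
      (fun x => ∑ j, ∑ k, third Ω f x i j k * normal Ω x j * normal Ω x k) (frontier Ω) :=
    ContDiffOn.sum fun j _ => ContDiffOn.sum fun k _ => ((contDiffOn_third hud hf i j k).mul
      (contDiffOn_euclidean.1 hn j)).mul (contDiffOn_euclidean.1 hn k)
  exact h

theorem contDiffOn_tangVec_nHess_lap :
    ContDiffOn ℝ (1 : ℕ) (tangVec Ω (nHess Ω (lap Ω f))) (frontier Ω) := by
  have h4 : ContDiffOn ℝ (4 : ℕ) (lap Ω f) (closure Ω) :=
    contDiffOn_lap (n := 6) hud hf (by norm_num)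
  have h3 : ∀ j, ContDiffOn ℝ (3 : ℕ) (pd Ω j (lap Ω f)) (closure Ω) := fun j =>
    contDiffOn_pd hud h4 (by norm_num) j
  have h1 : ∀ i j, ContDiffOn ℝ (1 : ℕ) (pd Ω i (pd Ω j (lap Ω f))) (frontier Ω) := fun i j =>
    (contDiffOn_pd hud (h3 j) (by norm_num) i).mono frontier_subset_closure
  have hn1 : ContDiffOn ℝ (1 : ℕ) (normal Ω) (frontier Ω) := hn.of_le (by norm_num)
  refine contDiffOn_tangVec hn1 (contDiffOn_euclidean.2 fun j => ?_)
  have h : ContDiffOn ℝ (1 : ℕ)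
      (fun x => ∑ i, normal Ω x i * pd Ω i (pd Ω j (lap Ω f)) x) (frontier Ω) :=
    ContDiffOn.sum fun i _ => (contDiffOn_euclidean.1 hn1 i).mul (h1 i j)
  exact h

include hN

theorem contDiffOn_tangVec_tangDivMat :
    ContDiffOn ℝ (1 : ℕ) (tangVec Ω (tangDivMat Ω (tangMat Ω (nThird Ω f)))) (frontier Ω) := by
  have hn1 : ContDiffOn ℝ (1 : ℕ) (normal Ω) (frontier Ω) := hn.of_le (by norm_num)
  exact contDiffOn_tangVec hn1 (contDiffOn_euclidean.2 fun i =>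
    contDiffOn_tangDiv hn1 hN (contDiffOn_tangRow hud hn hf i))

omit hud hf in
theorem contDiffOn_curvature (i j : Fin N) :
    ContDiffOn ℝ (1 : ℕ) (fun x => curvature Ω x i j) (frontier Ω) := by
  have hn1 : ContDiffOn ℝ (1 : ℕ) (normal Ω) (frontier Ω) := hn.of_le (by norm_num)
  refine (contDiffOn_tpd hn1 hN (contDiffOn_euclidean.1 hn i) j).congr fun x hx => ?_
  exact tangJacobian_apply (hN x hx) (hn.differentiableOn (by norm_num) x hx) i j

theorem contDiffOn_curvVec : ContDiffOn ℝ (1 : ℕ) (curvVec Ω f) (frontier Ω) := by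
  refine contDiffOn_euclidean.2 fun i => ?_
  have h : ContDiffOn ℝ (1 : ℕ)
      (fun x => ∑ j, curvature Ω x i j * tangVec Ω (thirdNN Ω f) x j) (frontier Ω) :=
    ContDiffOn.sum fun j _ => (contDiffOn_curvature hn hN i j).mul
      ((contDiffOn_euclidean.1 (contDiffOn_tangVec_thirdNN hud hn hf) j).of_le (by norm_num))
  exact h

end Smoothness

/-- The tangential field on `∂Ω` whose tangential divergence is the difference of the boundary
integrands of the two formulas. The terms with `∂ⱼφ` and `∂φ/∂n` move one tangential derivative off
`D²φ`, and the terms with `φ` move the remaining one off `∇φ`. -/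
def boundaryField (Ω : Set (Rn N)) (f φ : Rn N → ℝ) (x : Rn N) : Rn N :=
  (∑ j, pd Ω j φ x • tangRow Ω f j x) + dn Ω φ x • tangVec Ω (thirdNN Ω f) x -
    φ x • (tangVec Ω (tangDivMat Ω (tangMat Ω (nThird Ω f))) x + curvVec Ω f x +
      tangVec Ω (nHess Ω (lap Ω f)) x)

section Identity

variable (hΩ : IsOpen Ω) (hud : UniqueDiffOn ℝ (closure Ω))
  (hn : ContDiffOn ℝ (2 : ℕ) (normal Ω) (frontier Ω))
  (hN : ∀ x ∈ frontier Ω, IsOuterUnitNormal Ω x (normal Ω x)) {f φ : Rn N → ℝ}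
  (hf : ContDiffOn ℝ 6 f (closure Ω)) (hφ : ContDiffOn ℝ 3 φ (closure Ω))
include hud hn hφ

theorem contDiffOn_dn : ContDiffOn ℝ (1 : ℕ) (dn Ω φ) (frontier Ω) :=
  ContDiffOn.sum fun i _ => ((contDiffOn_euclidean.1 hn i).of_le (by norm_num)).mul
    ((contDiffOn_pd hud hφ (by norm_num) i).mono frontier_subset_closure)

include hN hf

theorem contDiffOn_boundaryField : ContDiffOn ℝ (1 : ℕ) (boundaryField Ω f φ) (frontier Ω) := by
  have hp : ∀ j, ContDiffOn ℝ (1 : ℕ) (pd Ω j φ) (frontier Ω) := fun j =>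
    (contDiffOn_pd hud hφ (by norm_num) j).mono frontier_subset_closure
  have hφ1 : ContDiffOn ℝ (1 : ℕ) φ (frontier Ω) :=
    (hφ.of_le (by norm_num)).mono frontier_subset_closure
  exact ((ContDiffOn.sum fun j _ => (hp j).smul
      ((contDiffOn_tangRow hud hn hf j).of_le (by norm_num))).add
    ((contDiffOn_dn hud hn hφ).smul
      ((contDiffOn_tangVec_thirdNN hud hn hf).of_le (by norm_num)))).sub
    (hφ1.smul (((contDiffOn_tangVec_tangDivMat hud hn hN hf).add
      (contDiffOn_curvVec hud hn hN hf)).add (contDiffOn_tangVec_nHess_lap hud hn hf)))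

omit hud hf hφ in
theorem sum_normal_mul_curvVec {x : Rn N} (hx : x ∈ frontier Ω) :
    ∑ i, normal Ω x i * curvVec Ω f x i = 0 := by
  simp only [curvVec_apply, Finset.mul_sum]
  rw [Finset.sum_comm]
  refine Finset.sum_eq_zero fun j _ => ?_
  rw [← zero_mul (tangVec Ω (thirdNN Ω f) x j), ← sum_normal_mul_curvature
    (hn.differentiableOn (by norm_num)) hN hx j, Finset.sum_mul]
  exact Finset.sum_congr rfl fun i _ => by ring

omit hud hf hφ in
theorem inner_normal_boundaryField {x : Rn N} (hx : x ∈ frontier Ω) :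
    ⟪normal Ω x, boundaryField Ω f φ x⟫ = 0 := by
  have h1 : ∀ v : Rn N, ⟪normal Ω x, v⟫ = ∑ i, normal Ω x i * v i := fun v => by
    simp [PiLp.inner_apply, mul_comm]
  have h2 : ∀ j, ⟪normal Ω x, tangRow Ω f j x⟫ = 0 := fun j => by
    rw [h1]; exact sum_tangMat_mul_normal (hN x hx) _ j
  have h3 : ∀ v, ⟪normal Ω x, tangVec Ω v x⟫ = 0 := fun v => by
    rw [h1]; exact sum_normal_mul_tangVec (hN x hx) v
  have h4 : ⟪normal Ω x, curvVec Ω f x⟫ = 0 := by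
    rw [h1]; exact sum_normal_mul_curvVec hn hN hx
  rw [boundaryField]
  simp [inner_sub_right, inner_add_right, inner_sum, inner_smul_right, h2, h3, h4]

include hΩ

omit hφ in
/-- `n · div_{∂Ω} (nᵀD³f)_{∂Ω} = div_{∂Ω} (D³f[n ⊗ n])_{∂Ω} - (nᵀD³f)_{∂Ω} : D_{∂Ω}n`, by the
product rule. -/
theorem sum_normal_mul_tangDivMat {x : Rn N} (hx : x ∈ frontier Ω) :
    ∑ j, normal Ω x j * tangDivMat Ω (tangMat Ω (nThird Ω f)) x j =
      tangDiv Ω (tangVec Ω (thirdNN Ω f)) x -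
        colon (tangMat Ω (nThird Ω f) x) (curvature Ω x) := by
  have hNx := hN x hx
  have hnd := hn.differentiableOn (by norm_num) x hx
  have hrow : ∀ j, DifferentiableWithinAt ℝ (tangRow Ω f j) (frontier Ω) x := fun j =>
    (contDiffOn_tangRow hud hn hf j).differentiableOn (by norm_num) x hx
  have hf3 : ContDiffOn ℝ 3 f (closure Ω) := hf.of_le (by norm_num)
  have h1 : tangDiv Ω (tangVec Ω (thirdNN Ω f)) x =
      ∑ j, tangDiv Ω (fun z => normal Ω z j • tangRow Ω f j z) x := by
    rw [← tangDiv_sum hNx _ fun j _ =>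
      (differentiableWithinAt_euclidean.1 hnd j).fun_smul (hrow j),
      tangDiv_eq hNx ((contDiffOn_tangVec_thirdNN hud hn hf).differentiableOn (by norm_num) x hx),
      tangDiv_eq hNx (DifferentiableWithinAt.fun_sum fun j _ =>
        (differentiableWithinAt_euclidean.1 hnd j).fun_smul (hrow j))]
    refine Finset.sum_congr rfl fun i _ => tpd_congr (fun z hz => ?_) i hx
    simp only [← sum_normal_mul_tangMat hΩ hud hf3 (frontier_subset_closure hz) i]
    simp [tangRow]
  rw [h1, colon, ← Finset.sum_sub_distrib]
  refine Finset.sum_congr rfl fun j _ => ?_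
  rw [tangDiv_smul hNx (differentiableWithinAt_euclidean.1 hnd j) (hrow j)]
  have h2 : ∀ i, curvature Ω x j i = tpd Ω i (fun z => normal Ω z j) x := fun i =>
    tangJacobian_apply hNx hnd j i
  simp only [h2]
  simp [tangRow, tangDivMat]
  exact Or.inl rfl

/-- The boundary integrands of the two formulas differ by a tangential divergence. -/
theorem boundary_integrand_eq {x : Rn N} (hx : x ∈ frontier Ω) :
    colon (nThird Ω f x) (hess Ω φ x) - ∑ k, nHess Ω (lap Ω f) x k * pd Ω k φ x +
        dn Ω (lap Ω (lap Ω f)) x * φ x =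
      dnnn Ω f x * dnn Ω φ x + coeffNormal Ω f x * dn Ω φ x + coeffValue Ω f x * φ x +
        tangDiv Ω (boundaryField Ω f φ) x := by
  have hNx := hN x hx
  have hxc : x ∈ closure Ω := frontier_subset_closure hx
  have hnd := hn.differentiableOn (by norm_num) x hx
  have hni := differentiableWithinAt_euclidean.1 hnd
  have hf3 : ContDiffOn ℝ 3 f (closure Ω) := hf.of_le (by norm_num)
  have hφ2 : ContDiffOn ℝ 2 φ (closure Ω) := hφ.of_le (by norm_num)
  have hpc : ∀ j, DifferentiableWithinAt ℝ (pd Ω j φ) (closure Ω) x := fun j =>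
    (contDiffOn_pd (m := 1) hud hφ (by norm_num) j).differentiableOn one_ne_zero x hxc
  have hpf : ∀ j, DifferentiableWithinAt ℝ (pd Ω j φ) (frontier Ω) x := fun j =>
    (hpc j).mono frontier_subset_closure
  have hφc : DifferentiableWithinAt ℝ φ (closure Ω) x :=
    hφ.differentiableOn (by norm_num) x hxc
  have hφf := hφc.mono (frontier_subset_closure (s := Ω))
  have hrow : ∀ j, DifferentiableWithinAt ℝ (tangRow Ω f j) (frontier Ω) x := fun j =>
    (contDiffOn_tangRow hud hn hf j).differentiableOn (by norm_num) x hx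
  have hvt : DifferentiableWithinAt ℝ (tangVec Ω (thirdNN Ω f)) (frontier Ω) x :=
    (contDiffOn_tangVec_thirdNN hud hn hf).differentiableOn (by norm_num) x hx
  have hβt : DifferentiableWithinAt ℝ (tangVec Ω (tangDivMat Ω (tangMat Ω (nThird Ω f))))
      (frontier Ω) x :=
    (contDiffOn_tangVec_tangDivMat hud hn hN hf).differentiableOn (by norm_num) x hx
  have hKv : DifferentiableWithinAt ℝ (curvVec Ω f) (frontier Ω) x :=
    (contDiffOn_curvVec hud hn hN hf).differentiableOn (by norm_num) x hx
  have hht : DifferentiableWithinAt ℝ (tangVec Ω (nHess Ω (lap Ω f))) (frontier Ω) x :=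
    (contDiffOn_tangVec_nHess_lap hud hn hf).differentiableOn (by norm_num) x hx
  have hdn : DifferentiableWithinAt ℝ (dn Ω φ) (frontier Ω) x :=
    (contDiffOn_dn hud hn hφ).differentiableOn (by norm_num) x hx
  -- the product rule for each of the five terms of the field
  have hdiv : tangDiv Ω (boundaryField Ω f φ) x =
      (∑ j, (∑ i, tangRow Ω f j x i * tpd Ω i (pd Ω j φ) x +
        pd Ω j φ x * tangDiv Ω (tangRow Ω f j) x)) +
      (∑ i, tangVec Ω (thirdNN Ω f) x i * tpd Ω i (dn Ω φ) x +
        dn Ω φ x * tangDiv Ω (tangVec Ω (thirdNN Ω f)) x) -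
      (∑ i, (tangVec Ω (tangDivMat Ω (tangMat Ω (nThird Ω f))) x + curvVec Ω f x +
        tangVec Ω (nHess Ω (lap Ω f)) x) i * tpd Ω i φ x +
        φ x * (tangDiv Ω (tangVec Ω (tangDivMat Ω (tangMat Ω (nThird Ω f)))) x +
          tangDiv Ω (curvVec Ω f) x + tangDiv Ω (tangVec Ω (nHess Ω (lap Ω f))) x)) := by
    have hsum := DifferentiableWithinAt.fun_sum (u := Finset.univ)
      fun j (_ : j ∈ Finset.univ) => (hpf j).fun_smul (hrow j)
    have h0 : boundaryField Ω f φ = fun z => ((∑ j, pd Ω j φ z • tangRow Ω f j z) +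
      dn Ω φ z • tangVec Ω (thirdNN Ω f) z) -
      φ z • (tangVec Ω (tangDivMat Ω (tangMat Ω (nThird Ω f))) z + curvVec Ω f z +
      tangVec Ω (nHess Ω (lap Ω f)) z) := rfl
    rw [h0, tangDiv_sub hNx (hsum.fun_add (hdn.fun_smul hvt))
      (hφf.fun_smul ((hβt.fun_add hKv).fun_add hht)),
      tangDiv_add hNx hsum (hdn.fun_smul hvt),
      tangDiv_sum hNx _ (fun j _ => (hpf j).fun_smul (hrow j)), tangDiv_smul hNx hdn hvt,
      tangDiv_smul hNx hφf ((hβt.fun_add hKv).fun_add hht), tangDiv_add hNx (hβt.fun_add hKv) hht,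
      tangDiv_add hNx hβt hKv]
    simp only [tangDiv_smul hNx (hpf _) (hrow _)]
  -- tangential derivatives along tangential vectors are full derivatives
  have h1 : ∀ j, ∑ i, tangRow Ω f j x i * tpd Ω i (pd Ω j φ) x =
      ∑ i, tangRow Ω f j x i * hess Ω φ x i j := fun j =>
    sum_mul_tpd_eq hNx (sum_tangMat_mul_normal hNx _ j) (hpc j)
  have h2 : ∑ i, tangVec Ω (thirdNN Ω f) x i * tpd Ω i (dn Ω φ) x =
      ∑ j, curvVec Ω f x j * pd Ω j φ x +
        ∑ j, normal Ω x j * ∑ i, tangVec Ω (thirdNN Ω f) x i * hess Ω φ x i j := by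
    have h3 : ∀ i, tpd Ω i (dn Ω φ) x =
        ∑ j, (normal Ω x j * tpd Ω i (pd Ω j φ) x + curvature Ω x j i * pd Ω j φ x) := by
      intro i
      have h4 : dn Ω φ = fun z => ∑ j, normal Ω z j * pd Ω j φ z := rfl
      rw [h4, tpd_sum hNx _ fun j _ => (hni j).fun_mul (hpf j)]
      refine Finset.sum_congr rfl fun j _ => ?_
      rw [tpd_mul hNx (hni j) (hpf j), curvature, tangJacobian_apply hNx hnd]
    have h5 : ∀ j, ∑ i, tangVec Ω (thirdNN Ω f) x i * tpd Ω i (pd Ω j φ) x =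
        ∑ i, tangVec Ω (thirdNN Ω f) x i * hess Ω φ x i j := fun j =>
      sum_mul_tpd_eq hNx (sum_normal_mul_tangVec hNx _) (hpc j)
    simp only [h3, ← h5, curvVec_apply, Finset.mul_sum, Finset.sum_mul]
    rw [Finset.sum_comm, ← Finset.sum_add_distrib]
    refine Finset.sum_congr rfl fun j _ => ?_
    rw [← Finset.sum_add_distrib]
    exact Finset.sum_congr rfl fun i _ => by ring
  have h3 : ∑ i, (tangVec Ω (tangDivMat Ω (tangMat Ω (nThird Ω f))) x + curvVec Ω f x +
        tangVec Ω (nHess Ω (lap Ω f)) x) i * tpd Ω i φ x =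
      ∑ i, tangVec Ω (tangDivMat Ω (tangMat Ω (nThird Ω f))) x i * pd Ω i φ x +
        ∑ i, curvVec Ω f x i * pd Ω i φ x +
        ∑ i, tangVec Ω (nHess Ω (lap Ω f)) x i * pd Ω i φ x := by
    simp only [PiLp.add_apply, add_mul, Finset.sum_add_distrib]
    rw [sum_mul_tpd_eq hNx (sum_normal_mul_tangVec hNx _) hφc,
      sum_mul_tpd_eq hNx (sum_normal_mul_curvVec hn hN hx) hφc,
      sum_mul_tpd_eq hNx (sum_normal_mul_tangVec hNx _) hφc]
  -- a tangential part pairs with `∇φ` up to a normal contribution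
  have h4 : ∀ v : Rn N → Rn N, ∑ i, tangVec Ω v x i * pd Ω i φ x =
      ∑ i, v x i * pd Ω i φ x - (∑ k, normal Ω x k * v x k) * dn Ω φ x := by
    intro v
    simp only [tangVec_apply, sub_mul, Finset.sum_sub_distrib, dn, Finset.mul_sum]
    congr 1
    exact Finset.sum_congr rfl fun i _ => by ring
  have h5 : ∀ j, tangDiv Ω (tangRow Ω f j) x = tangDivMat Ω (tangMat Ω (nThird Ω f)) x j :=
    fun j => rfl
  -- `nᵀD³f : D²φ` splits into tangential and normal parts
  have h6 : colon (nThird Ω f x) (hess Ω φ x) =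
      ∑ j, ∑ i, tangRow Ω f j x i * hess Ω φ x i j +
      ∑ j, normal Ω x j * ∑ i, tangVec Ω (thirdNN Ω f) x i * hess Ω φ x i j +
      dnnn Ω f x * dnn Ω φ x := by
    have hH : ∀ i j, hess Ω φ x i j = hess Ω φ x j i := fun i j => pd_comm hΩ hud hφ2 i j hxc
    have e1 : ∀ j, ∑ i, tangRow Ω f j x i * hess Ω φ x i j =
        ∑ k, nThird Ω f x j k * hess Ω φ x j k -
          thirdNN Ω f x j * ∑ i, normal Ω x i * hess Ω φ x i j := by
      intro j
      have : ∀ i, tangRow Ω f j x i = nThird Ω f x j i - thirdNN Ω f x j * normal Ω x i := by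
        intro i
        rw [← sum_nThird_mul_normal hΩ hud hf3 hxc j]
        exact tangMat_apply _ x j i
      simp only [this, sub_mul, Finset.sum_sub_distrib, Finset.mul_sum]
      congr 1
      · exact Finset.sum_congr rfl fun i _ => by rw [hH]
      · exact Finset.sum_congr rfl fun i _ => by ring
    have e2 : ∑ j, normal Ω x j * ∑ i, tangVec Ω (thirdNN Ω f) x i * hess Ω φ x i j =
        ∑ j, thirdNN Ω f x j * ∑ i, normal Ω x i * hess Ω φ x i j - dnnn Ω f x * dnn Ω φ x := by
      simp only [tangVec_apply, sum_normal_mul_thirdNN, sub_mul, Finset.sum_sub_distrib, mul_sub,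
        dnn, Finset.mul_sum]
      congr 1
      · rw [Finset.sum_comm]
        exact Finset.sum_congr rfl fun i _ => Finset.sum_congr rfl fun j _ => by
          rw [hH i j]; ring
      · rw [Finset.sum_comm]
        exact Finset.sum_congr rfl fun i _ => Finset.sum_congr rfl fun j _ => by ring
    simp only [e1, Finset.sum_sub_distrib, e2]
    rw [colon]
    ring
  have h7 := sum_normal_mul_tangDivMat hΩ hud hn hN hf hx
  rw [hdiv, h6, h2, h3, h4, h4, h7, sum_normal_mul_nHess, coeffNormal, coeffValue, tangDivTwo]
  simp only [h1, h5, Finset.sum_add_distrib]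
  have h8 : ∑ j, pd Ω j φ x * tangDivMat Ω (tangMat Ω (nThird Ω f)) x j =
      ∑ j, tangDivMat Ω (tangMat Ω (nThird Ω f)) x j * pd Ω j φ x :=
    Finset.sum_congr rfl fun j _ => mul_comm _ _
  have h9 : tangDiv Ω (fun y => WithLp.toLp 2
        (curvature Ω y *ᵥ (tangVec Ω (thirdNN Ω f) y : Fin N → ℝ))) x =
      tangDiv Ω (curvVec Ω f) x := rfl
  rw [h8, h9]
  ring

end Identity

end SecondFormula

/-! ### Integrating the boundary terms -/

/-- The two formulas express the same boundary integral, once tangential divergences are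
discarded. -/
theorem boundary_integral_eq {N : ℕ} {Ω : Set (Rn N)} (hΩ : IsOpen Ω)
    (hb : Bornology.IsBounded Ω) (hL : HasLipschitzBoundary Ω) (hC : HasContDiffBoundary 3 Ω)
    {f φ : Rn N → ℝ} (hf : ContDiffOn ℝ 6 f (closure Ω)) (hφ : ContDiffOn ℝ 3 φ (closure Ω)) :
    Integrable (fun x => dnnn Ω f x * dnn Ω φ x) (surfaceMeasure Ω) ∧
      Integrable (fun x => coeffNormal Ω f x * dn Ω φ x) (surfaceMeasure Ω) ∧
      Integrable (fun x => coeffValue Ω f x * φ x) (surfaceMeasure Ω) ∧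
      ∫ x, (colon (nThird Ω f x) (hess Ω φ x) - ∑ k, nHess Ω (lap Ω f) x k * pd Ω k φ x +
          dn Ω (lap Ω (lap Ω f)) x * φ x) ∂(surfaceMeasure Ω) =
        ∫ x, dnnn Ω f x * dnn Ω φ x ∂(surfaceMeasure Ω) +
          ∫ x, coeffNormal Ω f x * dn Ω φ x ∂(surfaceMeasure Ω) +
          ∫ x, coeffValue Ω f x * φ x ∂(surfaceMeasure Ω) := by
  have hud := uniqueDiffOn_closure hΩ hL
  have := isFiniteMeasure_surfaceMeasure hΩ hb hL
  have hN : ∀ x ∈ frontier Ω, IsOuterUnitNormal Ω x (normal Ω x) := fun x hx =>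
    isOuterUnitNormal_of_contDiff hΩ hC hx
  have hn : ContDiffOn ℝ (2 : ℕ) (normal Ω) (frontier Ω) := contDiffOn_normal hΩ hC
  have hn0 : ContDiffOn ℝ (0 : ℕ) (normal Ω) (frontier Ω) := hn.of_le (by norm_num)
  have hni : ∀ i, ContinuousOn (fun x => normal Ω x i) (frontier Ω) := fun i =>
    (contDiffOn_euclidean.1 hn i).continuousOn
  obtain ⟨-, -, -, -, hdnnlap, -, -⟩ := triharmonic_green hΩ hb hL hf hφ
  have hdiv : ∀ {v : Rn N → Rn N}, ContDiffOn ℝ (1 : ℕ) v (frontier Ω) →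
      MemLp (tangDiv Ω v) ⊤ (surfaceMeasure Ω) := fun hv =>
    memLp_top_of_continuousOn_frontier hb (contDiffOn_tangDiv hn0 hN hv).continuousOn
  have hφm : MemLp φ ⊤ (surfaceMeasure Ω) := memLp_top_of_continuousOn_frontier hb
    (hφ.continuousOn.mono frontier_subset_closure)
  have hdnφ : MemLp (dn Ω φ) ⊤ (surfaceMeasure Ω) :=
    memLp_top_dn hΩ hb hL (hφ.of_le (by norm_num))
  have hdnlap : MemLp (dn Ω (lap Ω (lap Ω f))) ⊤ (surfaceMeasure Ω) := by
    have h4 : ContDiffOn ℝ (4 : ℕ) (lap Ω f) (closure Ω) :=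
      contDiffOn_lap (n := 6) hud hf (by norm_num)
    have h1 : ContDiffOn ℝ (1 : ℕ) (lap Ω (lap Ω f)) (closure Ω) :=
      contDiffOn_lap hud h4 (by norm_num)
    exact memLp_top_dn hΩ hb hL h1
  have hdnnφ : MemLp (dnn Ω φ) ⊤ (surfaceMeasure Ω) := by
    refine memLp_top_of_continuousOn_frontier hb ?_
    have h2 : ∀ j, ContDiffOn ℝ (2 : ℕ) (pd Ω j φ) (closure Ω) := fun j =>
      contDiffOn_pd hud hφ (by norm_num) j
    have h1 : ∀ i j, ContinuousOn (pd Ω i (pd Ω j φ)) (frontier Ω) := fun i j =>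
      (contDiffOn_pd (m := 1) hud (h2 j) (by norm_num) i).continuousOn.mono
        frontier_subset_closure
    exact continuousOn_finsetSum _ fun i _ => continuousOn_finsetSum _ fun j _ =>
      ((hni i).mul (hni j)).mul (h1 i j)
  have hdnnn : MemLp (dnnn Ω f) ⊤ (surfaceMeasure Ω) :=
    memLp_top_of_continuousOn_frontier hb <| continuousOn_finsetSum _ fun i _ =>
      continuousOn_finsetSum _ fun j _ => continuousOn_finsetSum _ fun k _ =>
        (((hni i).mul (hni j)).mul (hni k)).mul (contDiffOn_third hud hf i j k).continuousOn
  have hcolon : MemLp (fun x => colon (tangMat Ω (nThird Ω f) x) (curvature Ω x)) ⊤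
      (surfaceMeasure Ω) :=
    memLp_top_of_continuousOn_frontier hb <| continuousOn_finsetSum _ fun i _ =>
      continuousOn_finsetSum _ fun j _ =>
        (contDiffOn_tangMat hn (contDiffOn_nThird hud hn hf) i j).continuousOn.mul
          (contDiffOn_curvature hn hN i j).continuousOn
  have hcn : MemLp (coeffNormal Ω f) ⊤ (surfaceMeasure Ω) :=
    (hcolon.sub hdnnlap).sub
      ((hdiv ((contDiffOn_tangVec_thirdNN hud hn hf).of_le (by norm_num))).const_mul 2)
  have hcv : MemLp (coeffValue Ω f) ⊤ (surfaceMeasure Ω) :=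
    (((hdiv (contDiffOn_tangVec_tangDivMat hud hn hN hf)).add
      (hdiv (contDiffOn_curvVec hud hn hN hf))).add hdnlap).add
      (hdiv (contDiffOn_tangVec_nHess_lap hud hn hf))
  have hw := contDiffOn_boundaryField hud hn hN hf hφ
  have i1 := (memLp_top_mul hdnnn hdnnφ).integrable le_top
  have i2 := (memLp_top_mul hcn hdnφ).integrable le_top
  have i3 := (memLp_top_mul hcv hφm).integrable le_top
  have i4 := (hdiv hw).integrable le_top
  have i12 : Integrable (fun x => dnnn Ω f x * dnn Ω φ x + coeffNormal Ω f x * dn Ω φ x)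
      (surfaceMeasure Ω) := i1.add i2
  have i123 : Integrable (fun x => dnnn Ω f x * dnn Ω φ x + coeffNormal Ω f x * dn Ω φ x +
      coeffValue Ω f x * φ x) (surfaceMeasure Ω) := i12.add i3
  refine ⟨i1, i2, i3, ?_⟩
  rw [integral_congr_ae (μ := surfaceMeasure Ω) (ae_restrict_of_forall_mem
      isClosed_frontier.measurableSet fun x hx => boundary_integrand_eq hΩ hud hn hN hf hφ hx),
    integral_add i123 i4, integral_add i12 i3, integral_add i1 i2,
    integral_tangDiv_eq_zero hΩ hb hL hC hw fun x hx => inner_normal_boundaryField hn hN hx,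
    add_zero]

end TriharmonicGreen

end

theorem mainTheorem3 {N : ℕ} (hN : 1 ≤ N) (Ω : Set (Rn N))
    (hΩ : IsBoundedDomain Ω) (hLip : HasLipschitzBoundary Ω)
    (f φ : Rn N → ℝ)
    (hf : ContDiffOn ℝ 6 f (closure Ω)) (hφ : ContDiffOn ℝ 3 φ (closure Ω)) :
    -- all the integrals in the first formula converge absolutely, and the formula holds
    (IntegrableOn (thirdColon Ω f φ) Ω ∧
      IntegrableOn (fun x => lap Ω (lap Ω
        (lap Ω f)) x * φ x) Ω ∧
      Integrable (fun x => colon (nThird Ω f x)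
        (hess Ω φ x)) (surfaceMeasure Ω) ∧
      Integrable (fun x => inner ℝ
        (tangVec Ω (nHess Ω (lap Ω f)) x)
        (tangGrad Ω φ x)) (surfaceMeasure Ω) ∧
      Integrable (fun x => dnn Ω (lap Ω f) x *
        dn Ω φ x) (surfaceMeasure Ω) ∧
      Integrable (fun x => dn Ω (lap Ω
        (lap Ω f)) x * φ x) (surfaceMeasure Ω) ∧
      ∫ x in Ω, thirdColon Ω f φ x =
        - (∫ x in Ω, lap Ω (lap Ω
            (lap Ω f)) x * φ x)
        + (∫ x, colon (nThird Ω f x)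
            (hess Ω φ x) ∂(surfaceMeasure Ω))
        - (∫ x, inner ℝ
            (tangVec Ω (nHess Ω (lap Ω f)) x)
            (tangGrad Ω φ x) ∂(surfaceMeasure Ω))
        - (∫ x, dnn Ω (lap Ω f) x *
            dn Ω φ x ∂(surfaceMeasure Ω))
        + (∫ x, dn Ω (lap Ω
            (lap Ω f)) x * φ x ∂(surfaceMeasure Ω))) ∧
    -- the same for the second formula, on a domain of class `C³`
    (HasContDiffBoundary 3 Ω →
      Integrable (fun x => dnnn Ω f x * dnn Ω φ x)
        (surfaceMeasure Ω) ∧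
      Integrable (fun x => coeffNormal Ω f x * dn Ω φ x)
        (surfaceMeasure Ω) ∧
      Integrable (fun x => coeffValue Ω f x * φ x)
        (surfaceMeasure Ω) ∧
      ∫ x in Ω, thirdColon Ω f φ x =
        - (∫ x in Ω, lap Ω (lap Ω
            (lap Ω f)) x * φ x)
        + (∫ x, dnnn Ω f x * dnn Ω φ x
            ∂(surfaceMeasure Ω))
        + (∫ x, coeffNormal Ω f x * dn Ω φ x
            ∂(surfaceMeasure Ω))
        + (∫ x, coeffValue Ω f x * φ x
            ∂(surfaceMeasure Ω))) := by
  obtain ⟨hΩo, -, hb⟩ := hΩ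
  have := isFiniteMeasure_surfaceMeasure hΩo hb hLip
  obtain ⟨v1, v2, m1, m2, m3, m4, hG⟩ := triharmonic_green hΩo hb hLip hf hφ
  have i1 := m1.integrable le_top
  have i2 := m2.integrable le_top
  have i3 := (memLp_top_mul m3 (memLp_top_dn hΩo hb hLip (hφ.of_le (by norm_num)))).integrable
    le_top
  have i4 := m4.integrable le_top
  have hae : (fun x => ∑ k, nHess Ω (lap Ω f) x k * pd Ω k φ x - dnn Ω (lap Ω f) x * dn Ω φ x)
      =ᵐ[surfaceMeasure Ω]
        fun x => inner ℝ (tangVec Ω (nHess Ω (lap Ω f)) x) (tangGrad Ω φ x) := by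
    filter_upwards [ae_isOuterUnitNormal hΩo hb hLip] with x hx
    rw [inner_tangVec_tangGrad hx, sum_normal_mul_nHess]
  refine ⟨⟨v1, v2, i1, (i2.sub i3).congr hae, i3, i4, ?_⟩, fun hC => ?_⟩
  · rw [hG, ← integral_congr_ae hae, integral_sub i2 i3]
    ring
  · obtain ⟨j1, j2, j3, hB⟩ := boundary_integral_eq hΩo hb hLip hC hf hφ
    refine ⟨j1, j2, j3, ?_⟩
    have i12 : Integrable (fun x => colon (nThird Ω f x) (hess Ω φ x) -
        ∑ k, nHess Ω (lap Ω f) x k * pd Ω k φ x) (surfaceMeasure Ω) := i1.sub i2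
    rw [integral_add i12 i4, integral_sub i1 i2] at hB
    rw [hG]
    linarith
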